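/- Let $k \ge 5$. All graphs are finite, simple, non-empty and connected. A graph $G$ is an \emph{$SC_k$ graph} if every induced cycle of $G$ has length exactly $k$ (graphs without cycles included). A graph is \emph{chordal} if it has no induced cycle of length at least $4$, and the \emph{minimum fill-in} of $G$ is the minimum number of edges whose addition makes $G$ chordal. For $n \ge 3$ let $CAGE(n,l)$ be the graph that consists of two vertices joined by $n$ internally disjoint paths with $l$ vertices each. The \emph{components} of the decomposition of $G$ are the maximal connected induced subgraphs that are not disconnected by the removal of a clique with one or two vertices. The algorithm \emph{Fill-in} chooses, in every component that is a cycle $C_k$, an arbitrary vertex and, if $k$ is even, in every component that is a $CAGE(n,\frac k2+1)$ with $n\ge 3$, a vertex of maximum degree in this component, and makes the chosen vertex adjacent to all the other vertices of the component. Minimum fill-in is solvable in polynomial time on $SC_k$ graphs, by the algorithm Fill-in. That is: (1) For every $SC_k$ graph $G$, whatever choices the algorithm makes, its output is a chordal graph that is obtained from $G$ by adding the minimum possible number of edges. This number is $$a(k-3)+\sum_{i=1}^{s}\Bigl(n_i\bigl(\tfrac k2-2\bigr)+1\Bigr),$$ where $a$ is the number of components of $G$ that are cycles $C_k$, and $CAGE(n_1,\frac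 k2+1),\dots,CAGE(n_s,\frac k2+1)$ are the components of $G$ that are cages (there are none if $k$ is odd). (2) There is a random access machine program (with addition and subtraction, under the unit-cost measure) which, for all $k\ge5$ and given the adjacency matrix of any $SC_k$ graph $G$ on $n$ vertices, computes an output of Fill-in on $G$ together with the minimum fill-in of $G$, in a number of steps bounded by a fixed polynomial in $n$. -/

import Mathlib

namespace SCGraph

/-! ## Chordal graphs, strictly chordality-`k` graphs, minimum fill-in -/

/-- A graph is chordal if it has no induced cycle of length at least four. -/
def IsChordal {V : Type*} (G : SimpleGraph V) : Prop :=
  ∀ m : ℕ, 4 ≤ m → ¬ (SimpleGraph.cycleGraph m).IsIndContained G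

/-- A (connected) strictly chordality-`k` graph: every induced cycle, if there is any, has
length exactly `k`. -/
def IsSC {V : Type*} (k : ℕ) (G : SimpleGraph V) : Prop :=
  G.Connected ∧ ∀ m : ℕ, 3 ≤ m → (SimpleGraph.cycleGraph m).IsIndContained G → m = k

/-- The number of edges of `H` that are not edges of `G`. -/
noncomputable def addedEdges {V : Type*} (G H : SimpleGraph V) : ℕ :=
  (H.edgeSet \ G.edgeSet).ncard

/-- The numbers of edges whose addition can make `G` chordal. The minimum fill-in of `G` is the
least element of this set. -/
def fillInSizes {V : Type*} (G : SimpleGraph V) : Set ℕ :=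
  {m | ∃ H : SimpleGraph V, G ≤ H ∧ IsChordal H ∧ addedEdges G H = m}

/-! ## The decomposition by clique separators of size one and two -/

/-- The subgraph of `G` induced on `A` is connected, and removing a clique with at most two
vertices never disconnects it. -/
def IsPrimeOn {V : Type*} (G : SimpleGraph V) (A : Set V) : Prop :=
  (G.induce A).Connected ∧
    ∀ S : Set V, S ⊆ A → G.IsClique S → S.ncard ≤ 2 → (G.induce (A \ S)).Preconnected

/-- The components of the decomposition of `G` along clique separators of size one and two:
the maximal connected induced subgraphs without such a separator (given by vertex sets). -/
def IsComponent {V : Type*} (G : SimpleGraph V) (A : Set V) : Prop :=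
  Maximal (IsPrimeOn G) A

/-- The cage graph `CAGE(n, l)`: two end vertices (`Sum.inl false` and `Sum.inl true`), joined by
`n` internally disjoint paths, each of which has `l - 2` internal vertices
(`Sum.inr (i, 0)`, `Sum.inr (i, 1)`, …), so that each path has `l` vertices altogether. -/
def cage (n l : ℕ) : SimpleGraph (Bool ⊕ Fin n × Fin (l - 2)) :=
  SimpleGraph.fromRel fun x y =>
    match x, y with
    | Sum.inl false, Sum.inr (_, j) => (j : ℕ) = 0
    | Sum.inl true, Sum.inr (_, j) => (j : ℕ) + 1 = l - 2
    | Sum.inr (i, j), Sum.inr (i', j') => i = i' ∧ (j : ℕ) + 1 = j'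
    | _, _ => False

/-- `A` is a component of the decomposition of `G` that is a cycle `C_k`. -/
def IsCycleComponent {V : Type*} (k : ℕ) (G : SimpleGraph V) (A : Set V) : Prop :=
  IsComponent G A ∧ Nonempty (SimpleGraph.cycleGraph k ≃g G.induce A)

/-- `k` is even and `A` is a component of the decomposition of `G` that is a cage
`CAGE(n, k/2 + 1)`, where `n ≥ 3`. -/
def IsCageComponent {V : Type*} (k : ℕ) (G : SimpleGraph V) (A : Set V) (n : ℕ) : Prop :=
  IsComponent G A ∧ Even k ∧ 3 ≤ n ∧ Nonempty (cage n (k / 2 + 1) ≃g G.induce A)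

/-! ## The algorithm Fill-in -/

/-- `u` is a vertex of maximum degree of the subgraph of `G` induced on `A`. -/
def IsMaxDegreeIn {V : Type*} (G : SimpleGraph V) (A : Set V) (u : V) : Prop :=
  u ∈ A ∧ ∀ v ∈ A, (G.neighborSet v ∩ A).ncard ≤ (G.neighborSet u ∩ A).ncard

/-- `H` is a possible output of the algorithm Fill-in on the input `G`: in every component that is
a cycle `C_k` an arbitrary vertex, and in every component that is a cage a vertex of maximum
degree, is chosen and made adjacent to all the other vertices of this component. The function
`hub` records the choices. -/
def IsFillInOutput {V : Type*} (k : ℕ) (G H : SimpleGraph V) : Prop :=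
  ∃ hub : Set V → V,
    (∀ A, IsCycleComponent k G A → hub A ∈ A) ∧
    (∀ A n, IsCageComponent k G A n → IsMaxDegreeIn G A (hub A)) ∧
    H = G ⊔ SimpleGraph.fromRel fun u v =>
      ∃ A, (IsCycleComponent k G A ∨ ∃ n, IsCageComponent k G A n) ∧ u = hub A ∧ v ∈ A

/-- `a (k - 3) + ∑ᵢ (nᵢ (k / 2 - 2) + 1)`, where `a` is the number of the components that are
cycles `C_k`, and the sum is over the components `CAGE(nᵢ, k/2 + 1)`. -/
noncomputable def fillInCount {V : Type*} (k : ℕ) (G : SimpleGraph V) : ℕ :=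
  {A | IsCycleComponent k G A}.ncard * (k - 3) +
    ∑ᶠ q ∈ {q : Set V × ℕ | IsCageComponent k G q.1 q.2}, (q.2 * (k / 2 - 2) + 1)

/-! ## Random access machines

Structured programs for a random access machine with addition and (truncated) subtraction, under
the unit-cost measure. As one step increases the length of the largest number by at most one bit,
polynomially many steps here are the same as polynomial time on Turing machines. -/

/-- A state: the values of the registers and the contents of the memory. -/
structure RamState where
  reg : ℕ → ℕ
  mem : ℕ → ℕ

/-- Programs. Registers are named by natural numbers. -/
inductive RamProg where
  /-- `reg x := c`, for a literal `c` -/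
  | const (x c : ℕ)
  /-- `reg x := reg y` -/
  | copy (x y : ℕ)
  /-- `reg x := reg y + reg z` -/
  | add (x y z : ℕ)
  /-- `reg x := reg y - reg z` (zero if `reg y < reg z`) -/
  | sub (x y z : ℕ)
  /-- `reg x := mem (reg y)` -/
  | load (x y : ℕ)
  /-- `mem (reg x) := reg y` -/
  | store (x y : ℕ)
  /-- first `p`, then `q` -/
  | seq (p q : RamProg)
  /-- if `reg x ≠ 0` then `p` else `q` -/
  | ite (x : ℕ) (p q : RamProg)
  /-- while `reg x ≠ 0` do `p` -/
  | loop (x : ℕ) (p : RamProg)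

/-- The state after `reg x := a`. -/
def RamState.setReg (s : RamState) (x a : ℕ) : RamState :=
  { s with reg := Function.update s.reg x a }

/-- The state after `mem i := a`. -/
def RamState.setMem (s : RamState) (i a : ℕ) : RamState :=
  { s with mem := Function.update s.mem i a }

/-- `Runs p s s' t`: started in the state `s`, the program `p` halts after exactly `t` steps, in
the state `s'`. Every elementary instruction and every test takes one step. -/
inductive Runs : RamProg → RamState → RamState → ℕ → Prop where
  | const (x c : ℕ) (s : RamState) : Runs (.const x c) s (s.setReg x c) 1
  | copy (x y : ℕ) (s : RamState) : Runs (.copy x y) s (s.setReg x (s.reg y)) 1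
  | add (x y z : ℕ) (s : RamState) : Runs (.add x y z) s (s.setReg x (s.reg y + s.reg z)) 1
  | sub (x y z : ℕ) (s : RamState) : Runs (.sub x y z) s (s.setReg x (s.reg y - s.reg z)) 1
  | load (x y : ℕ) (s : RamState) : Runs (.load x y) s (s.setReg x (s.mem (s.reg y))) 1
  | store (x y : ℕ) (s : RamState) : Runs (.store x y) s (s.setMem (s.reg x) (s.reg y)) 1
  | seq {p q : RamProg} {s s' s'' : RamState} {t t' : ℕ} :
      Runs p s s' t → Runs q s' s'' t' → Runs (.seq p q) s s'' (t + t')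
  | iteTrue {x : ℕ} {p q : RamProg} {s s' : RamState} {t : ℕ} :
      s.reg x ≠ 0 → Runs p s s' t → Runs (.ite x p q) s s' (t + 1)
  | iteFalse {x : ℕ} {p q : RamProg} {s s' : RamState} {t : ℕ} :
      s.reg x = 0 → Runs q s s' t → Runs (.ite x p q) s s' (t + 1)
  | loopDone {x : ℕ} {p : RamProg} {s : RamState} :
      s.reg x = 0 → Runs (.loop x p) s s 1
  | loopStep {x : ℕ} {p : RamProg} {s s' s'' : RamState} {t t' : ℕ} :
      s.reg x ≠ 0 → Runs p s s' t → Runs (.loop x p) s' s'' t' →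
        Runs (.loop x p) s s'' (t + t' + 1)

open Classical in
/-- The entry `i` of the adjacency matrix of `G`, stored row by row: the entry at `n * u + v` is
one if `u` and `v` are adjacent, and zero otherwise. All entries from `n * n` on are zero. -/
noncomputable def adjEntry {n : ℕ} (G : SimpleGraph (Fin n)) (i : ℕ) : ℕ :=
  if ∃ u v : Fin n, G.Adj u v ∧ i = n * (u : ℕ) + (v : ℕ) then 1 else 0

/-- The initial state for the input `G`: the register `0` holds the number `n` of vertices, the
memory holds the adjacency matrix of `G`, and everything else is zero. -/
noncomputable def inputState {n : ℕ} (G : SimpleGraph (Fin n)) : RamState where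
  reg x := if x = 0 then n else 0
  mem := adjEntry G

/-- In the state `s` the cells `0, …, n² - 1` of the memory hold the adjacency matrix of `H`. -/
def HoldsGraph {n : ℕ} (s : RamState) (H : SimpleGraph (Fin n)) : Prop :=
  ∀ i : ℕ, i < n * n → s.mem i = adjEntry H i

end SCGraph

namespace SCGraph

/-! Structure. Since `k ≥ 5`, an `SC_k` graph has no triangles, so its cliques have at most two
vertices and a prime set has no clique separator at all. A prime set that is not a clique contains
an induced cycle of length `k`. If some vertex of the prime set is not on this cycle, then a
shortest walk that avoids the cycle and joins two nonadjacent vertices of it is an ear. The ear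
closes an induced cycle with each of the two arcs, so the ear and both arcs have length `k / 2` and
form a cage with three paths. A further ear must join the same two ends: anywhere else, a detour
through a third path would give an induced cycle longer than `k`. Hence components are cliques,
cycles or cages (`IsSC.cycle_or_cage`).

Chordality. Deleting the chosen vertex, the hub, from a cycle or a cage leaves a forest. The
vertices of an induced cycle of length at least four in the output are pairwise inseparable in `G`,
so they lie in one component. The cycle avoids the hub, which is adjacent to everything there, so it
would be a cycle in the forest (`IsSC.isChordal_hubGraph`).

Optimality. Let a cycle or cage component have `N` vertices and let `d` be the degree of its hub
within it. A chordal supergraph of `G` induces on it a connected graph without cut vertices, and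
such a chordal graph has at least `2N - 3` edges (`IsChordal.two_mul_le_edges`, by removing
simplicial vertices). As the component without the hub is a forest, `G` has at most `d + N - 2`
edges there. The difference `N - 1 - d` is the number of vertices to which the algorithm joins the
hub. Distinct components share only cliques, so no missing edge lies in two of them and the local
bounds add up.

Computation. A component with nonadjacent vertices `x` and `y` consists of the vertices inseparable
from both (`IsComponent.eq_setOf_insep`), and inseparability is decided by deleting every clique of
one or two vertices and searching. No decomposition has to be constructed, and a vertex of maximum
degree is admissible in cycles as well as in cages, so neither `k` nor the shape of a component is
consulted. The program is written in a small language in which every loop runs `n` times; its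
compiled code is therefore polynomial by construction (`Cmd.runs_compile`). -/

/-- `p 0, …, p d` is a walk from `x` to `y` whose inner vertices are in `A`. -/
structure WalkIn {V : Type*} (G : SimpleGraph V) (A : Set V) (x y : V) (d : ℕ) (p : ℕ → V) :
    Prop where
  zero : p 0 = x
  last : p d = y
  adj : ∀ i, i < d → G.Adj (p i) (p (i + 1))
  mem : ∀ i, 0 < i → i < d → p i ∈ A

/-- There is a walk from `x` to `y` whose inner vertices are in `A`. -/
def Linked {V : Type*} (G : SimpleGraph V) (A : Set V) (x y : V) : Prop :=
  ∃ d p, WalkIn G A x y d p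

/-- `p 0, …, p d` are the consecutive vertices of an induced path. -/
structure IndPath {V : Type*} (G : SimpleGraph V) (p : ℕ → V) (d : ℕ) : Prop where
  inj : ∀ i j, i < j → j ≤ d → p i ≠ p j
  adj : ∀ i j, i < j → j ≤ d → (G.Adj (p i) (p j) ↔ j = i + 1)

/-- `f 0, …, f (m - 1)` are the consecutive vertices of an induced cycle. -/
structure IndCyc {V : Type*} (G : SimpleGraph V) (f : ℕ → V) (m : ℕ) : Prop where
  three_le : 3 ≤ m
  inj : ∀ i j, i < j → j < m → f i ≠ f j
  adj : ∀ i j, i < j → j < m → (G.Adj (f i) (f j) ↔ j = i + 1 ∨ (i = 0 ∧ j + 1 = m))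

/-! ### Walks, induced paths and induced cycles as sequences of vertices -/

section Paths

variable {V : Type*} {G : SimpleGraph V} {A B : Set V} {x y z : V} {d e m : ℕ} {p q f : ℕ → V}

theorem WalkIn.mono (h : WalkIn G A x y d p) (hAB : ∀ v ∈ A, v ∈ B) : WalkIn G B x y d p :=
  ⟨h.zero, h.last, h.adj, fun i h0 h1 => hAB _ (h.mem i h0 h1)⟩

theorem WalkIn.reverse (h : WalkIn G A x y d p) : WalkIn G A y x d (fun i => p (d - i)) := by
  refine ⟨by simpa using h.last, by simpa using h.zero, fun i hi => ?_, fun i h0 h1 => ?_⟩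
  · have := h.adj (d - (i + 1)) (by omega)
    rw [show d - (i + 1) + 1 = d - i by omega] at this
    exact this.symm
  · exact h.mem _ (by omega) (by omega)

theorem WalkIn.append (h : WalkIn G A x y d p) (h' : WalkIn G A y z e q) (hy : y ∈ A) :
    WalkIn G A x z (d + e) (fun i => if i ≤ d then p i else q (i - d)) := by
  refine ⟨by simpa using h.zero, ?_, fun i hi => ?_, fun i h0 h1 => ?_⟩
  · by_cases he : e = 0
    · subst he; have := h'.zero; have := h'.last; have := h.last; simp_all
    · simp only [show ¬ d + e ≤ d by omega, if_false, show d + e - d = e by omega, h'.last]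
  · rcases lt_trichotomy i d with hid | hid | hid
    · simpa [hid.le, Nat.succ_le_of_lt hid] using h.adj i hid
    · subst hid
      have := h'.adj 0 (by omega)
      rw [h'.zero, ← h.last] at this
      simpa using this
    · have := h'.adj (i - d) (by omega)
      rw [show i - d + 1 = i + 1 - d by omega] at this
      simpa [show ¬ i ≤ d by omega, show ¬ i + 1 ≤ d by omega] using this
  · rcases lt_trichotomy i d with hid | hid | hid
    · simpa [hid.le] using h.mem i h0 hid
    · subst hid; simpa [h.last] using hy
    · simpa [show ¬ i ≤ d by omega] using h'.mem (i - d) (by omega) (by omega)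

theorem WalkIn.take (h : WalkIn G A x y d p) {i : ℕ} (hi : i ≤ d) : WalkIn G A x (p i) i p :=
  ⟨h.zero, rfl, fun j hj => h.adj j (by omega), fun j h0 h1 => h.mem j h0 (by omega)⟩

theorem WalkIn.drop (h : WalkIn G A x y d p) {i : ℕ} (hi : i ≤ d) :
    WalkIn G A (p i) y (d - i) (fun j => p (i + j)) := by
  refine ⟨by simp, by simp [show i + (d - i) = d by omega, h.last], fun j hj => ?_,
    fun j h0 h1 => h.mem _ (by omega) (by omega)⟩
  simpa [add_assoc] using h.adj (i + j) (by omega)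

theorem walkIn_single (h : G.Adj x y) : WalkIn G A x y 1 (fun i => if i = 0 then x else y) :=
  ⟨by simp, by simp, fun i hi => by simp [show i = 0 by omega, h], fun i h0 h1 => by omega⟩

theorem Linked.refl : Linked G A x x :=
  ⟨0, fun _ => x, rfl, rfl, fun _ h => by omega, fun _ _ h => by omega⟩

theorem Linked.of_adj (h : G.Adj x y) : Linked G A x y := ⟨1, _, walkIn_single h⟩

theorem Linked.mono (h : Linked G A x y) (hAB : ∀ v ∈ A, v ∈ B) : Linked G B x y :=
  let ⟨d, p, hp⟩ := h; ⟨d, p, hp.mono hAB⟩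

theorem Linked.symm (h : Linked G A x y) : Linked G A y x :=
  let ⟨d, _, hp⟩ := h; ⟨d, _, hp.reverse⟩

theorem Linked.trans (h : Linked G A x y) (h' : Linked G A y z) (hy : y ∈ A) : Linked G A x z :=
  let ⟨_, _, hp⟩ := h; let ⟨_, _, hq⟩ := h'; ⟨_, _, hp.append hq hy⟩

/-- A property that spreads along edges inside `A` spreads along linkages. -/
theorem Linked.induction {P : V → Prop} (h : Linked G A x y) (hx : P x)
    (hstep : ∀ u v, P u → G.Adj u v → (v ∈ A ∨ v = y) → P v) : P y := by
  obtain ⟨d, p, hp⟩ := h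
  have : ∀ i, i ≤ d → P (p i) := by
    intro i
    induction i with
    | zero => intro _; rw [hp.zero]; exact hx
    | succ i ih =>
      intro hi
      refine hstep _ _ (ih (by omega)) (hp.adj i (by omega)) ?_
      rcases Nat.lt_or_ge (i + 1) d with h1 | h1
      · exact Or.inl (hp.mem _ (by omega) h1)
      · right; rw [show i + 1 = d by omega, hp.last]
  rw [← hp.last]; exact this d le_rfl

theorem preconnected_induce_iff :
    (G.induce A).Preconnected ↔ ∀ x ∈ A, ∀ y ∈ A, Linked G A x y := by
  constructor
  · intro h x hx y hy
    obtain ⟨w⟩ := h ⟨x, hx⟩ ⟨y, hy⟩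
    have key : ∀ (a b : A), (G.induce A).Walk a b → Linked G A a b := by
      intro a b w
      induction w with
      | nil => exact Linked.refl
      | cons hadj _ ih => exact (Linked.of_adj (SimpleGraph.induce_adj.1 hadj)).trans ih (Subtype.prop _)
    exact key _ _ w
  · intro h
    rintro ⟨x, hx⟩ ⟨y, hy⟩
    have key : ∃ hz : y ∈ A, (G.induce A).Reachable ⟨x, hx⟩ ⟨y, hz⟩ := by
      refine (h x hx y hy).induction (P := fun z => ∃ hz : z ∈ A, (G.induce A).Reachable ⟨x, hx⟩
        ⟨z, hz⟩) ⟨hx, SimpleGraph.Reachable.refl _⟩ ?_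
      rintro u v ⟨hu, hr⟩ hadj hv
      have hvA : v ∈ A := hv.elim id (fun e => e ▸ hy)
      exact ⟨hvA, hr.trans (SimpleGraph.Adj.reachable (by simpa using hadj))⟩
    exact key.2

theorem WalkIn.shortcut (h : WalkIn G A x y d p) {i j : ℕ} (hij : i < j) (hj : j ≤ d)
    (hadj : G.Adj (p i) (p j)) :
    WalkIn G A x y (d - (j - i - 1)) (fun t => if t ≤ i then p t else p (t + (j - i - 1))) := by
  refine ⟨by simpa using h.zero, ?_, fun t ht => ?_, fun t h0 h1 => ?_⟩
  · simp only [show ¬ d - (j - i - 1) ≤ i by omega, if_false]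
    rw [show d - (j - i - 1) + (j - i - 1) = d by omega, h.last]
  · rcases lt_trichotomy t i with hid | hid | hid
    · simpa [hid.le, Nat.succ_le_of_lt hid] using h.adj t (by omega)
    · subst hid
      simpa [show t + 1 + (j - t - 1) = j by omega] using hadj
    · have := h.adj (t + (j - i - 1)) (by omega)
      simpa [show ¬ t ≤ i by omega, show ¬ t + 1 ≤ i by omega,
        show t + 1 + (j - i - 1) = t + (j - i - 1) + 1 by omega] using this
  · by_cases hti : t ≤ i
    · simpa [hti] using h.mem t h0 (by omega)
    · simpa [hti] using h.mem (t + (j - i - 1)) (by omega) (by omega)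

theorem WalkIn.shortcut_eq (h : WalkIn G A x y d p) {i j : ℕ} (hij : i < j) (hj : j ≤ d)
    (heq : p i = p j) :
    WalkIn G A x y (d - (j - i)) (fun t => if t ≤ i then p t else p (t + (j - i))) := by
  refine ⟨by simpa using h.zero, ?_, fun t ht => ?_, fun t h0 h1 => ?_⟩
  · by_cases hjd : j = d
    · subst hjd
      simp only [show j - (j - i) ≤ i by omega, if_true]
      rw [show j - (j - i) = i by omega, heq, h.last]
    · simp only [show ¬ d - (j - i) ≤ i by omega, if_false]
      rw [show d - (j - i) + (j - i) = d by omega, h.last]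
  · rcases lt_trichotomy t i with hid | hid | hid
    · simpa [hid.le, Nat.succ_le_of_lt hid] using h.adj t (by omega)
    · subst hid
      simpa [show t + 1 + (j - t) = j + 1 by omega, heq] using h.adj j (by omega)
    · have := h.adj (t + (j - i)) (by omega)
      simpa [show ¬ t ≤ i by omega, show ¬ t + 1 ≤ i by omega,
        show t + 1 + (j - i) = t + (j - i) + 1 by omega] using this
  · by_cases hti : t ≤ i
    · simpa [hti] using h.mem t h0 (by omega)
    · simpa [hti] using h.mem (t + (j - i)) (by omega) (by omega)

/-- A repeated vertex or a chord would give a shorter walk. -/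
theorem WalkIn.indPath_of_le (h : WalkIn G A x y d p) (hmin : ∀ d' p', WalkIn G A x y d' p' → d ≤ d') :
    IndPath G p d := by
  refine ⟨fun i j hij hj heq => ?_, fun i j hij hj => ⟨fun hadj => ?_, fun e => ?_⟩⟩
  · have := hmin _ _ (h.shortcut_eq hij hj heq); omega
  · have := hmin _ _ (h.shortcut hij hj hadj); omega
  · subst e; exact h.adj i (by omega)

theorem Linked.exists_shortest (h : Linked G A x y) :
    ∃ d p, WalkIn G A x y d p ∧ IndPath G p d ∧ ∀ d' p', WalkIn G A x y d' p' → d ≤ d' := by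
  classical
  obtain ⟨p, hp⟩ := Nat.find_spec h
  have hmin : ∀ d' p', WalkIn G A x y d' p' → Nat.find h ≤ d' :=
    fun d' p' h' => Nat.find_min' h ⟨p', h'⟩
  exact ⟨_, p, hp, hp.indPath_of_le hmin, hmin⟩

theorem IndPath.inj' (h : IndPath G p d) {i j : ℕ} (hi : i ≤ d) (hj : j ≤ d) (e : p i = p j) :
    i = j := by
  rcases lt_trichotomy i j with hij | hij | hij
  · exact absurd e (h.inj i j hij hj)
  · exact hij
  · exact absurd e.symm (h.inj j i hij hi)

theorem IndPath.adj' (h : IndPath G p d) {i j : ℕ} (hi : i ≤ d) (hj : j ≤ d) :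
    G.Adj (p i) (p j) ↔ j = i + 1 ∨ i = j + 1 := by
  rcases lt_trichotomy i j with hij | hij | hij
  · rw [h.adj i j hij hj]; omega
  · subst hij; simp
  · rw [G.adj_comm, h.adj j i hij hi]; omega

theorem IndPath.of_symm (hinj : ∀ i j, i ≤ d → j ≤ d → p i = p j → i = j)
    (hadj : ∀ i j, i ≤ d → j ≤ d → (G.Adj (p i) (p j) ↔ j = i + 1 ∨ i = j + 1)) :
    IndPath G p d :=
  ⟨fun i j hij hj e => by have := hinj i j (by omega) hj e; omega,
   fun i j hij hj => by rw [hadj i j (by omega) hj]; omega⟩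

theorem IndPath.reverse (h : IndPath G p d) : IndPath G (fun i => p (d - i)) d := by
  refine IndPath.of_symm (fun i j hi hj e => ?_) (fun i j hi hj => ?_)
  · have := h.inj' (by omega) (by omega) e; omega
  · rw [h.adj' (by omega) (by omega)]; omega

theorem IndPath.drop (h : IndPath G p d) {i : ℕ} (hi : i ≤ d) :
    IndPath G (fun t => p (i + t)) (d - i) :=
  ⟨fun a b hab hb => h.inj _ _ (by omega) (by omega),
   fun a b hab hb => by rw [h.adj _ _ (by omega) (by omega)]; omega⟩

theorem IndPath.take (h : IndPath G p d) {i : ℕ} (hi : i ≤ d) : IndPath G p i :=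
  ⟨fun a b hab hb => h.inj _ _ hab (by omega), fun a b hab hb => h.adj _ _ hab (by omega)⟩

theorem IndPath.append (h : IndPath G p d) (h' : IndPath G q e) (hpq : p d = q 0)
    (hne : ∀ i j, i < d → 0 < j → j ≤ e → p i ≠ q j ∧ ¬ G.Adj (p i) (q j)) :
    IndPath G (fun i => if i ≤ d then p i else q (i - d)) (d + e) := by
  refine ⟨fun i j hij hj => ?_, fun i j hij hj => ?_⟩
  · by_cases hjd : j ≤ d
    · simpa [hjd, show i ≤ d by omega] using h.inj i j hij hjd
    · rcases lt_trichotomy i d with hid | hid | hid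
      · simpa [hjd, hid.le] using (hne i (j - d) hid (by omega) (by omega)).1
      · subst hid
        simpa [hjd, hpq] using h'.inj 0 (j - i) (by omega) (by omega)
      · simpa [hjd, show ¬ i ≤ d by omega] using h'.inj (i - d) (j - d) (by omega) (by omega)
  · by_cases hjd : j ≤ d
    · simpa [hjd, show i ≤ d by omega] using h.adj i j hij hjd
    · rcases lt_trichotomy i d with hid | hid | hid
      · have := (hne i (j - d) hid (by omega) (by omega)).2
        simp only [hjd, hid.le, if_true, if_false, this, false_iff]; omega
      · subst hid
        simp only [hjd, le_refl, if_true, if_false, hpq]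
        rw [h'.adj 0 (j - i) (by omega) (by omega)]; omega
      · simp only [hjd, show ¬ i ≤ d by omega, if_false]
        rw [h'.adj (i - d) (j - d) (by omega) (by omega)]; omega

theorem indPath_two (h1 : G.Adj x y) (h2 : G.Adj y z) (h3 : ¬ G.Adj x z) (h4 : x ≠ z) :
    IndPath G (fun i => if i = 0 then x else if i = 1 then y else z) 2 := by
  refine ⟨fun i j hij hj => ?_, fun i j hij hj => ?_⟩
  · have : (i = 0 ∧ j = 1) ∨ (i = 0 ∧ j = 2) ∨ (i = 1 ∧ j = 2) := by omega
    rcases this with ⟨rfl, rfl⟩ | ⟨rfl, rfl⟩ | ⟨rfl, rfl⟩ <;> simp [h1.ne, h2.ne, h4]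
  · have : (i = 0 ∧ j = 1) ∨ (i = 0 ∧ j = 2) ∨ (i = 1 ∧ j = 2) := by omega
    rcases this with ⟨rfl, rfl⟩ | ⟨rfl, rfl⟩ | ⟨rfl, rfl⟩ <;> simp [h1, h2, h3]

theorem IndCyc.inj' (h : IndCyc G f m) {i j : ℕ} (hi : i < m) (hj : j < m) (e : f i = f j) :
    i = j := by
  rcases lt_trichotomy i j with hij | hij | hij
  · exact absurd e (h.inj i j hij hj)
  · exact hij
  · exact absurd e.symm (h.inj j i hij hi)

theorem IndCyc.adj' (h : IndCyc G f m) {i j : ℕ} (hi : i < m) (hj : j < m) :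
    G.Adj (f i) (f j) ↔ j = i + 1 ∨ i = j + 1 ∨ (i = 0 ∧ j + 1 = m) ∨ (j = 0 ∧ i + 1 = m) := by
  rcases lt_trichotomy i j with hij | hij | hij
  · rw [h.adj i j hij hj]; omega
  · subst hij; have := h.three_le; simp; omega
  · rw [G.adj_comm, h.adj j i hij hi]; omega

theorem IndCyc.of_symm (hm : 3 ≤ m) (hinj : ∀ i j, i < m → j < m → f i = f j → i = j)
    (hadj : ∀ i j, i < m → j < m →
      (G.Adj (f i) (f j) ↔ j = i + 1 ∨ i = j + 1 ∨ (i = 0 ∧ j + 1 = m) ∨ (j = 0 ∧ i + 1 = m))) :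
    IndCyc G f m :=
  ⟨hm, fun i j hij hj e => by have := hinj i j (by omega) hj e; omega,
   fun i j hij hj => by rw [hadj i j (by omega) hj]; omega⟩

/-- Turns the residues that come from rotating and reflecting cycles into case distinctions of
linear arithmetic. -/
theorem mod_eq_or {m i : ℕ} (h : i < 2 * m) : i % m = if i < m then i else i - m := by
  split_ifs with h1
  · exact Nat.mod_eq_of_lt h1
  · rw [Nat.mod_eq_sub_mod (by omega), Nat.mod_eq_of_lt (by omega)]

theorem IndCyc.rotate (h : IndCyc G f m) (i : ℕ) (hi : i < m) :
    IndCyc G (fun t => f ((i + t) % m)) m := by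
  have hm := h.three_le
  refine IndCyc.of_symm hm (fun a b ha hb e => ?_) (fun a b ha hb => ?_)
  · have := h.inj' (Nat.mod_lt _ (by omega)) (Nat.mod_lt _ (by omega)) e
    rw [mod_eq_or (by omega), mod_eq_or (by omega)] at this
    split_ifs at this <;> omega
  · rw [h.adj' (Nat.mod_lt _ (by omega)) (Nat.mod_lt _ (by omega)), mod_eq_or (by omega),
      mod_eq_or (by omega)]
    split_ifs <;> omega

theorem IndCyc.reflect (h : IndCyc G f m) : IndCyc G (fun t => f ((m - t) % m)) m := by
  have hm := h.three_le
  refine IndCyc.of_symm hm (fun a b ha hb e => ?_) (fun a b ha hb => ?_)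
  · have := h.inj' (Nat.mod_lt _ (by omega)) (Nat.mod_lt _ (by omega)) e
    rw [mod_eq_or (by omega), mod_eq_or (by omega)] at this
    split_ifs at this <;> omega
  · rw [h.adj' (Nat.mod_lt _ (by omega)) (Nat.mod_lt _ (by omega)), mod_eq_or (by omega),
      mod_eq_or (by omega)]
    split_ifs <;> omega

theorem IndCyc.indPath (h : IndCyc G f m) {j : ℕ} (hj : j + 1 < m) : IndPath G f j :=
  ⟨fun a b hab hb => h.inj _ _ hab (by omega),
   fun a b hab hb => by rw [h.adj _ _ hab (by omega)]; omega⟩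

/-- Two induced paths with the same ends and no other contacts make an induced cycle. -/
theorem IndPath.indCyc (hp : IndPath G p d) (hq : IndPath G q e) (h0 : p 0 = q 0)
    (h1 : p d = q e) (hd : 2 ≤ d) (he : 2 ≤ e)
    (hne : ∀ i j, 0 < i → i < d → 0 < j → j < e → p i ≠ q j ∧ ¬ G.Adj (p i) (q j)) :
    IndCyc G (fun t => if t ≤ d then p t else q (d + e - t)) (d + e) := by
  refine ⟨by omega, fun i j hij hj => ?_, fun i j hij hj => ?_⟩
  · by_cases hjd : j ≤ d
    · simpa [hjd, show i ≤ d by omega] using hp.inj i j hij hjd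
    · by_cases hid : i ≤ d
      · simp only [hjd, hid, if_true, if_false]
        rcases Nat.eq_zero_or_pos i with rfl | hi
        · rw [h0]; exact hq.inj _ _ (by omega) (by omega)
        · rcases hid.eq_or_lt with rfl | hid
          · rw [h1]; exact (hq.inj _ _ (by omega) (by omega)).symm
          · exact (hne _ _ hi hid (by omega) (by omega)).1
      · simp only [hjd, hid, if_false]
        exact (hq.inj _ _ (by omega) (by omega)).symm
  · by_cases hjd : j ≤ d
    · simp only [hjd, show i ≤ d by omega, if_true]
      rw [hp.adj i j hij hjd]; omega
    · by_cases hid : i ≤ d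
      · simp only [hjd, hid, if_true, if_false]
        rcases Nat.eq_zero_or_pos i with rfl | hi
        · rw [h0, hq.adj' (by omega) (by omega)]; omega
        · rcases hid.eq_or_lt with rfl | hid
          · rw [h1, hq.adj' (by omega) (by omega)]; omega
          · simp only [(hne _ _ hi hid (by omega : 0 < d + e - j) (by omega)).2, false_iff]; omega
      · simp only [hjd, hid, if_false]
        rw [hq.adj' (by omega) (by omega)]; omega

theorem cycleGraph_adj_iff {m : ℕ} (hm : 3 ≤ m) (i j : Fin m) :
    (SimpleGraph.cycleGraph m).Adj i j ↔ (j : ℕ) = i + 1 ∨ (i : ℕ) = j + 1 ∨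
      ((i : ℕ) = 0 ∧ (j : ℕ) + 1 = m) ∨ ((j : ℕ) = 0 ∧ (i : ℕ) + 1 = m) := by
  have hi := i.2
  have hj := j.2
  rw [SimpleGraph.cycleGraph_adj', Fin.sub_def, Fin.sub_def]
  simp only
  rw [mod_eq_or (by omega), mod_eq_or (by omega)]
  split_ifs <;> omega

theorem IndCyc.isIndContained (h : IndCyc G f m) : (SimpleGraph.cycleGraph m).IsIndContained G :=
  ⟨{ toFun := fun i => f i
     inj' := fun i j e => Fin.ext (h.inj' i.2 j.2 e)
     map_rel_iff' := by
      intro i j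
      rw [cycleGraph_adj_iff h.three_le]
      exact h.adj' i.2 j.2 }⟩

theorem indCyc_of_embedding (hm : 3 ≤ m) (g : SimpleGraph.cycleGraph m ↪g G) :
    IndCyc G (fun t => g ⟨t % m, Nat.mod_lt _ (by omega)⟩) m := by
  refine IndCyc.of_symm hm (fun i j hi hj e => ?_) (fun i j hi hj => ?_)
  · have := g.injective e
    simpa [Nat.mod_eq_of_lt hi, Nat.mod_eq_of_lt hj] using this
  · rw [g.map_adj_iff, cycleGraph_adj_iff hm]
    simp [Nat.mod_eq_of_lt hi, Nat.mod_eq_of_lt hj]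

theorem isChordal_iff : IsChordal G ↔ ∀ m f, IndCyc G f m → m < 4 := by
  constructor
  · intro h m f hf
    by_contra hm
    exact h m (by omega) hf.isIndContained
  · rintro h m hm ⟨g⟩
    have := h m _ (indCyc_of_embedding (by omega) g)
    omega

end Paths

/-! ### Simplicial vertices and the number of edges of chordal graphs -/

/-- The edges of `G` with both ends in `A`. -/
def edgesIn {V : Type*} (G : SimpleGraph V) (A : Set V) : Set (Sym2 V) :=
  {e | e ∈ G.edgeSet ∧ ∀ v ∈ e, v ∈ A}

/-- The neighbours of `r` in `A` form a clique. -/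
def IsSimplicialIn {V : Type*} (G : SimpleGraph V) (A : Set V) (r : V) : Prop :=
  ∀ a ∈ A, ∀ b ∈ A, G.Adj r a → G.Adj r b → a ≠ b → G.Adj a b

section Chordal

variable {V : Type*} {G : SimpleGraph V} {A : Set V}

theorem mem_edgesIn {a b : V} : s(a, b) ∈ edgesIn G A ↔ G.Adj a b ∧ a ∈ A ∧ b ∈ A := by
  simp [edgesIn]

theorem Linked.exists_adj {x y : V} (h : Linked G A x y) (hxy : x ≠ y) (hy : y ∈ A) :
    ∃ a ∈ A, G.Adj x a := by
  obtain ⟨d, p, hp⟩ := h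
  have hd : d ≠ 0 := by
    rintro rfl
    exact hxy (hp.zero.symm.trans hp.last)
  refine ⟨p 1, ?_, by simpa [hp.zero] using hp.adj 0 (by omega)⟩
  rcases Nat.lt_or_ge 1 d with h1 | h1
  · exact hp.mem 1 (by omega) h1
  · rw [show 1 = d by omega, hp.last]; exact hy

/-- Dirac: in a chordal graph, a vertex with a non-neighbour has a simplicial non-neighbour. -/
theorem IsChordal.exists_simplicial_nonadj [Finite V] (hG : IsChordal G) (A : Set V) {v w : V}
    (hv : v ∈ A) (hw : w ∈ A) (hwv : w ≠ v) (hvw : ¬ G.Adj v w) :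
    ∃ r ∈ A, r ≠ v ∧ ¬ G.Adj v r ∧ IsSimplicialIn G A r := by
  induction hn : A.ncard using Nat.strong_induction_on generalizing A v w with
  | _ n ih =>
  subst hn
  set B : Set V := {z | z ∈ A ∧ z ≠ v ∧ ¬ G.Adj v z} with hB
  set C : Set V := {z | z ∈ B ∧ Linked G B w z} with hC
  set S : Set V := {s | s ∈ A ∧ G.Adj v s ∧ ∃ z ∈ C, G.Adj s z} with hS
  have hwB : w ∈ B := ⟨hw, hwv, hvw⟩
  have hwC : w ∈ C := ⟨hwB, Linked.refl⟩
  have hlink : ∀ z ∈ C, Linked G C w z := by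
    rintro z ⟨hzB, d, p, hp⟩
    exact ⟨d, p, hp.zero, hp.last, hp.adj, fun i h0 h1 => ⟨hp.mem i h0 h1, i, p, hp.take h1.le⟩⟩
  -- A shortest path from `s` to `s'` through `C`, closed by `v`, is an induced cycle of length at
  -- least four, because `v` has no neighbour in `C`.
  have hScl : ∀ s ∈ S, ∀ s' ∈ S, s ≠ s' → G.Adj s s' := by
    rintro s ⟨_, hvs, z, hz, hsz⟩ s' ⟨_, hvs', z', hz', hsz'⟩ hne
    by_contra hna
    have hl : Linked G C s s' :=
      (Linked.of_adj hsz).trans (((hlink z hz).symm.trans (hlink z' hz') hwC).trans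
        (Linked.of_adj hsz'.symm) hz') hz
    obtain ⟨d, p, hp, hip, -⟩ := hl.exists_shortest
    have hd : 2 ≤ d := by
      by_contra hd
      have : d = 0 ∨ d = 1 := by omega
      rcases this with rfl | rfl
      · exact hne (hp.zero.symm.trans hp.last)
      · have := hp.adj 0 (by omega)
        rw [hp.zero, hp.last] at this
        exact hna this
    have hc := hip.indCyc (indPath_two hvs.symm hvs' hna hne) (by simp [hp.zero])
      (by simp [hp.last]) hd le_rfl (fun i j hi hid hj hj2 => by
        have hj1 : j = 1 := by omega
        subst hj1
        have := (hp.mem i hi hid).1.2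
        simp only [one_ne_zero, if_false, if_true]
        exact ⟨this.1, fun h => this.2 h.symm⟩)
    have := isChordal_iff.1 hG _ _ hc
    omega
  have hsub : C ∪ S ⊆ A := by
    rintro z (hz | hz)
    · exact hz.1.1
    · exact hz.1
  have hvn : v ∉ C ∪ S := by
    rintro (hz | hz)
    · exact hz.1.2.1 rfl
    · exact hz.2.1.ne rfl
  have hlt : (C ∪ S).ncard < A.ncard :=
    Set.ncard_lt_ncard ⟨hsub, fun h => hvn (h hv)⟩ (Set.toFinite _)
  -- All neighbours in `A` of a vertex of `C` lie in `C ∪ S`, so being simplicial there is the same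
  -- as being simplicial in `A`.
  have hup : ∀ r ∈ C, IsSimplicialIn G (C ∪ S) r → IsSimplicialIn G A r := by
    intro r hr hsim
    have hin : ∀ a ∈ A, G.Adj r a → a ∈ C ∪ S := by
      intro a ha hra
      by_cases hva : G.Adj v a
      · exact Or.inr ⟨ha, hva, r, hr, hra.symm⟩
      · have hav : a ≠ v := by
          rintro rfl
          exact hr.1.2.2 hra.symm
        exact Or.inl ⟨⟨ha, hav, hva⟩, hr.2.trans (Linked.of_adj hra) hr.1⟩
    exact fun a ha b hb hra hrb => hsim a (hin a ha hra) b (hin b hb hrb) hra hrb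
  have hfin : ∀ r ∈ C, IsSimplicialIn G (C ∪ S) r →
      ∃ r ∈ A, r ≠ v ∧ ¬ G.Adj v r ∧ IsSimplicialIn G A r :=
    fun r hr hsim => ⟨r, hr.1.1, hr.1.2.1, hr.1.2.2, hup r hr hsim⟩
  by_cases hcl : ∃ a ∈ C ∪ S, ∃ b ∈ C ∪ S, b ≠ a ∧ ¬ G.Adj a b
  · obtain ⟨a, ha, b, hb, hba, hab⟩ := hcl
    obtain ⟨r, hr, hra, har, hrs⟩ := ih _ hlt (C ∪ S) ha hb hba hab rfl
    rcases hr with hr | hr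
    · exact hfin r hr hrs
    -- If the simplicial vertex `r` fell into `S`, it serves as the next `v`: its simplicial
    -- non-neighbour cannot be in the clique `S`.
    · obtain ⟨r', hr', hrr, hrr', hrs'⟩ := ih _ hlt (C ∪ S) (Or.inr hr) ha hra.symm
        (fun h => har h.symm) rfl
      rcases hr' with hr' | hr'
      · exact hfin r' hr' hrs'
      · exact absurd (hScl r hr r' hr' hrr.symm) hrr'
  · push Not at hcl
    exact hfin w hwC (fun a ha b hb _ _ hab => hcl a ha b hb hab.symm)

theorem IsChordal.exists_simplicial [Finite V] (hG : IsChordal G) (hA : A.Nonempty) :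
    ∃ r ∈ A, IsSimplicialIn G A r := by
  by_cases hcl : ∃ a ∈ A, ∃ b ∈ A, b ≠ a ∧ ¬ G.Adj a b
  · obtain ⟨a, ha, b, hb, hba, hab⟩ := hcl
    obtain ⟨r, hr, -, -, h⟩ := hG.exists_simplicial_nonadj A ha hb hba hab
    exact ⟨r, hr, h⟩
  · push Not at hcl
    obtain ⟨w, hw⟩ := hA
    exact ⟨w, hw, fun a ha b hb _ _ hab => hcl a ha b hb hab.symm⟩

/-- A chordal graph without cut vertices has at least `2 n - 3` edges. -/
theorem IsChordal.two_mul_le_edges [Finite V] (hG : IsChordal G) (A : Set V) (h2 : 2 ≤ A.ncard)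
    (hconn : ∀ x ∈ A, ∀ y ∈ A, Linked G A x y)
    (hcut : ∀ v ∈ A, ∀ x ∈ A \ {v}, ∀ y ∈ A \ {v}, Linked G (A \ {v}) x y) :
    2 * A.ncard ≤ (edgesIn G A).ncard + 3 := by
  induction hn : A.ncard using Nat.strong_induction_on generalizing A with
  | _ n ih =>
  have hne : A.Nonempty := Set.nonempty_of_ncard_ne_zero (by omega)
  obtain ⟨r, hr, hsim⟩ := hG.exists_simplicial hne
  obtain ⟨w, hw, hwr⟩ := Set.exists_ne_of_one_lt_ncard (by omega : 1 < A.ncard) r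
  obtain ⟨a, ha, hra⟩ := (hconn r hr w hw).exists_adj hwr.symm hw
  have hfin : ∀ s : Set (Sym2 V), s.Finite := fun s => s.toFinite
  have hrn : (A \ {r}).ncard = A.ncard - 1 := Set.ncard_sdiff_singleton_of_mem hr
  by_cases hn2 : n = 2
  · have : 0 < (edgesIn G A).ncard :=
      (Set.ncard_pos (hfin _)).2 ⟨s(r, a), mem_edgesIn.2 ⟨hra, hr, ha⟩⟩
    omega
  · have han : (A \ {a}).ncard = A.ncard - 1 := Set.ncard_sdiff_singleton_of_mem ha
    have hrA : r ∈ A \ {a} := ⟨hr, hra.ne⟩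
    obtain ⟨b, hb, hbr⟩ := Set.exists_ne_of_one_lt_ncard (by omega : 1 < (A \ {a}).ncard) r
    obtain ⟨c, hc, hrc⟩ := (hcut a ha r hrA b hb).exists_adj hbr.symm hb
    -- An inner vertex of an induced path has two nonadjacent neighbours and is not simplicial.
    -- Shortest walks therefore avoid `r`, and deleting `r` keeps connectedness and creates no cut
    -- vertex.
    have hstep : ∀ D : Set V, ∀ x ∈ A \ {r}, ∀ y ∈ A \ {r}, Linked G D x y → D ⊆ A →
        Linked G (D \ {r}) x y := by
      intro D x hx y hy hl hD
      obtain ⟨d, p, hp, hip, -⟩ := hl.exists_shortest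
      refine ⟨d, p, hp.zero, hp.last, hp.adj, fun i h0 h1 => ⟨hp.mem i h0 h1, fun hir => ?_⟩⟩
      have hd : ∀ j, j ≤ d → p j ∈ A := by
        intro j hj
        rcases Nat.eq_zero_or_pos j with rfl | hj0
        · rw [hp.zero]; exact hx.1
        · rcases hj.eq_or_lt with rfl | hjd
          · rw [hp.last]; exact hy.1
          · exact hD (hp.mem j hj0 hjd)
      have hir : p i = r := hir
      have e1 : G.Adj r (p (i - 1)) := by
        rw [← hir, hip.adj' (by omega) (by omega)]; omega
      have e2 : G.Adj r (p (i + 1)) := by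
        rw [← hir, hip.adj' (by omega) (by omega)]; omega
      have e3 := hsim _ (hd (i - 1) (by omega)) _ (hd (i + 1) (by omega)) e1 e2
        (hip.inj _ _ (by omega) (by omega))
      rw [hip.adj' (by omega) (by omega)] at e3
      omega
    have hlow := ih (n - 1) (by omega) (A \ {r}) (by omega)
      (fun x hx y hy => hstep A x hx y hy (hconn x hx.1 y hy.1) subset_rfl)
      (fun v hv x hx y hy => by
        have := hstep (A \ {v}) x hx.1 y hy.1
          (hcut v hv.1 x ⟨hx.1.1, hx.2⟩ y ⟨hy.1.1, hy.2⟩) Set.sdiff_subset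
        exact this.mono (fun z hz => ⟨⟨hz.1.1, hz.2⟩, hz.1.2⟩)) (by omega)
    have hnr : ∀ z, s(r, z) ∉ edgesIn G (A \ {r}) := fun z h => (mem_edgesIn.1 h).2.1.2 rfl
    -- Two edges are lost with `r`: it has a neighbour `a` by connectedness, and another one `c`
    -- because `a` is not a cut vertex.
    have hins : (insert s(r, a) (insert s(r, c) (edgesIn G (A \ {r})))).ncard ≤
        (edgesIn G A).ncard := by
      refine Set.ncard_le_ncard ?_ (hfin _)
      rintro e (rfl | rfl | he)
      · exact mem_edgesIn.2 ⟨hra, hr, ha⟩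
      · exact mem_edgesIn.2 ⟨hrc, hr, hc.1⟩
      · exact ⟨he.1, fun v hv => (he.2 v hv).1⟩
    rw [Set.ncard_insert_of_notMem _ (hfin _), Set.ncard_insert_of_notMem (hnr _) (hfin _)] at hins
    · omega
    · rintro (h | h)
      · have : a = c := by
          rcases Sym2.eq_iff.1 h with h | h
          · exact h.2
          · exact h.2.trans h.1
        exact hc.2 this.symm
      · exact hnr _ h

end Chordal

/-! ### Prime sets, inseparability and components -/

/-- No clique with at most two vertices separates `x` and `y`. -/
def Insep {V : Type*} (G : SimpleGraph V) (x y : V) : Prop :=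
  ∀ S : Set V, G.IsClique S → S.ncard ≤ 2 → x ∉ S → y ∉ S → Linked G Sᶜ x y

section Components

variable {V : Type*} {G : SimpleGraph V} {A B : Set V} {x y z : V}

theorem isPrimeOn_iff : IsPrimeOn G A ↔ A.Nonempty ∧ (∀ x ∈ A, ∀ y ∈ A, Linked G A x y) ∧
    ∀ S ⊆ A, G.IsClique S → S.ncard ≤ 2 → ∀ x ∈ A \ S, ∀ y ∈ A \ S, Linked G (A \ S) x y := by
  unfold IsPrimeOn
  rw [SimpleGraph.connected_iff, preconnected_induce_iff, Set.nonempty_coe_sort]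
  simp only [preconnected_induce_iff]
  tauto

theorem Insep.refl (x : V) : Insep G x x := fun _ _ _ _ _ => Linked.refl

theorem Insep.symm (h : Insep G x y) : Insep G y x :=
  fun S hS h2 hx hy => (h S hS h2 hy hx).symm

/-- The clique may stick out of `A`, since only its part in `A` is removed. -/
theorem IsPrimeOn.linked_diff [Finite V] (h : IsPrimeOn G A) {S : Set V} (hS : G.IsClique S)
    (h2 : S.ncard ≤ 2) (hx : x ∈ A \ S) (hy : y ∈ A \ S) : Linked G (A \ S) x y := by
  have := (isPrimeOn_iff.1 h).2.2 (S ∩ A) Set.inter_subset_right (hS.subset Set.inter_subset_left)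
    ((Set.ncard_le_ncard Set.inter_subset_left S.toFinite).trans h2) x ⟨hx.1, fun h => hx.2 h.1⟩
    y ⟨hy.1, fun h => hy.2 h.1⟩
  exact this.mono fun v hv => ⟨hv.1, fun h => hv.2 ⟨h, hv.1⟩⟩

theorem IsPrimeOn.insep [Finite V] (h : IsPrimeOn G A) (hx : x ∈ A) (hy : y ∈ A) : Insep G x y :=
  fun _ hS h2 hxS hyS => (h.linked_diff hS h2 ⟨hx, hxS⟩ ⟨hy, hyS⟩).mono fun _ hv => hv.2

/-- A walk that leaves `X ∪ S` does so through `S`. -/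
theorem exists_mem_of_leaves {D X S : Set V} {q : ℕ → V} {e i : ℕ}
    (hX : ∀ u ∈ X, ∀ v ∈ D, G.Adj u v → v ∈ X ∪ S) (h0 : q 0 ∈ X ∪ S)
    (hadj : ∀ t, t < e → G.Adj (q t) (q (t + 1))) (hD : ∀ t, 0 < t → t < e → q t ∈ D)
    (hi : i < e) (hiX : q i ∉ X ∪ S) : ∃ a, a < i ∧ q a ∈ S := by
  by_contra hno
  push Not at hno
  have hall : ∀ t, t ≤ i → q t ∈ X := by
    intro t
    induction t with
    | zero =>
      intro _
      rcases Nat.eq_zero_or_pos i with rfl | hi0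
      · exact absurd h0 hiX
      · exact h0.resolve_right (hno 0 hi0)
    | succ t ih =>
      intro ht
      have h1 := hX _ (ih (by omega)) _ (hD (t + 1) (by omega) (by omega)) (hadj t (by omega))
      rcases ht.eq_or_lt with rfl | ht
      · exact absurd h1 hiX
      · exact h1.resolve_right (hno _ ht)
  exact hiX (Or.inl (hall i le_rfl))

/-- Linkages between vertices on one side of a clique separator can be kept on this side. -/
theorem Linked.inter_side {D X S : Set V} (hS : G.IsClique S)
    (hX : ∀ u ∈ X, ∀ v ∈ D, G.Adj u v → v ∈ X ∪ S) (hx : x ∈ X ∪ S) (hy : y ∈ X ∪ S)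
    (h : Linked G D x y) : Linked G (D ∩ (X ∪ S)) x y := by
  obtain ⟨d, p, hp, hip, -⟩ := h.exists_shortest
  refine ⟨d, p, hp.zero, hp.last, hp.adj, fun i h0 h1 => ⟨hp.mem i h0 h1, ?_⟩⟩
  -- A shortest walk that leaves the side passes through the clique before and after; these two
  -- vertices are adjacent but not consecutive on an induced path.
  by_contra hi
  obtain ⟨a, ha, haS⟩ := exists_mem_of_leaves hX (by rw [hp.zero]; exact hx) hp.adj hp.mem h1 hi
  have hr := hp.reverse
  obtain ⟨b, hb, hbS⟩ := exists_mem_of_leaves hX (by rw [hr.zero]; exact hy) hr.adj hr.mem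
    (i := d - i) (by omega) (by simpa [show d - (d - i) = i by omega] using hi)
  have := hS haS hbS (hip.inj _ _ (by omega) (by omega))
  rw [hip.adj' (by omega) (by omega)] at this
  omega

/-- If `B` is not prime, a clique `S` splits it. No two vertices of `Q` are separated by `S`, so `Q`
lies in one side together with `S`. By `Linked.inter_side` this smaller set inherits the hypotheses,
and the descent ends in a prime set. -/
theorem exists_isPrimeOn_aux [Finite V] {Q : Set V} (hQ : Q.Nonempty) (B : Set V) (hQB : Q ⊆ B)
    (hB : ∀ x ∈ B, ∀ y ∈ B, Linked G B x y)
    (hQS : ∀ x ∈ Q, ∀ y ∈ Q, ∀ S : Set V, G.IsClique S → S.ncard ≤ 2 → x ∉ S → y ∉ S →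
      Linked G (B \ S) x y) : ∃ A, IsPrimeOn G A ∧ Q ⊆ A := by
  induction hn : B.ncard using Nat.strong_induction_on generalizing B with
  | _ n ih =>
  by_cases hp : IsPrimeOn G B
  · exact ⟨B, hp, hQB⟩
  rw [isPrimeOn_iff] at hp
  push Not at hp
  obtain ⟨S, hSB, hS, h2, c, hc, c', hc', hcc⟩ := hp (hQ.mono hQB) hB
  set X : Set V := {z | z ∈ B \ S ∧ Linked G (B \ S) c z} with hXdef
  have hXc : ∀ u ∈ X, ∀ v ∈ B, G.Adj u v → v ∈ X ∪ S := by
    intro u hu v hv huv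
    by_cases hvS : v ∈ S
    · exact Or.inr hvS
    · exact Or.inl ⟨⟨hv, hvS⟩, hu.2.trans (Linked.of_adj huv) hu.1⟩
  have hYc : ∀ u ∈ (B \ S) \ X, ∀ v ∈ B, G.Adj u v → v ∈ (B \ S) \ X ∪ S := by
    intro u hu v hv huv
    by_cases hvS : v ∈ S
    · exact Or.inr hvS
    · exact Or.inl ⟨⟨hv, hvS⟩, fun hvX => (hXc v hvX u hu.1.1 huv.symm).elim hu.2 hu.1.2⟩
  have hrec : ∀ Z : Set V, (∀ u ∈ Z, ∀ v ∈ B, G.Adj u v → v ∈ Z ∪ S) → Z ∪ S ⊂ B → Q ⊆ Z ∪ S →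
      ∃ A, IsPrimeOn G A ∧ Q ⊆ A := by
    intro Z hZ hZB hQZ
    refine ih _ (hn ▸ Set.ncard_lt_ncard hZB B.toFinite) (Z ∪ S) hQZ ?_ ?_ rfl
    · intro x hx y hy
      exact ((hB x (hZB.1 hx) y (hZB.1 hy)).inter_side hS hZ hx hy).mono fun v hv => hv.2
    · intro x hx y hy T hT hT2 hxT hyT
      exact ((hQS x hx y hy T hT hT2 hxT hyT).inter_side hS
        (fun u hu v hv => hZ u hu v hv.1) (hQZ hx) (hQZ hy)).mono fun v hv => ⟨hv.2, hv.1.2⟩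
  by_cases hQX : ∃ q ∈ Q, q ∈ X
  · obtain ⟨q, hq, hqX⟩ := hQX
    refine hrec X hXc ⟨Set.union_subset (fun z hz => hz.1.1) hSB, fun h => ?_⟩ fun q' hq' => ?_
    · rcases h hc'.1 with h | h
      · exact hcc h.2
      · exact hc'.2 h
    · by_cases hqS : q' ∈ S
      · exact Or.inr hqS
      · exact Or.inl ⟨⟨hQB hq', hqS⟩,
          hqX.2.trans (hQS q hq q' hq' S hS h2 hqX.1.2 hqS) hqX.1⟩
  · push Not at hQX
    refine hrec _ hYc ⟨Set.union_subset (fun z hz => hz.1.1) hSB, fun h => ?_⟩ fun q' hq' => ?_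
    · rcases h hc.1 with h | h
      · exact h.2 ⟨hc, Linked.refl⟩
      · exact hc.2 h
    · by_cases hqS : q' ∈ S
      · exact Or.inr hqS
      · exact Or.inl ⟨⟨hQB hq', hqS⟩, hQX q' hq'⟩

theorem IsPrimeOn.exists_isComponent [Finite V] (h : IsPrimeOn G A) :
    ∃ B, IsComponent G B ∧ A ⊆ B := by
  obtain ⟨B, hAB, hB⟩ := (Set.toFinite {B | IsPrimeOn G B}).exists_le_maximal h
  exact ⟨B, hB, hAB⟩

/-- Pairwise inseparable vertices are contained in a component. -/
theorem exists_isComponent_of_insep [Finite V] (hG : G.Preconnected) {Q : Set V}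
    (hQ : Q.Nonempty) (h : ∀ x ∈ Q, ∀ y ∈ Q, Insep G x y) : ∃ A, IsComponent G A ∧ Q ⊆ A := by
  have huniv : ∀ x y, Linked G Set.univ x y := by
    intro x y
    have := hG.map (f := (SimpleGraph.induceUnivIso G).symm.toHom)
      (SimpleGraph.induceUnivIso G).symm.surjective
    exact preconnected_induce_iff.1 this x trivial y trivial
  obtain ⟨A, hA, hQA⟩ := exists_isPrimeOn_aux hQ Set.univ (Set.subset_univ _)
    (fun x _ y _ => huniv x y)
    (fun x hx y hy S hS h2 hxS hyS => (h x hx y hy S hS h2 hxS hyS).mono fun v hv => ⟨trivial, hv⟩)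
  obtain ⟨B, hB, hAB⟩ := hA.exists_isComponent
  exact ⟨B, hB, hQA.trans hAB⟩

/-- A clique cannot contain both `x` and `y`. The one that survives its removal connects what is
left of `A` with what is left of `B`. -/
theorem IsPrimeOn.union [Finite V] (hA : IsPrimeOn G A) (hB : IsPrimeOn G B) (hxA : x ∈ A)
    (hxB : x ∈ B) (hyA : y ∈ A) (hyB : y ∈ B) (hxy : x ≠ y) (hadj : ¬ G.Adj x y) :
    IsPrimeOn G (A ∪ B) := by
  have hA' := isPrimeOn_iff.1 hA
  have hB' := isPrimeOn_iff.1 hB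
  have key : ∀ S : Set V, G.IsClique S → S.ncard ≤ 2 → ∀ u ∈ (A ∪ B) \ S, ∀ v ∈ (A ∪ B) \ S,
      Linked G ((A ∪ B) \ S) u v := by
    intro S hS h2 u hu v hv
    have : ∃ z, z ∈ A ∧ z ∈ B ∧ z ∉ S := by
      by_contra hno
      push Not at hno
      exact hadj (hS (hno x hxA hxB) (hno y hyA hyB) hxy)
    obtain ⟨z, hzA, hzB, hzS⟩ := this
    have hto : ∀ w ∈ (A ∪ B) \ S, Linked G ((A ∪ B) \ S) w z := by
      rintro w ⟨hw | hw, hwS⟩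
      · exact (hA.linked_diff hS h2 ⟨hw, hwS⟩ ⟨hzA, hzS⟩).mono fun v hv => ⟨Or.inl hv.1, hv.2⟩
      · exact (hB.linked_diff hS h2 ⟨hw, hwS⟩ ⟨hzB, hzS⟩).mono fun v hv => ⟨Or.inr hv.1, hv.2⟩
    exact (hto u hu).trans (hto v hv).symm ⟨Or.inl hzA, hzS⟩
  refine isPrimeOn_iff.2 ⟨hA'.1.mono Set.subset_union_left, fun u hu v hv => ?_,
    fun S _ hS h2 => key S hS h2⟩
  simpa using key ∅ (by simp) (by simp) u (by simpa using hu) v (by simpa using hv)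

/-- Distinct components thus meet in cliques only. This keeps the counts of added edges in different
components separate. -/
theorem IsComponent.eq_of_nonadj [Finite V] (hA : IsComponent G A) (hB : IsComponent G B)
    (hxA : x ∈ A) (hxB : x ∈ B) (hyA : y ∈ A) (hyB : y ∈ B) (hxy : x ≠ y)
    (hadj : ¬ G.Adj x y) : A = B := by
  have h := hA.1.union hB.1 hxA hxB hyA hyB hxy hadj
  have h1 := hA.eq_of_subset h Set.subset_union_left
  have h2 := hB.eq_of_subset h Set.subset_union_right
  exact h1.trans h2.symm

/-- A component is determined by two nonadjacent vertices in it. -/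
theorem IsComponent.eq_setOf_insep [Finite V] (hG : G.Preconnected) (hA : IsComponent G A)
    (hx : x ∈ A) (hy : y ∈ A) (hxy : x ≠ y) (hadj : ¬ G.Adj x y) :
    A = {z | Insep G z x ∧ Insep G z y} := by
  ext z
  refine ⟨fun hz => ⟨hA.1.insep hz hx, hA.1.insep hz hy⟩, fun hz => ?_⟩
  have hi := hA.1.insep hx hy
  -- The three vertices are pairwise inseparable and share a component, which is `A` because it
  -- contains the nonadjacent pair.
  obtain ⟨B, hB, hQB⟩ := exists_isComponent_of_insep hG (Q := {x, y, z}) ⟨x, by simp⟩ (by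
    rintro a (rfl | rfl | rfl) b (rfl | rfl | rfl)
    exacts [Insep.refl _, hi, hz.1.symm, hi.symm, Insep.refl _, hz.2.symm, hz.1, hz.2,
      Insep.refl _])
  rw [hA.eq_of_nonadj hB hx (hQB (by simp)) hy (hQB (by simp)) hxy hadj]
  exact hQB (by simp)

end Components

/-! ### Induced cycles in prime sets and the ears attached to them -/

/-- `p` is an induced path of length `d` from `x` to `y` with inner vertices outside `K`, which
have no neighbours in `K` except for the ends of the path. -/
structure Ear {V : Type*} (G : SimpleGraph V) (K : Set V) (x y : V) (d : ℕ) (p : ℕ → V) :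
    Prop where
  path : IndPath G p d
  zero : p 0 = x
  last : p d = y
  out : ∀ i, 0 < i → i < d → p i ∉ K
  contact : ∀ i z, 0 < i → i < d → z ∈ K → G.Adj (p i) z → (i = 1 ∧ z = x) ∨ (i + 1 = d ∧ z = y)

section Cycles

variable {V : Type*} {G : SimpleGraph V} {A K : Set V} {x y z w : V} {k d : ℕ} {p f : ℕ → V}

theorem Ear.reverse (h : Ear G K x y d p) : Ear G K y x d (fun i => p (d - i)) := by
  refine ⟨h.path.reverse, by simpa using h.last, by simpa using h.zero,
    fun i h0 h1 => h.out _ (by omega) (by omega), fun i z h0 h1 hz hadj => ?_⟩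
  rcases h.contact _ z (by omega) (by omega) hz hadj with ⟨h2, h3⟩ | ⟨h2, h3⟩
  · exact Or.inr ⟨by omega, h3⟩
  · exact Or.inl ⟨by omega, h3⟩

theorem IsSC.indCyc_length (h : IsSC k G) {m : ℕ} (hf : IndCyc G f m) : m = k :=
  h.2 m hf.three_le hf.isIndContained

theorem IsSC.not_triangle (h : IsSC k G) (hk : 5 ≤ k) (hxy : G.Adj x y) (hyz : G.Adj y z) :
    ¬ G.Adj x z := by
  intro hxz
  have : IndCyc G (fun i => if i = 0 then x else if i = 1 then y else z) 3 := by
    refine ⟨le_rfl, fun i j hij hj => ?_, fun i j hij hj => ?_⟩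
    all_goals
      have : (i = 0 ∧ j = 1) ∨ (i = 0 ∧ j = 2) ∨ (i = 1 ∧ j = 2) := by omega
      rcases this with ⟨rfl, rfl⟩ | ⟨rfl, rfl⟩ | ⟨rfl, rfl⟩ <;>
        simp [hxy, hyz, hxz, hxy.ne, hyz.ne, hxz.ne]
  have := h.indCyc_length this
  omega

/-- Makes the size condition on separators automatic: every clique is an admissible separator. -/
theorem IsSC.ncard_clique_le [Finite V] (h : IsSC k G) (hk : 5 ≤ k) {S : Set V}
    (hS : G.IsClique S) : S.ncard ≤ 2 := by
  by_contra hlt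
  obtain ⟨a, b, c, ha, hb, hc, hab, hac, hbc⟩ := (Set.two_lt_ncard_iff S.toFinite).1 (by omega)
  exact h.not_triangle hk (hS ha hb hab) (hS hb hc hbc) (hS ha hc hac)

/-- A prime set that is not a clique contains an induced cycle. -/
theorem IsSC.exists_indCyc [Finite V] (h : IsSC k G) (hk : 5 ≤ k) (hA : IsPrimeOn G A) (hx : x ∈ A)
    (hy : y ∈ A) (hxy : x ≠ y) (hadj : ¬ G.Adj x y) :
    ∃ f, IndCyc G f k ∧ ∀ t, t < k → f t ∈ A := by
  classical
  obtain ⟨d, p, hp, hip, -⟩ := ((isPrimeOn_iff.1 hA).2.1 x hx y hy).exists_shortest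
  have hd : 2 ≤ d := by
    by_contra hd
    have : d = 0 ∨ d = 1 := by omega
    rcases this with rfl | rfl
    · exact hxy (hp.zero.symm.trans hp.last)
    · have := hp.adj 0 (by omega)
      rw [hp.zero, hp.last] at this
      exact hadj this
  set m := p 1 with hm
  have hmA : m ∈ A := hp.mem 1 (by omega) (by omega)
  have h2A : p 2 ∈ A := by
    rcases hd.eq_or_lt with h2 | h2
    · rw [h2, hp.last]; exact hy
    · exact hp.mem 2 (by omega) h2
  -- The vertex `m` does not separate its two neighbours on the path. Among all pairs of neighbours
  -- of `m`, take the shortest connection that avoids `m`: by minimality its inner vertices are not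
  -- adjacent to `m`, so it closes an induced cycle with `m`.
  have hex : ∃ e, ∃ a ∈ A, ∃ b ∈ A, ∃ q, a ≠ b ∧ G.Adj m a ∧ G.Adj m b ∧
      WalkIn G (A \ {m}) a b e q := by
    obtain ⟨e, q, hq⟩ := hA.linked_diff (S := {m}) (by simp) (by simp)
      (x := x) (y := p 2) ⟨hx, by rw [← hp.zero]; exact hip.inj 0 1 (by omega) (by omega)⟩
      ⟨h2A, (hip.inj 1 2 (by omega) (by omega)).symm⟩
    refine ⟨e, x, hx, p 2, h2A, q, ?_, ?_, hp.adj 1 (by omega), hq⟩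
    · rw [← hp.zero]; exact hip.inj 0 2 (by omega) (by omega)
    · rw [← hp.zero]; exact (hp.adj 0 (by omega)).symm
  obtain ⟨a, ha, b, hb, q, hab, hma, hmb, hq⟩ := Nat.find_spec hex
  set e := Nat.find hex with he
  have hmin : ∀ e' a' b' q', a' ∈ A → b' ∈ A → a' ≠ b' → G.Adj m a' → G.Adj m b' →
      WalkIn G (A \ {m}) a' b' e' q' → e ≤ e' := fun e' a' b' q' h1 h2 h3 h4 h5 h6 =>
    Nat.find_min' hex ⟨a', h1, b', h2, q', h3, h4, h5, h6⟩
  have hiq := hq.indPath_of_le fun e' q' h' => hmin e' a b q' ha hb hab hma hmb h'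
  have hnab := h.not_triangle hk hma.symm hmb
  have he2 : 2 ≤ e := by
    by_contra hd
    have : e = 0 ∨ e = 1 := by omega
    rcases this with h0 | h0
    · rw [h0] at hq
      exact hab (hq.zero.symm.trans hq.last)
    · have := hq.adj 0 (by omega)
      rw [hq.zero, zero_add, ← h0, hq.last] at this
      exact hnab this
  have hc := hiq.indCyc (indPath_two hma.symm hmb hnab hab) (by simp [hq.zero])
    (by simp [hq.last]) he2 le_rfl (fun i j hi hid hj hj2 => by
      have hj1 : j = 1 := by omega
      subst hj1
      simp only [one_ne_zero, if_false, if_true]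
      have hqi := hq.mem i hi hid
      refine ⟨hqi.2, fun hadj => ?_⟩
      have := hmin i a (q i) q ha hqi.1
        (by rw [← hq.zero]; exact hiq.inj 0 i hi hid.le) hma hadj.symm (hq.take hid.le)
      omega)
  have hlen := h.indCyc_length hc
  rw [hlen] at hc
  refine ⟨_, hc, fun t ht => ?_⟩
  by_cases hte : t ≤ e
  · simp only [hte, if_true]
    rcases Nat.eq_zero_or_pos t with rfl | ht0
    · rw [hq.zero]; exact ha
    · rcases hte.eq_or_lt with rfl | hte
      · rw [hq.last]; exact hb
      · exact (hq.mem t ht0 hte).1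
  · have : k - t = 1 := by omega
    simp [hte, this, hmA]

/-- The first neighbour `f t` with `t > 0` would give the induced cycle `f 0, …, f t, w` of length
`t + 2 < k`. -/
theorem IsSC.not_adj_cyc_aux (h : IsSC k G) (hk : 5 ≤ k) (hf : IndCyc G f k)
    (hw : ∀ t, t < k → w ≠ f t) (h0 : G.Adj w (f 0)) {s : ℕ} (hs0 : 0 < s) (hsk : s < k - 2) :
    ¬ G.Adj w (f s) := by
  classical
  intro hs
  have hex : ∃ s, 0 < s ∧ s < k - 2 ∧ G.Adj w (f s) := ⟨s, hs0, hsk, hs⟩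
  obtain ⟨h1, h2, h3⟩ := Nat.find_spec hex
  set t := Nat.find hex
  have hmin : ∀ i, 0 < i → i < t → ¬ G.Adj w (f i) := fun i hi hit hadj =>
    Nat.find_min hex hit ⟨hi, by omega, hadj⟩
  have ht : G.Adj (f 0) (f t) → False := h.not_triangle hk h0.symm h3
  have ht1 : t ≠ 1 := fun e => ht (by rw [hf.adj 0 t h1 (by omega)]; omega)
  have hc := (hf.indPath (j := t) (by omega)).indCyc
    (indPath_two h0.symm h3 ht (hf.inj 0 t h1 (by omega))) (by simp) (by simp) (by omega) le_rfl
    (fun i j hi hid hj hj2 => by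
      have hj1 : j = 1 := by omega
      subst hj1
      simp only [one_ne_zero, if_false, if_true]
      exact ⟨(hw i (by omega)).symm, fun h => hmin i hi hid h.symm⟩)
  have := h.indCyc_length hc
  omega

/-- A vertex outside an induced cycle has at most one neighbour on it. -/
theorem IsSC.eq_of_adj_cyc (h : IsSC k G) (hk : 5 ≤ k) (hf : IndCyc G f k)
    (hw : ∀ t, t < k → w ≠ f t) {i j : ℕ} (hi : i < k) (hj : j < k) (hwi : G.Adj w (f i))
    (hwj : G.Adj w (f j)) : i = j := by
  by_contra hij
  have key : ∀ g : ℕ → V, IndCyc G g k → (∀ t, t < k → w ≠ g t) → ∀ t, 0 < t → t < k →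
      G.Adj w (g 0) → ¬ G.Adj w (g t) := by
    intro g hg hwg t h0 ht hg0 hgt
    -- What remains is `t ≥ k - 2`. Read backwards the vertex has index `k - t ≤ 2`, which is less
    -- than `k - 2` as `k ≥ 5`.
    have h1 : ¬ t < k - 2 := fun hlt => h.not_adj_cyc_aux hk hg hwg hg0 h0 hlt hgt
    refine h.not_adj_cyc_aux hk hg.reflect (fun t ht => hwg _ (Nat.mod_lt _ (by omega))) ?_
      (s := k - t) (by omega) (by omega) ?_
    · simpa using hg0
    · simpa [show k - (k - t) = t by omega, Nat.mod_eq_of_lt ht] using hgt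
  refine key _ (hf.rotate i hi) (fun t ht => hw _ (Nat.mod_lt _ (by omega)))
    (if i < j then j - i else k + j - i) (by split_ifs <;> omega) (by split_ifs <;> omega)
    (by simpa [Nat.mod_eq_of_lt hi] using hwi) ?_
  split_ifs with hlt
  · simpa [show i + (j - i) = j by omega, Nat.mod_eq_of_lt hj] using hwj
  · simpa [show i + (k + j - i) = k + j by omega, Nat.mod_eq_of_lt hj] using hwj

/-- Nonadjacent vertices of `K` are on induced cycles of length `k` inside `K`. -/
def CycleCovered (G : SimpleGraph V) (k : ℕ) (K : Set V) : Prop :=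
  ∀ x ∈ K, ∀ y ∈ K, x ≠ y → ¬ G.Adj x y →
    ∃ f j, IndCyc G f k ∧ (∀ t, t < k → f t ∈ K) ∧ f 0 = x ∧ j < k ∧ f j = y

theorem IndCyc.cycleCovered_range (hf : IndCyc G f k) :
    CycleCovered G k {v | ∃ t, t < k ∧ f t = v} := by
  rintro x ⟨i, hi, rfl⟩ y ⟨j, hj, rfl⟩ hxy -
  refine ⟨_, if i < j then j - i else k + j - i, hf.rotate i hi,
    fun t ht => ⟨_, Nat.mod_lt _ (by omega), rfl⟩, by simp [Nat.mod_eq_of_lt hi], ?_, ?_⟩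
  · have : i ≠ j := fun e => hxy (by rw [e])
    split_ifs <;> omega
  · split_ifs with hlt
    · simp [show i + (j - i) = j by omega, Nat.mod_eq_of_lt hj]
    · simp [show i + (k + j - i) = k + j by omega, Nat.mod_eq_of_lt hj]

/-- Two distinct neighbours in `K` are nonadjacent, as there are no triangles, hence lie on a common
induced cycle, on which an outside vertex has at most one neighbour. -/
theorem IsSC.eq_of_adj_covered (h : IsSC k G) (hk : 5 ≤ k) (hK : CycleCovered G k K) (hw : w ∉ K)
    (hx : x ∈ K) (hy : y ∈ K) (hwx : G.Adj w x) (hwy : G.Adj w y) : x = y := by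
  by_contra hxy
  obtain ⟨f, j, hf, hfK, rfl, hj, rfl⟩ := hK x hx y hy hxy (h.not_triangle hk hwx.symm hwy)
  have := h.eq_of_adj_cyc hk hf (fun t ht e => hw (by rw [e]; exact hfK t ht)) (by omega) hj hwx hwy
  exact hxy (by rw [this])

/-- Otherwise the vertices of `K` that `w` reaches outside `K` form a clique, and this clique
separates `w` from the rest of `K`. -/
theorem IsSC.exists_linked_outside [Finite V] (h : IsSC k G) (hk : 5 ≤ k) (hA : IsPrimeOn G A)
    (hKA : K ⊆ A) (hx : x ∈ K) (hy : y ∈ K) (hxy : x ≠ y) (hadj : ¬ G.Adj x y) (hwA : w ∈ A)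
    (hwK : w ∉ K) : ∃ a ∈ K, ∃ b ∈ K, a ≠ b ∧ ¬ G.Adj a b ∧ Linked G (A \ K) a b := by
  set N : Set V := {a | a ∈ K ∧ Linked G (A \ K) w a} with hN
  by_cases hcl : ∃ a ∈ N, ∃ b ∈ N, a ≠ b ∧ ¬ G.Adj a b
  · obtain ⟨a, ha, b, hb, hab, hnab⟩ := hcl
    exact ⟨a, ha.1, b, hb.1, hab, hnab, ha.2.symm.trans hb.2 ⟨hwA, hwK⟩⟩
  · push Not at hcl
    have hNc : G.IsClique N := fun a ha b hb hab => hcl a ha b hb hab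
    have : ∃ z ∈ K, z ∉ N := by
      by_contra hno
      push Not at hno
      exact hadj (hcl x (hno x hx) y (hno y hy) hxy)
    obtain ⟨z, hz, hzN⟩ := this
    have hl := hA.linked_diff hNc (h.ncard_clique_le hk hNc) (x := w) (y := z)
      ⟨hwA, fun h => hwK h.1⟩ ⟨hKA hz, hzN⟩
    have := hl.induction (P := fun u => u ∈ A \ K ∧ Linked G (A \ K) w u)
      ⟨⟨hwA, hwK⟩, Linked.refl⟩ (by
        rintro u v ⟨hu, hl⟩ huv hv
        have hvAN : v ∈ A \ N := hv.elim id fun e => e ▸ ⟨hKA hz, hzN⟩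
        have hlv := hl.trans (Linked.of_adj huv) hu
        exact ⟨⟨hvAN.1, fun hvK => hvAN.2 ⟨hvK, hlv⟩⟩, hlv⟩)
    exact absurd hz this.1.2

/-- The ear is a shortest walk outside `K` over all nonadjacent pairs of ends in `K`. With either
arc of a covering cycle it closes an induced cycle of length `k`, which forces the ends to be
antipodal on every such cycle and gives `k = 2d`. -/
theorem IsSC.exists_ear [Finite V] (h : IsSC k G) (hk : 5 ≤ k) (hA : IsPrimeOn G A)
    (hKA : K ⊆ A) (hK : CycleCovered G k K) {x₀ y₀ : V} (hx₀ : x₀ ∈ K) (hy₀ : y₀ ∈ K)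
    (hxy₀ : x₀ ≠ y₀) (hadj₀ : ¬ G.Adj x₀ y₀) (hwA : w ∈ A) (hwK : w ∉ K) :
    ∃ d x y p, x ∈ K ∧ y ∈ K ∧ 3 ≤ d ∧ k = 2 * d ∧ Ear G K x y d p ∧
      (∀ i, 0 < i → i < d → p i ∈ A) ∧
      ∀ f, IndCyc G f k → (∀ t, t < k → f t ∈ K) → ∀ a b, a < b → b < k →
        (f a = x ∧ f b = y ∨ f a = y ∧ f b = x) → b = a + d := by
  classical
  obtain ⟨a, ha, b, hb, hab, hnab, e, q, hq⟩ :=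
    h.exists_linked_outside hk hA hKA hx₀ hy₀ hxy₀ hadj₀ hwA hwK
  have hex : ∃ d, ∃ x ∈ K, ∃ y ∈ K, ∃ p, x ≠ y ∧ ¬ G.Adj x y ∧ WalkIn G (A \ K) x y d p :=
    ⟨e, a, ha, b, hb, q, hab, hnab, hq⟩
  clear hq q e hnab hab hb ha b a
  obtain ⟨x, hx, y, hy, p, hxy, hadj, hp⟩ := Nat.find_spec hex
  set d := Nat.find hex with hd
  have hmin : ∀ d' x' y' p', x' ∈ K → y' ∈ K → x' ≠ y' → ¬ G.Adj x' y' →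
      WalkIn G (A \ K) x' y' d' p' → d ≤ d' := fun d' x' y' p' h1 h2 h3 h4 h5 =>
    Nat.find_min' hex ⟨x', h1, y', h2, p', h3, h4, h5⟩
  clear_value d
  have hip := hp.indPath_of_le fun d' p' h' => hmin d' x y p' hx hy hxy hadj h'
  have hnb : ∀ i, 0 < i → i < d → ∀ z ∈ K, ∀ z' ∈ K, G.Adj (p i) z → G.Adj (p i) z' → z = z' :=
    fun i h0 h1 z hz z' hz' => h.eq_of_adj_covered hk hK (hp.mem i h0 h1).2 hz hz'
  have hd3 : 3 ≤ d := by
    by_contra hd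
    have : d = 0 ∨ d = 1 ∨ d = 2 := by omega
    rcases this with rfl | rfl | rfl
    · exact hxy (hp.zero.symm.trans hp.last)
    · have := hp.adj 0 (by omega)
      rw [hp.zero, hp.last] at this
      exact hadj this
    · refine hxy (hnb 1 (by omega) (by omega) x hx y hy ?_ ?_)
      · rw [← hp.zero]; exact (hp.adj 0 (by omega)).symm
      · rw [← hp.last]; exact hp.adj 1 (by omega)
  -- A contact `z` in the middle of the walk must be adjacent to both `x` and `y`: otherwise the
  -- walk through `z` joins a nonadjacent pair in fewer steps.
  have hatt : ∀ i z, 0 < i → i < d → z ∈ K → G.Adj (p i) z →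
      (i = 1 ∧ z = x) ∨ (i + 1 = d ∧ z = y) ∨ (z ≠ x ∧ z ≠ y ∧ G.Adj x z ∧ G.Adj z y) := by
    intro i z h0 h1 hz hiz
    by_cases hi1 : i = 1
    · subst hi1
      refine Or.inl ⟨rfl, hnb 1 h0 h1 z hz x hx hiz ?_⟩
      rw [← hp.zero]; exact (hp.adj 0 (by omega)).symm
    by_cases hi2 : i + 1 = d
    · refine Or.inr (Or.inl ⟨hi2, hnb i h0 h1 z hz y hy hiz ?_⟩)
      rw [← hp.last, ← hi2]; exact hp.adj i h1
    have hzx : z ≠ x := by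
      rintro rfl
      rw [← hp.zero, hip.adj' (by omega) (by omega)] at hiz
      omega
    have hzy : z ≠ y := by
      rintro rfl
      rw [← hp.last, hip.adj' (by omega) (by omega)] at hiz
      omega
    refine Or.inr (Or.inr ⟨hzx, hzy, ?_, ?_⟩)
    · by_contra hna
      have := hmin _ x z _ hx hz hzx.symm hna
        ((hp.take h1.le).append (walkIn_single hiz) (hp.mem i h0 h1))
      omega
    · by_contra hna
      have := hmin _ z y _ hz hy hzy hna
        ((walkIn_single hiz.symm).append (hp.drop h1.le) (hp.mem i h0 h1))
      omega
  -- A middle contact on the arc would be adjacent to both ends of the arc, which happens only on an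
  -- arc of length two.
  have harc : ∀ f j, IndCyc G f k → (∀ t, t < k → f t ∈ K) → f 0 = x → j < k → f j = y →
      j ≠ 2 → j + d = k := by
    intro f j hf hfK h0 hj hjy hj2
    have hj0 : j ≠ 0 := by
      rintro rfl
      exact hxy (h0.symm.trans hjy)
    have hj1 : ¬ (j = 1 ∨ j + 1 = k) := fun hor => by
      rw [← h0, ← hjy, hf.adj 0 j (by omega) hj] at hadj
      omega
    refine h.indCyc_length ((hf.indPath (j := j) (by omega)).indCyc hip (h0.trans hp.zero.symm)
      (hjy.trans hp.last.symm) (by omega) (by omega) fun t i ht htj hi hid => ⟨fun e => ?_, fun e => ?_⟩)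
    · exact (hp.mem i hi hid).2 (e ▸ hfK t (by omega))
    · rcases hatt i (f t) hi hid (hfK t (by omega)) e.symm with ⟨-, h1⟩ | ⟨-, h1⟩ | ⟨-, -, h1, h2⟩
      · rw [← h0] at h1
        exact hf.inj 0 t ht (by omega) h1.symm
      · rw [← hjy] at h1
        exact hf.inj t j htj hj h1
      · rw [← h0, hf.adj' (by omega) (by omega)] at h1
        rw [← hjy, hf.adj' (by omega) (by omega)] at h2
        omega
  -- If one arc had length two, the other would have a different length because `k ≥ 5`, and `harc`
  -- for it would give `d = 2`. So `harc` applies to both arcs: `j + d = k` and `(k - j) + d = k`.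
  have hant : ∀ f j, IndCyc G f k → (∀ t, t < k → f t ∈ K) → f 0 = x → j < k → f j = y →
      j = d ∧ k = 2 * d := by
    intro f j hf hfK h0 hj hjy
    have hj0 : j ≠ 0 := by
      rintro rfl
      exact hxy (h0.symm.trans hjy)
    have h1 := harc f j hf hfK h0 hj hjy
    have h2 := harc _ (k - j) hf.reflect (fun t ht => hfK _ (Nat.mod_lt _ (by omega)))
      (by simpa using h0) (by omega)
      (by simpa [show k - (k - j) = j by omega, Nat.mod_eq_of_lt hj] using hjy)
    omega
  obtain ⟨f, j, hf, hfK, h0, hj, hjy⟩ := hK x hx y hy hxy hadj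
  obtain ⟨rfl, hkd⟩ := hant f j hf hfK h0 hj hjy
  refine ⟨j, x, y, p, hx, hy, hd3, hkd, ⟨hip, hp.zero, hp.last, fun i h0 h1 => (hp.mem i h0 h1).2,
    fun i z hi hid hz hiz => ?_⟩, fun i h0 h1 => (hp.mem i h0 h1).1, ?_⟩
  · rcases hatt i z hi hid hz hiz with h1 | h1 | ⟨hzx, hzy, h1, h2⟩
    · exact Or.inl h1
    · exact Or.inr h1
    -- Now that the ends are antipodal at distance `d ≥ 3`, a common neighbour is impossible on the
    -- cycle, and off the cycle it would have two neighbours on it.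
    · exfalso
      by_cases hzf : ∃ t, t < k ∧ z = f t
      · obtain ⟨t, ht, rfl⟩ := hzf
        rw [← h0, hf.adj' (by omega) (by omega)] at h1
        rw [← hjy, hf.adj' (by omega) (by omega)] at h2
        omega
      · push Not at hzf
        have := h.eq_of_adj_cyc hk hf hzf (i := 0) (by omega) hj (by rw [h0]; exact h1.symm)
          (by rw [hjy]; exact h2)
        omega
  · intro f hf hfK a b hab hb hor
    rcases hor with ⟨h1, h2⟩ | ⟨h1, h2⟩
    · have := hant _ (b - a) (hf.rotate a (by omega)) (fun t ht => hfK _ (Nat.mod_lt _ (by omega)))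
        (by simpa [Nat.mod_eq_of_lt (hab.trans hb)] using h1) (by omega)
        (by simpa [show a + (b - a) = b by omega, Nat.mod_eq_of_lt hb] using h2)
      omega
    · have := hant _ (k + a - b) (hf.rotate b (by omega))
        (fun t ht => hfK _ (Nat.mod_lt _ (by omega)))
        (by simpa [Nat.mod_eq_of_lt hb] using h2) (by omega)
        (by simpa [show b + (k + a - b) = k + a by omega, Nat.mod_eq_of_lt (hab.trans hb)] using h1)
      omega

end Cycles

/-! ### Cages as families of paths, and their growth by ears -/

/-- `n` induced paths of length `h` from `u` to `v` without further contacts. -/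
structure CageFamily {V : Type*} (G : SimpleGraph V) (h n : ℕ) (p : Fin n → ℕ → V) (u v : V) :
    Prop where
  path : ∀ i, IndPath G (p i) h
  zero : ∀ i, p i 0 = u
  last : ∀ i, p i h = v
  cross : ∀ i j, i ≠ j → ∀ a b, 0 < a → a < h → 0 < b → b < h →
    p i a ≠ p j b ∧ ¬ G.Adj (p i a) (p j b)

/-- The vertices on the paths of a family. -/
def famSet {V : Type*} (h n : ℕ) (p : Fin n → ℕ → V) : Set V := {w | ∃ i a, a ≤ h ∧ p i a = w}

section Cages

variable {V : Type*} {G : SimpleGraph V} {A : Set V} {x y u v w : V} {k h n d s t : ℕ}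
  {p : Fin n → ℕ → V} {q : ℕ → V}

theorem mem_famSet (i : Fin n) {a : ℕ} (ha : a ≤ h) : p i a ∈ famSet h n p := ⟨i, a, ha, rfl⟩

theorem CageFamily.indCyc (H : CageFamily G h n p u v) (hh : 2 ≤ h) {i j : Fin n} (hij : i ≠ j) :
    IndCyc G (fun t => if t ≤ h then p i t else p j (h + h - t)) (h + h) :=
  (H.path i).indCyc (H.path j) ((H.zero i).trans (H.zero j).symm)
    ((H.last i).trans (H.last j).symm) hh hh
    fun a b ha hah hb hbh => H.cross i j hij a b ha hah hb hbh

theorem mem_famSet_cyc {i j : Fin n} {t : ℕ} (ht : t < h + h) :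
    (if t ≤ h then p i t else p j (h + h - t)) ∈ famSet h n p := by
  split_ifs with hth
  · exact mem_famSet i hth
  · exact mem_famSet j (by omega)

/-- Any two paths form a cycle of length `2h`. Vertices on different paths use these two; for
vertices on the same path any other path completes the cycle. -/
theorem CageFamily.cycleCovered (H : CageFamily G h n p u v) (hh : 2 ≤ h) (hn : 2 ≤ n) :
    CycleCovered G (h + h) (famSet h n p) := by
  rintro x ⟨i, a, ha, rfl⟩ y ⟨j, b, hb, rfl⟩ hxy hadj
  have : ∃ i' j' : Fin n, i' ≠ j' ∧ (∃ a', a' < h + h ∧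
      (if a' ≤ h then p i' a' else p j' (h + h - a')) = p i a) ∧ ∃ b', b' < h + h ∧
      (if b' ≤ h then p i' b' else p j' (h + h - b')) = p j b := by
    by_cases hij : i = j
    · subst hij
      have : Nontrivial (Fin n) := Fin.nontrivial_iff_two_le.2 hn
      obtain ⟨j', hj'⟩ := exists_ne i
      exact ⟨i, j', hj'.symm, ⟨a, by omega, by simp [ha]⟩, b, by omega, by simp [hb]⟩
    · refine ⟨i, j, hij, ⟨a, by omega, by simp [ha]⟩, ?_⟩
      rcases Nat.eq_zero_or_pos b with rfl | hb0
      · exact ⟨0, by omega, by simp [H.zero]⟩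
      · refine ⟨h + h - b, by omega, ?_⟩
        split_ifs with hle
        · have : b = h := by omega
          subst this
          simp [H.last]
        · rw [show h + h - (h + h - b) = b by omega]
  obtain ⟨i', j', hij, ⟨a', ha', hae⟩, b', hb', hbe⟩ := this
  obtain ⟨f, c, hf, hfm, h0, hc, hcy⟩ := (H.indCyc hh hij).cycleCovered_range (p i a)
    ⟨a', ha', hae⟩ (p j b) ⟨b', hb', hbe⟩ hxy hadj
  refine ⟨f, c, hf, fun t ht => ?_, h0, hc, hcy⟩
  obtain ⟨t', ht', e⟩ := hfm t ht
  rw [← e]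
  exact mem_famSet_cyc ht'

theorem CageFamily.cons (H : CageFamily G h n p u v)
    (E : Ear G (famSet h n p) u v h q) :
    CageFamily G h (n + 1) (Fin.cons q p) u v := by
  have key : ∀ (i : Fin n) a b, 0 < a → a < h → 0 < b → b < h →
      q a ≠ p i b ∧ ¬ G.Adj (q a) (p i b) := by
    intro i a b ha hah hb hbh
    refine ⟨fun e => E.out a ha hah (e ▸ mem_famSet i hbh.le), fun e => ?_⟩
    rcases E.contact a _ ha hah (mem_famSet i hbh.le) e with ⟨-, h1⟩ | ⟨-, h1⟩
    · rw [← H.zero i] at h1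
      exact (H.path i).inj 0 b hb hbh.le h1.symm
    · rw [← H.last i] at h1
      exact (H.path i).inj b h hbh le_rfl h1
  refine ⟨fun i => ?_, fun i => ?_, fun i => ?_, fun i j => ?_⟩
  · refine Fin.cases ?_ (fun i => ?_) i
    · simpa using E.path
    · simpa using H.path i
  · refine Fin.cases ?_ (fun i => ?_) i
    · simpa using E.zero
    · simpa using H.zero i
  · refine Fin.cases ?_ (fun i => ?_) i
    · simpa using E.last
    · simpa using H.last i
  · refine Fin.cases ?_ (fun i => ?_) i <;> refine Fin.cases ?_ (fun j => ?_) j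
    · intro hne; exact absurd rfl hne
    · intro _ a b ha hah hb hbh
      simpa using key j a b ha hah hb hbh
    · intro _ a b ha hah hb hbh
      have := key i b a hb hbh ha hah
      simp only [Fin.cons_zero, Fin.cons_succ]
      exact ⟨this.1.symm, fun e => this.2 e.symm⟩
    · intro hne a b ha hah hb hbh
      simpa using H.cross i j (fun e => hne (by rw [e])) a b ha hah hb hbh

/-- An ear between inner vertices of two paths closes a long cycle through a third path. -/
theorem CageFamily.exists_long_indCyc (H : CageFamily G h n p u v) {i j m : Fin n} (hij : i ≠ j)
    (him : m ≠ i) (hmj : m ≠ j) (hst : s + t = h) (hs : 2 ≤ s) (ht : 0 < t)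
    (E : Ear G (famSet h n p) (p i s) (p j t) h q) :
    ∃ f, IndCyc G f (h + (h - s + h + t)) := by
  have h1 : IndPath G (fun a => p i (s + a)) (h - s) := (H.path i).drop (by omega)
  have h2 : IndPath G (fun a => p m (h - a)) h := (H.path m).reverse
  have hd1 : ∀ a, 0 < a → a < h → p i a ≠ u ∧ p i a ≠ v := fun a ha hah =>
    ⟨by rw [← H.zero i]; exact ((H.path i).inj 0 a ha hah.le).symm,
     by rw [← H.last i]; exact (H.path i).inj a h hah le_rfl⟩
  have h12 := h1.append h2 (by simp [show s + (h - s) = h by omega, H.last])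
    (fun a b ha hb hbh => by
      by_cases hbe : b = h
      · subst hbe
        simp only [Nat.sub_self, H.zero m]
        rw [← H.zero i]
        refine ⟨((H.path i).inj 0 _ (by omega) (by omega)).symm, ?_⟩
        rw [(H.path i).adj' (by omega) (by omega)]; omega
      · exact H.cross i m him.symm _ _ (by omega) (by omega) (by omega) (by omega))
  have h123 := h12.append ((H.path j).take (i := t) (by omega)) (by
      simp only [show ¬ h - s + h ≤ h - s by omega, if_false]
      simp [show h - s + h - (h - s) = h by omega, H.zero])
    (fun a b ha hb hbt => by
      have hnv : p j b ≠ v ∧ ¬ G.Adj v (p j b) := by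
        rw [← H.last j]
        refine ⟨(H.path j).inj _ _ (by omega) le_rfl, ?_⟩
        rw [(H.path j).adj' le_rfl (by omega)]; omega
      split_ifs with hle
      · by_cases hae : a = h - s
        · rw [hae, show s + (h - s) = h by omega, H.last i]
          exact ⟨hnv.1.symm, hnv.2⟩
        · exact H.cross i j hij _ _ (by omega) (by omega) (by omega) (by omega)
      · exact H.cross m j hmj _ _ (by omega) (by omega) (by omega) (by omega))
  -- From `p i s` along path `i` to `v`, back along path `m` to `u`, then along path `j` to `p j t`.
  -- As `s ≥ 2`, the first piece has no contact with `u` and the last none with `v`. As `s + t = h`,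
  -- the cycle closed by the ear has length `2h + 2t > 2h`.
  set W : ℕ → V := fun i_1 => if i_1 ≤ h - s + h then
      (if i_1 ≤ h - s then p i (s + i_1) else p m (h - (i_1 - (h - s))))
      else p j (i_1 - (h - s + h)) with hW
  have hW0 : W 0 = p i s := by simp [hW]
  have hWl : W (h - s + h + t) = p j t := by
    simp [hW, show ¬ h - s + h + t ≤ h - s + h by omega]
  have hWm : ∀ a, a ≤ h - s + h + t → W a ∈ famSet h n p := by
    intro a ha
    simp only [hW]
    split_ifs
    · exact mem_famSet _ (by omega)
    · exact mem_famSet _ (by omega)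
    · exact mem_famSet _ (by omega)
  refine ⟨_, E.path.indCyc h123 (E.zero.trans hW0.symm) (E.last.trans hWl.symm) (by omega) (by omega)
    fun a b ha hah hb hbl => ⟨fun e => ?_, fun e => ?_⟩⟩
  · exact E.out a ha hah (e ▸ hWm b hbl.le)
  · rcases E.contact a (W b) ha hah (hWm b hbl.le) e with ⟨-, h3⟩ | ⟨-, h3⟩
    · rw [← hW0] at h3
      exact h123.inj 0 b hb hbl.le h3.symm
    · rw [← hWl] at h3
      exact h123.inj b _ hbl le_rfl h3

/-- A vertex outside yields an ear whose ends are antipodal on each cycle formed by two paths.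
Either the ends are `u` and `v`, and the ear is a new path, or they are inner vertices of two
different paths, and a third path gives an induced cycle that is too long. -/
theorem CageFamily.exists_extension [Finite V] (H : CageFamily G h n p u v) (hsc : IsSC (2 * h) G)
    (hh : 3 ≤ h) (hn : 3 ≤ n) (hA : IsPrimeOn G A) (hpA : famSet h n p ⊆ A) (hwA : w ∈ A)
    (hw : w ∉ famSet h n p) :
    ∃ p' : Fin (n + 1) → ℕ → V, CageFamily G h (n + 1) p' u v ∧ famSet h (n + 1) p' ⊆ A := by
  have hcov : CycleCovered G (2 * h) (famSet h n p) := by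
    rw [two_mul]; exact H.cycleCovered (by omega) (by omega)
  let i₀ : Fin n := ⟨0, by omega⟩
  obtain ⟨d, x, y, q, hx, hy, hd3, hkd, E, hqA, hant⟩ := hsc.exists_ear (by omega) hA hpA hcov
    (mem_famSet i₀ (Nat.zero_le h)) (mem_famSet i₀ (by omega : 2 ≤ h))
    ((H.path i₀).inj 0 2 (by omega) (by omega))
    (by rw [(H.path i₀).adj 0 2 (by omega) (by omega)]; omega) hwA hw
  obtain rfl : d = h := by omega
  have hcyc : ∀ i j : Fin n, i ≠ j → ∀ a b, a < b → b < 2 * d →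
      ((if a ≤ d then p i a else p j (d + d - a)) = x ∧
        (if b ≤ d then p i b else p j (d + d - b)) = y ∨
       (if a ≤ d then p i a else p j (d + d - a)) = y ∧
        (if b ≤ d then p i b else p j (d + d - b)) = x) → b = a + d := by
    intro i j hij a b hab hb hor
    have hc := H.indCyc (by omega) hij
    rw [← two_mul] at hc
    exact hant _ hc (fun t ht => by
      rw [two_mul]
      exact mem_famSet_cyc (p := p) (i := i) (j := j) (t := t) (h := d) (by omega)) a b hab hb
      (by simpa [two_mul] using hor)
  -- On a single path of length `d`, only its two ends are at distance `d`.
  have hsame : ∀ i s t, s ≤ d → t ≤ d → p i s = x → p i t = y →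
      (x = u ∧ y = v) ∨ (x = v ∧ y = u) := by
    intro i s t hs ht hsx hty
    have : Nontrivial (Fin n) := Fin.nontrivial_iff_two_le.2 (by omega)
    obtain ⟨j, hj⟩ := exists_ne i
    rcases lt_trichotomy s t with hlt | rfl | hlt
    · have := hcyc i j hj.symm s t hlt (by omega) (Or.inl (by simp [hs, ht, hsx, hty]))
      have h1 : s = 0 := by omega
      have h2 : t = d := by omega
      subst h1 h2
      exact Or.inl ⟨hsx.symm.trans (H.zero i), hty.symm.trans (H.last i)⟩
    · have := E.path.inj 0 d (by omega) le_rfl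
      rw [E.zero, E.last, ← hsx, ← hty] at this
      exact absurd rfl this
    · have := hcyc i j hj.symm t s hlt (by omega) (Or.inr (by simp [hs, ht, hsx, hty]))
      have h1 : t = 0 := by omega
      have h2 : s = d := by omega
      subst h1 h2
      exact Or.inr ⟨hsx.symm.trans (H.last i), hty.symm.trans (H.zero i)⟩
  have hends : (x = u ∧ y = v) ∨ (x = v ∧ y = u) := by
    obtain ⟨i, s, hs, hsx⟩ := hx
    obtain ⟨j, t, ht, hty⟩ := hy
    by_cases hij : i = j
    · subst hij
      exact hsame i s t hs ht hsx hty
    by_cases hs0 : s = 0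
    · exact hsame j 0 t (by omega) ht (by rw [H.zero, ← hsx, hs0, H.zero]) hty
    by_cases hsd : s = d
    · exact hsame j d t le_rfl ht (by rw [H.last, ← hsx, hsd, H.last]) hty
    by_cases ht0 : t = 0
    · exact hsame i s 0 hs (by omega) hsx (by rw [H.zero, ← hty, ht0, H.zero])
    by_cases htd : t = d
    · exact hsame i s d hs le_rfl hsx (by rw [H.last, ← hty, htd, H.last])
    -- On the cycle formed by paths `i` and `j`, the vertex `p j t` has position `2d - t`;
    -- antipodality gives `s + t = d`.
    have hst := hcyc i j hij s (2 * d - t) (by omega) (by omega) (Or.inl (by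
      simp only [hs, if_true, show ¬ 2 * d - t ≤ d by omega, if_false,
        show d + d - (2 * d - t) = t by omega]
      exact ⟨hsx, hty⟩))
    have hm : ∃ m : Fin n, m ≠ i ∧ m ≠ j := by
      have hcard : ({i, j} : Finset (Fin n)).card < (Finset.univ : Finset (Fin n)).card := by
        have := Finset.card_le_two (a := i) (b := j)
        rw [Finset.card_univ, Fintype.card_fin]; omega
      obtain ⟨m, -, hm⟩ := Finset.exists_mem_notMem_of_card_lt_card hcard
      exact ⟨m, by simpa using hm⟩
    obtain ⟨m, hmi, hmj⟩ := hm
    exfalso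
    -- If `s = 1`, then `t = d - 1 ≥ 2`, and the two paths exchange their roles with the ear
    -- reversed.
    by_cases hs2 : 2 ≤ s
    · obtain ⟨f, hf⟩ := H.exists_long_indCyc hij hmi hmj (by omega) hs2 (by omega)
        (hsx.symm ▸ hty.symm ▸ E)
      have := hsc.indCyc_length hf
      omega
    · obtain ⟨f, hf⟩ := H.exists_long_indCyc (Ne.symm hij) hmj hmi (s := t) (t := s) (by omega)
        (by omega) (by omega) (hsx.symm ▸ hty.symm ▸ E.reverse)
      have := hsc.indCyc_length hf
      omega
  have hfin : ∀ q, Ear G (famSet d n p) u v d q → (∀ i, 0 < i → i < d → q i ∈ A) →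
      ∃ p' : Fin (n + 1) → ℕ → V, CageFamily G d (n + 1) p' u v ∧ famSet d (n + 1) p' ⊆ A := by
    intro q E hqA
    refine ⟨_, H.cons E, ?_⟩
    rintro z ⟨i, a, ha, rfl⟩
    refine Fin.cases ?_ (fun i => ?_) i
    · simp only [Fin.cons_zero]
      rcases Nat.eq_zero_or_pos a with rfl | ha0
      · rw [E.zero, ← H.zero i₀]; exact hpA (mem_famSet _ (by omega))
      · rcases ha.eq_or_lt with rfl | had
        · rw [E.last, ← H.last i₀]; exact hpA (mem_famSet _ le_rfl)
        · exact hqA a ha0 had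
    · simpa using hpA (mem_famSet i ha)
  rcases hends with ⟨rfl, rfl⟩ | ⟨rfl, rfl⟩
  · exact hfin q E hqA
  · exact hfin _ E.reverse fun i h0 h1 => hqA _ (by omega) (by omega)

/-- The second vertices of the paths are distinct. This bounds the number of paths, so repeated
extension terminates. -/
theorem CageFamily.le_card [Finite V] (H : CageFamily G h n p u v) (hh : 2 ≤ h) :
    n ≤ Nat.card V := by
  have hinj : Function.Injective fun i => p i 1 := by
    intro i j e
    by_contra hij
    exact (H.cross i j hij 1 1 (by omega) (by omega) (by omega) (by omega)).1 e
  simpa using Nat.card_le_card_of_injective _ hinj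

theorem CageFamily.exists_spanning [Finite V] (hsc : IsSC (2 * h) G) (hh : 3 ≤ h)
    (hA : IsPrimeOn G A) (H : CageFamily G h n p u v) (hn : 3 ≤ n) (hpA : famSet h n p ⊆ A) :
    ∃ n', 3 ≤ n' ∧ ∃ p' : Fin n' → ℕ → V, CageFamily G h n' p' u v ∧ famSet h n' p' = A := by
  induction hN : Nat.card V - n using Nat.strong_induction_on generalizing n with
  | _ N ih =>
  by_cases hall : A ⊆ famSet h n p
  · exact ⟨n, hn, p, H, hpA.antisymm hall⟩
  · obtain ⟨w, hwA, hw⟩ := Set.not_subset.1 hall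
    obtain ⟨p', H', hp'⟩ := H.exists_extension hsc hh hn hA hpA hwA hw
    have := H'.le_card (by omega)
    exact ih _ (by omega) H' (by omega) hp' rfl

theorem CageFamily.adj_iff (H : CageFamily G h n p u v) {i j : Fin n} {a b : ℕ} (ha : 0 < a)
    (hah : a < h) (hb : 0 < b) (hbh : b < h) :
    G.Adj (p i a) (p j b) ↔ i = j ∧ (b = a + 1 ∨ a = b + 1) := by
  by_cases hij : i = j
  · subst hij
    rw [(H.path i).adj' hah.le hbh.le]; simp
  · simp [hij, (H.cross i j hij a b ha hah hb hbh).2]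

theorem CageFamily.nonempty_iso (H : CageFamily G h n p u v) (hn : 0 < n) (hh : 3 ≤ h)
    (hA : famSet h n p = A) {l : ℕ} (hl : l = h + 1) : Nonempty (cage n l ≃g G.induce A) := by
  subst hl hA
  let i₀ : Fin n := ⟨0, hn⟩
  let F : Bool ⊕ Fin n × Fin (h + 1 - 2) → V :=
    Sum.elim (fun b => if b then v else u) fun ij => p ij.1 (ij.2 + 1)
  have huv : u ≠ v ∧ ¬ G.Adj u v := by
    rw [← H.zero i₀, ← H.last i₀]
    refine ⟨(H.path i₀).inj 0 h (by omega) le_rfl, ?_⟩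
    rw [(H.path i₀).adj 0 h (by omega) le_rfl]; omega
  have hu : ∀ i b, 0 < b → b < h → u ≠ p i b ∧ (G.Adj u (p i b) ↔ b = 1) := by
    intro i b hb hbh
    rw [← H.zero i]
    exact ⟨(H.path i).inj 0 b hb hbh.le, by rw [(H.path i).adj 0 b hb hbh.le]⟩
  have hv : ∀ i b, 0 < b → b < h → v ≠ p i b ∧ (G.Adj v (p i b) ↔ b + 1 = h) := by
    intro i b hb hbh
    rw [← H.last i]
    exact ⟨((H.path i).inj b h hbh le_rfl).symm, by rw [G.adj_comm, (H.path i).adj b h hbh le_rfl]; omega⟩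
  have hne : ∀ i j a b, 0 < a → a < h → 0 < b → b < h → p i a = p j b → i = j ∧ a = b := by
    intro i j a b ha hah hb hbh e
    by_cases hij : i = j
    · subst hij; exact ⟨rfl, (H.path i).inj' hah.le hbh.le e⟩
    · exact absurd e (H.cross i j hij a b ha hah hb hbh).1
  have hinj : Function.Injective F := by
    rintro (a | ⟨i, a⟩) (b | ⟨j, b⟩) e
    · cases a <;> cases b <;> simp [F, huv.1, huv.1.symm] at e ⊢
    · cases a
      · exact absurd e (hu j _ (by omega) (by omega)).1
      · exact absurd e (hv j _ (by omega) (by omega)).1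
    · cases b
      · exact absurd e.symm (hu i _ (by omega) (by omega)).1
      · exact absurd e.symm (hv i _ (by omega) (by omega)).1
    · obtain ⟨rfl, h2⟩ := hne i j _ _ (by omega) (by omega) (by omega) (by omega) e
      have : a = b := Fin.ext (Nat.succ_injective h2)
      rw [this]
  have hadj : ∀ a b, G.Adj (F a) (F b) ↔ (cage n (h + 1)).Adj a b := by
    rintro (a | ⟨i, a⟩) (b | ⟨j, b⟩)
    · cases a <;> cases b <;> simp [F, cage, huv.2, G.adj_comm v u]
    · have ha := b.2
      cases a
      · simp only [F, Sum.elim_inl, Sum.elim_inr, cage, SimpleGraph.fromRel_adj, Bool.false_eq_true, if_false]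
        rw [(hu j _ (by omega) (by omega)).2]; simp
      · simp only [F, Sum.elim_inl, Sum.elim_inr, cage, SimpleGraph.fromRel_adj, if_true]
        rw [(hv j _ (by omega) (by omega)).2]; simp; omega
    · have ha := a.2
      rw [G.adj_comm]
      cases b
      · simp only [F, Sum.elim_inl, Sum.elim_inr, cage, SimpleGraph.fromRel_adj, Bool.false_eq_true, if_false]
        rw [(hu i _ (by omega) (by omega)).2]; simp
      · simp only [F, Sum.elim_inl, Sum.elim_inr, cage, SimpleGraph.fromRel_adj, if_true]
        rw [(hv i _ (by omega) (by omega)).2]; simp; omega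
    · have ha := a.2
      have hb := b.2
      simp only [F, Sum.elim_inr, cage, SimpleGraph.fromRel_adj]
      rw [H.adj_iff (by omega) (by omega) (by omega) (by omega)]
      constructor
      · rintro ⟨rfl, h1⟩
        refine ⟨fun e => ?_, by simp; omega⟩
        simp only [Sum.inr.injEq, Prod.mk.injEq, true_and] at e
        subst e; omega
      · rintro ⟨-, ⟨rfl, h1⟩ | ⟨rfl, h1⟩⟩
        · exact ⟨rfl, by omega⟩
        · exact ⟨rfl, by omega⟩
  have hmem : ∀ c, F c ∈ famSet h n p := by
    rintro (a | ⟨i, a⟩)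
    · cases a
      · simp only [F, Sum.elim_inl, Bool.false_eq_true, if_false]
        rw [← H.zero i₀]; exact mem_famSet _ (by omega)
      · simp only [F, Sum.elim_inl, if_true]
        rw [← H.last i₀]; exact mem_famSet _ le_rfl
    · exact mem_famSet _ (by have := a.2; omega)
  refine ⟨⟨Equiv.ofBijective (fun c => ⟨F c, hmem c⟩) ⟨fun a b e => hinj (congrArg Subtype.val e), ?_⟩,
    fun {a b} => hadj a b⟩⟩
  rintro ⟨w, i, a, ha, rfl⟩
  rcases Nat.eq_zero_or_pos a with rfl | ha0
  · exact ⟨Sum.inl false, Subtype.ext (H.zero i).symm⟩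
  · rcases ha.eq_or_lt with rfl | hah
    · exact ⟨Sum.inl true, Subtype.ext (H.last i).symm⟩
    · refine ⟨Sum.inr (i, ⟨a - 1, by omega⟩), Subtype.ext ?_⟩
      simp [F, show a - 1 + 1 = a by omega]

theorem IndCyc.nonempty_iso {f : ℕ → V} (hf : IndCyc G f k) (hA : ∀ t, t < k → f t ∈ A)
    (hall : ∀ w ∈ A, ∃ t, t < k ∧ f t = w) :
    Nonempty (SimpleGraph.cycleGraph k ≃g G.induce A) := by
  refine ⟨⟨Equiv.ofBijective (fun i : Fin k => (⟨f i, hA i i.2⟩ : A)) ⟨fun i j e => ?_, ?_⟩, ?_⟩⟩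
  · exact Fin.ext (hf.inj' i.2 j.2 (congrArg Subtype.val e))
  · rintro ⟨w, hw⟩
    obtain ⟨t, ht, e⟩ := hall w hw
    exact ⟨⟨t, ht⟩, Subtype.ext e⟩
  · intro i j
    rw [cycleGraph_adj_iff hf.three_le]
    exact hf.adj' i.2 j.2

/-- Prime sets of `SC_k` graphs that are not cliques are cycles or cages. -/
theorem IsSC.cycle_or_cage [Finite V] (hsc : IsSC k G) (hk : 5 ≤ k) (hA : IsPrimeOn G A) (hx : x ∈ A)
    (hy : y ∈ A) (hxy : x ≠ y) (hadj : ¬ G.Adj x y) :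
    Nonempty (SimpleGraph.cycleGraph k ≃g G.induce A) ∨
      Even k ∧ ∃ n, 3 ≤ n ∧ Nonempty (cage n (k / 2 + 1) ≃g G.induce A) := by
  obtain ⟨f, hf, hfA⟩ := hsc.exists_indCyc hk hA hx hy hxy hadj
  by_cases hall : ∀ w ∈ A, ∃ t, t < k ∧ f t = w
  · exact Or.inl (hf.nonempty_iso hfA hall)
  right
  push Not at hall
  obtain ⟨w, hwA, hw⟩ := hall
  obtain ⟨d, x, y, q, ⟨a, ha, hax⟩, ⟨b, hb, hby⟩, hd3, rfl, E, hqA, hant⟩ :=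
    hsc.exists_ear hk hA (K := {v | ∃ t, t < k ∧ f t = v}) (by rintro v ⟨t, ht, rfl⟩; exact hfA t ht)
    hf.cycleCovered_range (x₀ := f 0) (y₀ := f 2) ⟨0, by omega, rfl⟩ ⟨2, by omega, rfl⟩
    (hf.inj 0 2 (by omega) (by omega)) (by rw [hf.adj 0 2 (by omega) (by omega)]; omega) hwA
    (w := w) (by rintro ⟨t, ht, e⟩; exact hw t ht e)
  refine ⟨by simp, ?_⟩
  have hg := hf.rotate a ha
  set g := fun t => f ((a + t) % (2 * d)) with hgdef
  have hgK : ∀ t, g t ∈ {v | ∃ t, t < 2 * d ∧ f t = v} := fun t => ⟨_, Nat.mod_lt _ (by omega), rfl⟩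
  have hg0 : g 0 = x := by simpa [hgdef, Nat.mod_eq_of_lt ha] using hax
  -- The cycle is rotated to start at `x`; antipodality of the ear then puts `y` at position `d`.
  have hgd : g d = y := by
    obtain ⟨c, hc, hcy⟩ : ∃ c, c < 2 * d ∧ g c = y := by
      refine ⟨if a ≤ b then b - a else 2 * d + b - a, by split_ifs <;> omega, ?_⟩
      rw [← hby]
      simp only [hgdef]
      split_ifs
      · rw [show a + (b - a) = b by omega, Nat.mod_eq_of_lt hb]
      · rw [show a + (2 * d + b - a) = 2 * d + b by omega, Nat.add_mod_left, Nat.mod_eq_of_lt hb]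
    have hc0 : c ≠ 0 := by
      rintro rfl
      have := E.path.inj 0 d (by omega) le_rfl
      rw [E.zero, E.last, ← hg0, ← hcy] at this
      exact this rfl
    have := hant g hg (fun t _ => hgK t) 0 c (by omega) hc (Or.inl ⟨hg0, hcy⟩)
    rw [← hcy, this, zero_add]
  have hr := hg.reflect
  -- The two arcs between the antipodal vertices `x` and `y`. With the ear they make three paths,
  -- enough for `CageFamily.exists_extension`.
  have H2 : CageFamily G d 2 ![g, fun t => g ((2 * d - t) % (2 * d))] x y := by
    have hcr : ∀ a b, 0 < a → a < d → 0 < b → b < d → g a ≠ g ((2 * d - b) % (2 * d)) ∧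
        ¬ G.Adj (g a) (g ((2 * d - b) % (2 * d))) := by
      intro a b ha had hb hbd
      rw [Nat.mod_eq_of_lt (by omega)]
      refine ⟨hg.inj _ _ (by omega) (by omega), ?_⟩
      rw [hg.adj' (by omega) (by omega)]; omega
    refine ⟨fun i => ?_, fun i => ?_, fun i => ?_, fun i j hij => ?_⟩
    · fin_cases i
      · exact hg.indPath (by omega)
      · exact hr.indPath (by omega)
    · fin_cases i
      · exact hg0
      · simpa using hg0
    · fin_cases i
      · exact hgd
      · simpa [show 2 * d - d = d by omega, Nat.mod_eq_of_lt (show d < 2 * d by omega)] using hgd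
    · fin_cases i <;> fin_cases j
      · exact absurd rfl hij
      · exact hcr
      · intro a b ha had hb hbd
        exact ⟨(hcr b a hb hbd ha had).1.symm, fun e => (hcr b a hb hbd ha had).2 e.symm⟩
      · exact absurd rfl hij
  have hsub : famSet d 2 ![g, fun t => g ((2 * d - t) % (2 * d))] ⊆
      {v | ∃ t, t < 2 * d ∧ f t = v} := by
    rintro z ⟨i, t, -, rfl⟩
    fin_cases i
    · exact hgK _
    · exact hgK _
  have E2 : Ear G (famSet d 2 ![g, fun t => g ((2 * d - t) % (2 * d))]) x y d q :=
    ⟨E.path, E.zero, E.last, fun i h0 h1 hm => E.out i h0 h1 (hsub hm),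
      fun i z h0 h1 hz => E.contact i z h0 h1 (hsub hz)⟩
  have H3 := H2.cons E2
  have hfA' : ∀ z ∈ {v | ∃ t, t < 2 * d ∧ f t = v}, z ∈ A := by
    rintro v ⟨t, ht, rfl⟩; exact hfA t ht
  obtain ⟨n, hn, p, H, hpA⟩ := H3.exists_spanning hsc hd3 hA le_rfl (by
    rintro z ⟨i, t, ht, rfl⟩
    refine Fin.cases ?_ (fun i => ?_) i
    · simp only [Fin.cons_zero]
      rcases Nat.eq_zero_or_pos t with rfl | ht0
      · rw [E.zero, ← hg0]; exact hfA' _ (hgK _)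
      · rcases ht.eq_or_lt with rfl | htd
        · rw [E.last, ← hgd]; exact hfA' _ (hgK _)
        · exact hqA t ht0 htd
    · exact hfA' _ (hsub (mem_famSet i ht)))
  exact ⟨n, hn, H.nonempty_iso (by omega) hd3 hpA (by omega)⟩

end Cages

/-! ### Hubs: vertices whose removal leaves a forest -/

/-- The vertex `u` of `A` meets every subset of `A` that induces minimum degree at least two. -/
structure IsHub {V : Type*} (G : SimpleGraph V) (A : Set V) (u : V) : Prop where
  mem : u ∈ A
  forest : ∀ Z ⊆ A, u ∉ Z → (∀ z ∈ Z, ∃ a ∈ Z, ∃ b ∈ Z, a ≠ b ∧ G.Adj z a ∧ G.Adj z b) → Z = ∅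

section Hubs

variable {V : Type*} {G : SimpleGraph V} {A : Set V} {u v w : V} {k h n : ℕ}
  {p : Fin n → ℕ → V} {f : ℕ → V}

theorem exists_indCyc_of_iso (hk : 3 ≤ k) (e : SimpleGraph.cycleGraph k ≃g G.induce A) (hu : u ∈ A) :
    ∃ f, IndCyc G f k ∧ f 0 = u ∧ A = {v | ∃ t, t < k ∧ f t = v} := by
  have hf := indCyc_of_embedding hk (e.toEmbedding.trans (SimpleGraph.Embedding.induce A))
  obtain ⟨i, hi⟩ := e.surjective ⟨u, hu⟩
  have hr := hf.rotate i i.2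
  refine ⟨_, hr, ?_, ?_⟩
  · simp [Nat.mod_eq_of_lt i.2, hi]
  · ext v
    constructor
    · intro hv
      obtain ⟨j, hj⟩ := e.surjective ⟨v, hv⟩
      refine ⟨if i ≤ j then j - i else k + j - i, by split_ifs <;> omega, ?_⟩
      have : (i + if i ≤ j then (j : ℕ) - i else k + j - i) % k = j := by
        split_ifs with hij
        · rw [show (i : ℕ) + (j - i) = j by omega, Nat.mod_eq_of_lt j.2]
        · rw [show (i : ℕ) + (k + j - i) = k + j by omega, Nat.add_mod_left, Nat.mod_eq_of_lt j.2]
      simp [this, Nat.mod_eq_of_lt j.2, hj]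
    · rintro ⟨t, ht, rfl⟩
      simp

/-- A vertex of `Z` needs both its neighbours on the cycle in `Z`. Starting from `u ∉ Z`, all
vertices are excluded one after the other. -/
theorem isHub_of_cycle (hk : 4 ≤ k) (e : SimpleGraph.cycleGraph k ≃g G.induce A) (hu : u ∈ A) :
    IsHub G A u ∧ (G.neighborSet u ∩ A).ncard = 2 ∧ A.ncard = k := by
  obtain ⟨f, hf, rfl, hA⟩ := exists_indCyc_of_iso (by omega) e hu
  refine ⟨⟨hu, fun Z hZ h0 hdeg => ?_⟩, ?_, ?_⟩
  · have hno : ∀ t, t < k → f t ∉ Z := by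
      intro t
      induction t with
      | zero => exact fun _ => h0
      | succ t ih =>
        intro ht hm
        obtain ⟨a, ha, b, hb, hab, h1, h2⟩ := hdeg _ hm
        obtain ⟨i, hi, rfl⟩ : a ∈ {v | ∃ t, t < k ∧ f t = v} := hA ▸ hZ ha
        obtain ⟨j, hj, rfl⟩ : b ∈ {v | ∃ t, t < k ∧ f t = v} := hA ▸ hZ hb
        have hij : i ≠ j := fun e => hab (by rw [e])
        have hit : i ≠ t := by
          rintro rfl; exact ih (by omega) ha
        have hjt : j ≠ t := by
          rintro rfl; exact ih (by omega) hb
        rw [hf.adj' ht hi] at h1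
        rw [hf.adj' ht hj] at h2
        omega
    refine Set.eq_empty_of_forall_notMem fun z hz => ?_
    obtain ⟨i, hi, rfl⟩ : z ∈ {v | ∃ t, t < k ∧ f t = v} := hA ▸ hZ hz
    exact hno i hi hz
  · have : G.neighborSet (f 0) ∩ A = {f 1, f (k - 1)} := by
      ext z
      simp only [Set.mem_inter_iff, SimpleGraph.mem_neighborSet, Set.mem_insert_iff,
        Set.mem_singleton_iff]
      constructor
      · rintro ⟨h1, hz⟩
        obtain ⟨i, hi, rfl⟩ : z ∈ {v | ∃ t, t < k ∧ f t = v} := hA ▸ hz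
        rw [hf.adj' (by omega) hi] at h1
        rcases h1 with h1 | h1 | h1 | h1
        · left; rw [h1]
        · omega
        · right; rw [show k - 1 = i by omega]
        · omega
      · rintro (rfl | rfl)
        · exact ⟨(hf.adj' (by omega) (by omega)).2 (by omega), by rw [hA]; exact ⟨1, by omega, rfl⟩⟩
        · exact ⟨(hf.adj' (by omega) (by omega)).2 (by omega),
            by rw [hA]; exact ⟨k - 1, by omega, rfl⟩⟩
    rw [this, Set.ncard_pair (hf.inj _ _ (by omega) (by omega))]
  · rw [← Nat.card_coe_set_eq, ← Nat.card_congr e.toEquiv]; simp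

theorem CageFamily.reverse (H : CageFamily G h n p u v) :
    CageFamily G h n (fun i a => p i (h - a)) v u ∧
      famSet h n (fun i a => p i (h - a)) = famSet h n p := by
  refine ⟨⟨fun i => (H.path i).reverse, fun i => by simpa using H.last i,
    fun i => by simpa using H.zero i, fun i j hij a b ha hah hb hbh =>
      H.cross i j hij _ _ (by omega) (by omega) (by omega) (by omega)⟩, ?_⟩
  ext w
  constructor
  · rintro ⟨i, a, ha, rfl⟩
    exact ⟨i, h - a, by omega, rfl⟩
  · rintro ⟨i, a, ha, rfl⟩
    exact ⟨i, h - a, by omega, by simp [show h - (h - a) = a by omega]⟩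

theorem CageFamily.eq_of_adj_inner (H : CageFamily G h n p u v) {i : Fin n} {a : ℕ} (ha : 0 < a)
    (hah : a < h) (hw : w ∈ famSet h n p) (hadj : G.Adj (p i a) w) :
    w = p i (a - 1) ∨ w = p i (a + 1) := by
  obtain ⟨j, b, hb, rfl⟩ := hw
  have key : ∀ b, b ≤ h → G.Adj (p i a) (p i b) → p i b = p i (a - 1) ∨ p i b = p i (a + 1) := by
    intro b hb hadj
    rw [(H.path i).adj' hah.le hb] at hadj
    rcases hadj with rfl | rfl
    · exact Or.inr rfl
    · exact Or.inl rfl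
  by_cases hij : i = j
  · subst hij; exact key b hb hadj
  · rcases Nat.eq_zero_or_pos b with rfl | hb0
    · rw [H.zero j, ← H.zero i] at hadj ⊢
      exact key 0 (by omega) hadj
    · rcases hb.eq_or_lt with rfl | hbh
      · rw [H.last j, ← H.last i] at hadj ⊢
        exact key b le_rfl hadj
      · exact absurd hadj (H.cross i j hij a b ha hah hb0 hbh).2

theorem CageFamily.eq_of_adj_zero (H : CageFamily G h n p u v) (hh : 2 ≤ h)
    (hw : w ∈ famSet h n p) (hadj : G.Adj u w) : ∃ i, w = p i 1 := by
  obtain ⟨j, b, hb, rfl⟩ := hw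
  rw [← H.zero j, (H.path j).adj' (by omega) hb] at hadj
  exact ⟨j, by congr 1; omega⟩

theorem CageFamily.eq_of_adj_last (H : CageFamily G h n p u v) (hh : 2 ≤ h)
    (hw : w ∈ famSet h n p) (hadj : G.Adj v w) : ∃ i, w = p i (h - 1) := by
  obtain ⟨j, b, hb, rfl⟩ := hw
  rw [← H.last j, (H.path j).adj' (by omega) hb] at hadj
  exact ⟨j, by congr 1; omega⟩

/-- Without `u` the cage is a tree of paths hanging at `v`. Inner vertices are excluded from `Z` one
by one along each path, starting at `u`; after that `v` has no neighbour left in `Z`. -/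
theorem CageFamily.isHub (H : CageFamily G h n p u v) (hh : 2 ≤ h) (hn : 0 < n) :
    IsHub G (famSet h n p) u := by
  refine ⟨by rw [← H.zero ⟨0, hn⟩]; exact mem_famSet _ (by omega), fun Z hZ h0 hdeg => ?_⟩
  have hno : ∀ i t, t < h → p i t ∉ Z := by
    intro i t
    induction t with
    | zero => intro _; rw [H.zero]; exact h0
    | succ t ih =>
      intro ht hm
      obtain ⟨a, ha, b, hb, hab, h1, h2⟩ := hdeg _ hm
      have h3 := H.eq_of_adj_inner (by omega) ht (hZ ha) h1
      have h4 := H.eq_of_adj_inner (by omega) ht (hZ hb) h2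
      have hz := ih (by omega)
      rw [Nat.add_sub_cancel] at h3 h4
      rcases h3 with rfl | rfl
      · exact hz ha
      · rcases h4 with rfl | rfl
        · exact hz hb
        · exact hab rfl
  refine Set.eq_empty_of_forall_notMem fun z hz => ?_
  obtain ⟨i, t, ht, rfl⟩ := hZ hz
  rcases ht.eq_or_lt with rfl | ht
  · obtain ⟨a, ha, -, -, -, h1, -⟩ := hdeg _ hz
    rw [H.last] at h1
    obtain ⟨j, rfl⟩ := H.eq_of_adj_last hh (hZ ha) h1
    exact hno j _ (by omega) ha
  · exact hno i t ht hz

theorem CageFamily.ncard_neighborSet (H : CageFamily G h n p u v) (hh : 2 ≤ h) :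
    (G.neighborSet u ∩ famSet h n p).ncard = n := by
  have : G.neighborSet u ∩ famSet h n p = (fun i => p i 1) '' Set.univ := by
    ext w
    constructor
    · rintro ⟨h1, h2⟩
      obtain ⟨i, rfl⟩ := H.eq_of_adj_zero hh h2 h1
      exact ⟨i, trivial, rfl⟩
    · rintro ⟨i, -, rfl⟩
      refine ⟨?_, mem_famSet _ (by omega)⟩
      rw [SimpleGraph.mem_neighborSet, ← H.zero i, (H.path i).adj' (by omega) (by omega)]
      omega
  rw [this, Set.ncard_image_of_injective, Set.ncard_univ, Nat.card_fin]
  intro i j e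
  by_contra hij
  exact (H.cross i j hij 1 1 (by omega) (by omega) (by omega) (by omega)).1 e

/-- Converse of `CageFamily.nonempty_iso`: degrees and forests are easier to treat with families of
paths. -/
theorem exists_cageFamily_of_iso {l : ℕ} (hl : l = h + 1) (hh : 2 ≤ h) (hn : 0 < n)
    (e : cage n l ≃g G.induce A) : ∃ u v, ∃ p : Fin n → ℕ → V,
      CageFamily G h n p u v ∧ famSet h n p = A := by
  subst hl
  set F := fun c => ((e c : A) : V) with hF
  have hFi : ∀ c d, F c = F d ↔ c = d := fun c d =>
    ⟨fun h => e.injective (Subtype.ext h), fun h => by rw [h]⟩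
  have hFa : ∀ c d, G.Adj (F c) (F d) ↔ (cage n (h + 1)).Adj c d := fun c d => e.map_adj_iff
  let c : Fin n → ℕ → Bool ⊕ Fin n × Fin (h + 1 - 2) := fun i a =>
    if h0 : a = 0 then Sum.inl false else if h1 : a < h then Sum.inr (i, ⟨a - 1, by omega⟩)
      else Sum.inl true
  have c0 : ∀ i, c i 0 = Sum.inl false := fun i => by simp [c]
  have ch : ∀ i, c i h = Sum.inl true := fun i => by simp [c, show h ≠ 0 by omega]
  have cm : ∀ i a (h0 : 0 < a) (h1 : a < h), c i a = Sum.inr (i, ⟨a - 1, by omega⟩) := by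
    intro i a h0 h1
    simp [c, h1, h0.ne']
  refine ⟨F (Sum.inl false), F (Sum.inl true), fun i a => F (c i a), ⟨fun i => ?_, fun i => ?_,
    fun i => ?_, fun i j hij a b ha hah hb hbh => ?_⟩, ?_⟩
  · refine ⟨fun a b hab hb => ?_, fun a b hab hb => ?_⟩
    · rw [Ne, hFi]
      rcases Nat.eq_zero_or_pos a with rfl | ha0 <;> rcases hb.eq_or_lt with rfl | hbh
      · simp [c0, ch]
      · simp [c0, cm i b hab hbh]
      · simp [cm i a ha0 hab, ch]
      · simp [cm i a ha0 (by omega), cm i b (by omega) hbh]; omega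
    · rw [hFa]
      rcases Nat.eq_zero_or_pos a with rfl | ha0 <;> rcases hb.eq_or_lt with rfl | hbh
      · simp [c0, ch, cage]; omega
      · simp [c0, cm i b hab hbh, cage]; omega
      · simp [cm i a ha0 hab, ch, cage]; omega
      · simp [cm i a ha0 (by omega), cm i b (by omega) hbh, cage]; omega
  · simp [c0]
  · simp [ch]
  · rw [Ne, hFi, hFa, cm i a ha hah, cm j b hb hbh]
    simp [cage, hij, Ne.symm hij]
  · ext w
    constructor
    · rintro ⟨i, a, ha, rfl⟩
      exact (e (c i a)).2
    · intro hw
      obtain ⟨b, hb⟩ := e.surjective ⟨w, hw⟩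
      have hb : F b = w := congrArg Subtype.val hb
      rcases b with b | ⟨i, j⟩
      · cases b
        · exact ⟨⟨0, hn⟩, 0, by omega, by simp [c0, hb]⟩
        · exact ⟨⟨0, hn⟩, h, le_rfl, by simp [ch, hb]⟩
      · exact ⟨i, j + 1, by omega, by simp [cm i (j + 1) (by omega) (by omega), hb]⟩

/-- Inner vertices have degree at most two, less than the degree `n ≥ 3` of an end. So a vertex of
maximum degree is one of the two ends, which are exchanged by reversing the paths. -/
theorem isHub_of_cage [Finite V] (hk : 5 ≤ k) (hke : Even k) (hn : 3 ≤ n)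
    (e : cage n (k / 2 + 1) ≃g G.induce A) (hu : IsMaxDegreeIn G A u) :
    IsHub G A u ∧ (G.neighborSet u ∩ A).ncard = n ∧ A.ncard = n * (k / 2 - 1) + 2 ∧
      ∃ x ∈ A, ∃ y ∈ A, x ≠ y ∧ ¬ G.Adj x y := by
  obtain ⟨h, rfl⟩ := hke
  obtain ⟨x, y, p, H, rfl⟩ := exists_cageFamily_of_iso (h := h) (by omega) (by omega) (by omega) e
  have hx := H.ncard_neighborSet (by omega)
  have hxm : x ∈ famSet h n p := (H.isHub (by omega) (by omega)).mem
  have hdeg := hu.2 x hxm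
  rw [hx] at hdeg
  have hcard : (famSet h n p).ncard = n * ((h + h) / 2 - 1) + 2 := by
    rw [← Nat.card_coe_set_eq, ← Nat.card_congr e.toEquiv]
    simp [Nat.card_eq_fintype_card]
    omega
  have hnon : ∃ x ∈ famSet h n p, ∃ y ∈ famSet h n p, x ≠ y ∧ ¬ G.Adj x y := by
    let i₀ : Fin n := ⟨0, by omega⟩
    refine ⟨_, mem_famSet i₀ (Nat.zero_le h), _, mem_famSet i₀ le_rfl,
      (H.path i₀).inj 0 h (by omega) le_rfl, ?_⟩
    rw [(H.path i₀).adj 0 h (by omega) le_rfl]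
    omega
  have hends : u = x ∨ u = y := by
    obtain ⟨i, a, ha, rfl⟩ := hu.1
    rcases Nat.eq_zero_or_pos a with rfl | ha0
    · exact Or.inl (H.zero i)
    · rcases ha.eq_or_lt with rfl | hah
      · exact Or.inr (H.last i)
      · exfalso
        have : (G.neighborSet (p i a) ∩ famSet h n p).ncard ≤ 2 := by
          refine (Set.ncard_le_ncard (t := {p i (a - 1), p i (a + 1)}) ?_ (Set.toFinite _)).trans
            (Set.ncard_insert_le _ _ |>.trans (by simp))
          rintro w ⟨h1, h2⟩
          exact H.eq_of_adj_inner ha0 hah h2 h1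
        omega
  rcases hends with rfl | rfl
  · exact ⟨H.isHub (by omega) (by omega), hx, hcard, hnon⟩
  · obtain ⟨H', hset⟩ := H.reverse
    have h1 := H'.isHub (by omega) (by omega)
    have h2 := H'.ncard_neighborSet (by omega)
    rw [hset] at h1 h2
    exact ⟨h1, h2, hcard, hnon⟩

end Hubs

/-! ### Correctness of Fill-in -/

/-- The components to which the algorithm adds edges. -/
def IsBig {V : Type*} (k : ℕ) (G : SimpleGraph V) (A : Set V) : Prop :=
  IsCycleComponent k G A ∨ ∃ n, IsCageComponent k G A n

/-- `hub` records admissible choices of the algorithm. -/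
def IsHubChoice {V : Type*} (k : ℕ) (G : SimpleGraph V) (hub : Set V → V) : Prop :=
  (∀ A, IsCycleComponent k G A → hub A ∈ A) ∧
    ∀ A n, IsCageComponent k G A n → IsMaxDegreeIn G A (hub A)

/-- The graph obtained by joining each hub to its component. -/
def hubGraph {V : Type*} (k : ℕ) (G : SimpleGraph V) (hub : Set V → V) : SimpleGraph V :=
  G ⊔ SimpleGraph.fromRel fun u v => ∃ A, IsBig k G A ∧ u = hub A ∧ v ∈ A

section FillIn

variable {V : Type*} {G H : SimpleGraph V} {A B : Set V} {u v w x y a b : V} {k h n m : ℕ}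
  {hub : Set V → V} {f : ℕ → V}

theorem isFillInOutput_iff : IsFillInOutput k G H ↔ ∃ hub, IsHubChoice k G hub ∧ H = hubGraph k G hub :=
  ⟨fun ⟨hub, h1, h2, h3⟩ => ⟨hub, ⟨h1, h2⟩, h3⟩, fun ⟨hub, ⟨h1, h2⟩, h3⟩ => ⟨hub, h1, h2, h3⟩⟩

theorem IsBig.isComponent (hA : IsBig k G A) : IsComponent G A :=
  hA.elim And.left fun ⟨_, h⟩ => h.1

theorem IsSC.isBig (hsc : IsSC k G) [Finite V] (hk : 5 ≤ k) (hA : IsComponent G A) (hx : x ∈ A)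
    (hy : y ∈ A) (hxy : x ≠ y) (hadj : ¬ G.Adj x y) : IsBig k G A := by
  rcases hsc.cycle_or_cage hk hA.1 hx hy hxy hadj with h | ⟨hke, n, hn, h⟩
  · exact Or.inl ⟨hA, h⟩
  · exact Or.inr ⟨n, hA, hke, hn, h⟩

theorem IsBig.exists_nonadj [Finite V] (hk : 5 ≤ k) (hA : IsBig k G A)
    (hhub : IsHubChoice k G hub) : ∃ x ∈ A, ∃ y ∈ A, x ≠ y ∧ ¬ G.Adj x y := by
  rcases hA with hA | ⟨n, hA⟩
  · obtain ⟨f, hf, -, hfA⟩ := exists_indCyc_of_iso (by omega) hA.2.some (hhub.1 A hA)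
    refine ⟨f 0, ?_, f 2, ?_, hf.inj 0 2 (by omega) (by omega), ?_⟩
    · rw [hfA]; exact ⟨0, by omega, rfl⟩
    · rw [hfA]; exact ⟨2, by omega, rfl⟩
    · rw [hf.adj 0 2 (by omega) (by omega)]; omega
  · exact (isHub_of_cage hk hA.2.1 hA.2.2.1 hA.2.2.2.some (hhub.2 A n hA)).2.2.2

theorem IsBig.isHub [Finite V] (hk : 5 ≤ k) (hA : IsBig k G A) (hhub : IsHubChoice k G hub) :
    IsHub G A (hub A) := by
  rcases hA with hA | ⟨n, hA⟩
  · exact (isHub_of_cycle (by omega) hA.2.some (hhub.1 A hA)).1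
  · exact (isHub_of_cage hk hA.2.1 hA.2.2.1 hA.2.2.2.some (hhub.2 A n hA)).1

theorem hubGraph_adj : (hubGraph k G hub).Adj a b ↔
    G.Adj a b ∨ (a ≠ b ∧ ∃ A, IsBig k G A ∧ ((a = hub A ∧ b ∈ A) ∨ (b = hub A ∧ a ∈ A))) := by
  simp only [hubGraph, SimpleGraph.sup_adj, SimpleGraph.fromRel_adj]
  refine or_congr Iff.rfl (and_congr Iff.rfl ⟨?_, ?_⟩)
  · rintro (⟨A, h1, h2, h3⟩ | ⟨A, h1, h2, h3⟩)
    · exact ⟨A, h1, Or.inl ⟨h2, h3⟩⟩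
    · exact ⟨A, h1, Or.inr ⟨h2, h3⟩⟩
  · rintro ⟨A, h1, ⟨h2, h3⟩ | ⟨h2, h3⟩⟩
    · exact Or.inl ⟨A, h1, h2, h3⟩
    · exact Or.inr ⟨A, h1, h2, h3⟩

theorem le_hubGraph : G ≤ hubGraph k G hub := le_sup_left

theorem hubGraph_adj_mem [Finite V] (hk : 5 ≤ k) (hhub : IsHubChoice k G hub)
    (hadj : (hubGraph k G hub).Adj a b) (hG : ¬ G.Adj a b) :
    a ≠ b ∧ ∃ A, IsBig k G A ∧ a ∈ A ∧ b ∈ A ∧ (a = hub A ∨ b = hub A) := by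
  rcases hubGraph_adj.1 hadj with h | ⟨hab, A, hA, ⟨h1, h2⟩ | ⟨h1, h2⟩⟩
  · exact absurd h hG
  · exact ⟨hab, A, hA, h1 ▸ (hA.isHub hk hhub).mem, h2, Or.inl h1⟩
  · exact ⟨hab, A, hA, h2, h1 ▸ (hA.isHub hk hhub).mem, Or.inr h1⟩

/-- The component responsible for the new edge shares a nonadjacent pair with `A`, so it is `A`. -/
theorem hubGraph_adj_of_mem [Finite V] (hk : 5 ≤ k) (hhub : IsHubChoice k G hub)
    (hA : IsComponent G A) (ha : a ∈ A) (hb : b ∈ A) (hadj : (hubGraph k G hub).Adj a b)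
    (hG : ¬ G.Adj a b) : a = hub A ∨ b = hub A := by
  obtain ⟨hab, B, hB, haB, hbB, hor⟩ := hubGraph_adj_mem hk hhub hadj hG
  rwa [hA.eq_of_nonadj hB.isComponent ha haB hb hbB hab hG]

/-! ### The output is chordal -/

theorem linked_of_hubGraph_adj [Finite V] (hk : 5 ≤ k) (hhub : IsHubChoice k G hub) {S : Set V}
    (hS : G.IsClique S) (h2 : S.ncard ≤ 2) (ha : a ∉ S) (hb : b ∉ S)
    (hadj : (hubGraph k G hub).Adj a b) : Linked G Sᶜ a b := by
  by_cases hG : G.Adj a b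
  · exact Linked.of_adj hG
  · obtain ⟨-, A, hA, haA, hbA, -⟩ := hubGraph_adj_mem hk hhub hadj hG
    exact (hA.isComponent.1.linked_diff hS h2 ⟨haA, ha⟩ ⟨hbA, hb⟩).mono fun v hv => hv.2

/-- Ends of a new edge lie in a common component, so an arc of the cycle that misses `S` links its
ends in `G` without `S`. `S` cannot hit the interiors of both arcs: its vertices are adjacent, but
vertices inside different arcs are not, the cycle being induced. -/
theorem insep_of_indCyc [Finite V] (hk : 5 ≤ k) (hhub : IsHubChoice k G hub)
    (hf : IndCyc (hubGraph k G hub) f m) (hb : n < m) : Insep G (f 0) (f n) := by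
  intro S hS h2 h0 hbS
  have harc : ∀ (g : ℕ → V) (n : ℕ), IndCyc (hubGraph k G hub) g m → n < m → g 0 ∉ S → g n ∉ S →
      (∀ i, 0 < i → i < n → g i ∉ S) → Linked G Sᶜ (g 0) (g n) := by
    intro g n hg hn h0 hnS hno
    have : ∀ i, i ≤ n → Linked G Sᶜ (g 0) (g i) := by
      intro i
      induction i with
      | zero => exact fun _ => Linked.refl
      | succ i ih =>
        intro hi
        have hiS : g i ∉ S := by
          rcases Nat.eq_zero_or_pos i with rfl | h
          · exact h0
          · exact hno i h (by omega)
        have hiS' : g (i + 1) ∉ S := by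
          rcases hi.eq_or_lt with rfl | h
          · exact hnS
          · exact hno _ (by omega) h
        exact (ih (by omega)).trans (linked_of_hubGraph_adj hk hhub hS h2 hiS hiS'
          ((hg.adj i (i + 1) (by omega) (by omega)).2 (Or.inl rfl))) hiS
    exact this n le_rfl
  by_cases hno : ∀ i, 0 < i → i < n → f i ∉ S
  · exact harc f n hf hb h0 hbS hno
  · push Not at hno
    obtain ⟨i, hi0, hin, hiS⟩ := hno
    have := harc _ (m - n) hf.reflect (by omega) (by simpa using h0)
      (by simpa [show m - (m - n) = n by omega, Nat.mod_eq_of_lt hb] using hbS) (by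
        intro j hj hjn hjS
        rw [Nat.mod_eq_of_lt (by omega)] at hjS
        have hne := hf.inj i (m - j) (by omega) (by omega)
        have := le_hubGraph (k := k) (hub := hub) (hS hiS hjS hne)
        rw [hf.adj' (by omega) (by omega)] at this
        omega)
    simpa [show m - (m - n) = n by omega, Nat.mod_eq_of_lt hb] using this

/-- An induced cycle of length at least four lies in one component because its vertices are
inseparable. It misses the hub, so all its edges are old ones, contrary to the forest property. -/
theorem IsSC.isChordal_hubGraph [Finite V] (hsc : IsSC k G) (hk : 5 ≤ k)
    (hhub : IsHubChoice k G hub) : IsChordal (hubGraph k G hub) := by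
  rw [isChordal_iff]
  intro m f hf
  by_contra hm
  set Q : Set V := {v | ∃ t, t < m ∧ f t = v} with hQ
  have hins : ∀ x ∈ Q, ∀ y ∈ Q, Insep G x y := by
    rintro x ⟨i, hi, rfl⟩ y ⟨j, hj, rfl⟩
    have hlt : (if i ≤ j then j - i else m + j - i) < m := by split_ifs <;> omega
    have := insep_of_indCyc hk hhub (hf.rotate i hi) hlt
    have hmod : (i + if i ≤ j then j - i else m + j - i) % m = j := by
      split_ifs with hij
      · rw [show i + (j - i) = j by omega, Nat.mod_eq_of_lt hj]
      · rw [show i + (m + j - i) = m + j by omega, Nat.add_mod_left, Nat.mod_eq_of_lt hj]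
    rw [hmod, add_zero, Nat.mod_eq_of_lt hi] at this
    exact this
  obtain ⟨A, hA, hQA⟩ := exists_isComponent_of_insep hsc.1.preconnected
    (Q := Q) ⟨f 0, ⟨0, by omega, rfl⟩⟩ hins
  have hfA : ∀ t, t < m → f t ∈ A := fun t ht => hQA ⟨t, ht, rfl⟩
  have hbig : IsBig k G A := hsc.isBig hk hA (hfA 0 (by omega)) (hfA 2 (by omega))
    (hf.inj 0 2 (by omega) (by omega)) fun hadj => by
      have := le_hubGraph (k := k) (hub := hub) hadj
      rw [hf.adj 0 2 (by omega) (by omega)] at this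
      omega
  -- The hub is adjacent to the whole component, but the vertices at positions 0 and 2 of the
  -- rotated cycle are not adjacent, as its length is at least four.
  have hnohub : ∀ i, i < m → f i ≠ hub A := by
    intro i hi hih
    have hr := hf.rotate i hi
    have h0 : f ((i + 0) % m) = hub A := by rw [add_zero, Nat.mod_eq_of_lt hi, hih]
    have : (hubGraph k G hub).Adj (f ((i + 0) % m)) (f ((i + 2) % m)) :=
      hubGraph_adj.2 (Or.inr ⟨hr.inj 0 2 (by omega) (by omega), A, hbig,
        Or.inl ⟨h0, hfA _ (Nat.mod_lt _ (by omega))⟩⟩)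
    rw [hr.adj 0 2 (by omega) (by omega)] at this
    omega
  have hempty := (hbig.isHub hk hhub).forest Q hQA (by rintro ⟨t, ht, e⟩; exact hnohub t ht e) (by
    rintro z ⟨i, hi, rfl⟩
    have hr := hf.rotate i hi
    have hG : ∀ j, j < m → (hubGraph k G hub).Adj (f i) (f j) → G.Adj (f i) (f j) := by
      intro j hj hadj
      by_contra hG
      exact (hubGraph_adj_of_mem hk hhub hA (hfA i hi) (hfA j hj) hadj hG).elim (hnohub i hi)
        (hnohub j hj)
    have h1 := (hr.adj 0 1 (by omega) (by omega)).2 (Or.inl rfl)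
    have h2 := (hr.adj 0 (m - 1) (by omega) (by omega)).2 (Or.inr ⟨rfl, by omega⟩)
    rw [add_zero, Nat.mod_eq_of_lt hi] at h1 h2
    exact ⟨_, ⟨_, Nat.mod_lt _ (by omega), rfl⟩, _, ⟨_, Nat.mod_lt _ (by omega), rfl⟩,
      hr.inj 1 (m - 1) (by omega) (by omega), hG _ (Nat.mod_lt _ (by omega)) h1,
      hG _ (Nat.mod_lt _ (by omega)) h2⟩)
  have : f 0 ∈ Q := ⟨0, by omega, rfl⟩
  rw [hempty] at this
  exact this

/-! ### Counting -/

/-- The hypothesis, applied to `W` itself, yields a vertex with at most one neighbour; remove it and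
repeat. -/
theorem forest_edges [Finite V] (W : Set V) (hne : W.Nonempty)
    (hW : ∀ Z ⊆ W, (∀ z ∈ Z, ∃ a ∈ Z, ∃ b ∈ Z, a ≠ b ∧ G.Adj z a ∧ G.Adj z b) → Z = ∅) :
    (edgesIn G W).ncard + 1 ≤ W.ncard := by
  induction hn : W.ncard using Nat.strong_induction_on generalizing W with
  | _ n ih =>
  have : ∃ z ∈ W, ∀ a ∈ W, ∀ b ∈ W, G.Adj z a → G.Adj z b → a = b := by
    by_contra hno
    push Not at hno
    refine hne.ne_empty (hW W subset_rfl fun z hz => ?_)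
    obtain ⟨a, ha, b, hb, h1, h2, h3⟩ := hno z hz
    exact ⟨a, ha, b, hb, h3, h1, h2⟩
  obtain ⟨z, hz, hz1⟩ := this
  have hcard : (W \ {z}).ncard = W.ncard - 1 := Set.ncard_sdiff_singleton_of_mem hz
  have hpos : 0 < W.ncard := (Set.ncard_pos W.toFinite).2 hne
  have hsub : ∃ e, edgesIn G W ⊆ insert e (edgesIn G (W \ {z})) := by
    by_cases hex : ∃ a ∈ W, G.Adj z a
    · obtain ⟨a, ha, hza⟩ := hex
      refine ⟨s(z, a), fun e => Sym2.inductionOn e fun b c => ?_⟩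
      rw [mem_edgesIn]
      rintro ⟨hbc, hb, hc⟩
      by_cases hbz : b = z
      · subst hbz; exact Or.inl (by rw [hz1 c hc a ha hbc hza])
      · by_cases hcz : c = z
        · subst hcz; exact Or.inl (by rw [hz1 b hb a ha hbc.symm hza, Sym2.eq_swap])
        · exact Or.inr (mem_edgesIn.2 ⟨hbc, ⟨hb, hbz⟩, hc, hcz⟩)
    · push Not at hex
      refine ⟨s(z, z), fun e => Sym2.inductionOn e fun b c => ?_⟩
      rw [mem_edgesIn]
      rintro ⟨hbc, hb, hc⟩
      refine Or.inr (mem_edgesIn.2 ⟨hbc, ⟨hb, ?_⟩, hc, ?_⟩)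
      · rintro rfl; exact hex c hc hbc
      · rintro rfl; exact hex b hb hbc.symm
  by_cases hWz : (W \ {z}).Nonempty
  · have h1 := ih _ (by omega) (W \ {z}) hWz (fun Z hZ => hW Z (hZ.trans Set.sdiff_subset)) rfl
    obtain ⟨e, he⟩ := hsub
    have h2 := (Set.ncard_le_ncard he (Set.toFinite _)).trans (Set.ncard_insert_le _ _)
    omega
  · have : edgesIn G W = ∅ := by
      refine Set.eq_empty_of_forall_notMem fun e => Sym2.inductionOn e fun b c => ?_
      rw [mem_edgesIn]
      rintro ⟨hbc, hb, hc⟩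
      have hall : ∀ y ∈ W, y = z := fun y hy => by
        by_contra hyz; exact hWz ⟨y, hy, hyz⟩
      exact hbc.ne ((hall b hb).trans (hall c hc).symm)
    rw [this, Set.ncard_empty]; omega

/-- The forest on `A` without `u` has at most `|A| - 2` edges; all other edges are at `u`. -/
theorem IsHub.edges_le [Finite V] (hu : IsHub G A u) (h2 : 2 ≤ A.ncard) :
    (edgesIn G A).ncard + 2 ≤ (G.neighborSet u ∩ A).ncard + A.ncard := by
  have hcard : (A \ {u}).ncard = A.ncard - 1 := Set.ncard_sdiff_singleton_of_mem hu.mem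
  have hne : (A \ {u}).Nonempty := Set.nonempty_of_ncard_ne_zero (by omega)
  have h1 := forest_edges (G := G) (A \ {u}) hne fun Z hZ =>
    hu.forest Z (hZ.trans Set.sdiff_subset) fun h => (hZ h).2 rfl
  have hsub : edgesIn G A ⊆ edgesIn G (A \ {u}) ∪ (fun v => s(u, v)) '' (G.neighborSet u ∩ A) := by
    refine fun e => Sym2.inductionOn e fun b c => ?_
    rw [mem_edgesIn]
    rintro ⟨hbc, hb, hc⟩
    by_cases hbu : b = u
    · subst hbu; exact Or.inr ⟨c, ⟨hbc, hc⟩, rfl⟩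
    · by_cases hcu : c = u
      · subst hcu; exact Or.inr ⟨b, ⟨hbc.symm, hb⟩, Sym2.eq_swap⟩
      · exact Or.inl (mem_edgesIn.2 ⟨hbc, ⟨hb, hbu⟩, hc, hcu⟩)
  have h3 := (Set.ncard_le_ncard hsub (Set.toFinite _)).trans (Set.ncard_union_le _ _)
  have h4 := Set.ncard_image_le (f := fun v => s(u, v)) (G.neighborSet u ∩ A).toFinite
  omega

theorem Linked.mono_graph {D : Set V} (hGH : G ≤ H) (hl : Linked G D x y) : Linked H D x y :=
  let ⟨d, p, hp⟩ := hl
  ⟨d, p, hp.zero, hp.last, fun i hi => hGH (hp.adj i hi), hp.mem⟩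

theorem edgesIn_mono (hGH : G ≤ H) : edgesIn G A ⊆ edgesIn H A :=
  fun _ he => ⟨SimpleGraph.edgeSet_subset_edgeSet.2 hGH he.1, he.2⟩

/-- A chordal supergraph has many additional edges in every prime set with a hub. -/
theorem IsPrimeOn.le_ncard_added [Finite V] (hA : IsPrimeOn G A) (h2 : 2 ≤ A.ncard)
    (hu : IsHub G A u) (hGH : G ≤ H) (hH : IsChordal H) :
    A.ncard ≤ (edgesIn H A \ edgesIn G A).ncard + (G.neighborSet u ∩ A).ncard + 1 := by
  -- Primeness for the empty clique and for single vertices makes `H` connected and free of cut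
  -- vertices on `A`. The bound is `(2|A| - 3) - (deg u + |A| - 2) = |A| - 1 - deg u`.
  have h1 := hH.two_mul_le_edges A h2
    (fun x hx y hy => ((isPrimeOn_iff.1 hA).2.1 x hx y hy).mono_graph hGH)
    (fun v _ x hx y hy => (hA.linked_diff (S := {v}) (by simp) (by simp) hx hy).mono_graph hGH)
  have h3 := hu.edges_le h2
  have h4 := Set.ncard_sdiff_add_ncard_of_subset (edgesIn_mono (A := A) hGH) (Set.toFinite _)
  omega

/-- The new edges inside `A` join the hub to its non-neighbours in `A`; no other component
contributes. This is equality in `IsPrimeOn.le_ncard_added`. -/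
theorem IsBig.ncard_added [Finite V] (hk : 5 ≤ k) (hhub : IsHubChoice k G hub) (hA : IsBig k G A) :
    (edgesIn (hubGraph k G hub) A \ edgesIn G A).ncard + (G.neighborSet (hub A) ∩ A).ncard + 1 =
      A.ncard := by
  have hu := hA.isHub hk hhub
  have heq : edgesIn (hubGraph k G hub) A \ edgesIn G A =
      (fun v => s(hub A, v)) '' ((A \ {hub A}) \ G.neighborSet (hub A)) := by
    ext e
    refine Sym2.inductionOn e fun b c => ?_
    simp only [Set.mem_sdiff, mem_edgesIn, Set.mem_image]
    constructor
    · rintro ⟨⟨hbc, hb, hc⟩, hno⟩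
      have hG : ¬ G.Adj b c := fun hG => hno ⟨hG, hb, hc⟩
      rcases hubGraph_adj_of_mem hk hhub hA.isComponent hb hc hbc hG with rfl | rfl
      · exact ⟨c, ⟨⟨hc, hbc.ne'⟩, hG⟩, rfl⟩
      · exact ⟨b, ⟨⟨hb, hbc.ne⟩, fun h => hG h.symm⟩, Sym2.eq_swap⟩
    · rintro ⟨v, ⟨⟨hv, hvu⟩, hvn⟩, e⟩
      have hadj : (hubGraph k G hub).Adj (hub A) v :=
        hubGraph_adj.2 (Or.inr ⟨fun e => hvu e.symm, A, hA, Or.inl ⟨rfl, hv⟩⟩)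
      have hvn : ¬ G.Adj (hub A) v := hvn
      rcases Sym2.eq_iff.1 e with ⟨rfl, rfl⟩ | ⟨rfl, rfl⟩
      · exact ⟨⟨hadj, hu.mem, hv⟩, fun h => hvn h.1⟩
      · exact ⟨⟨hadj.symm, hv, hu.mem⟩, fun h => hvn h.1.symm⟩
  rw [heq, Set.InjOn.ncard_image (fun v _ w _ e => by
    rcases Sym2.eq_iff.1 e with ⟨-, h⟩ | ⟨h1, h2⟩
    · exact h
    · exact h2.trans h1)]
  have h1 : (A \ {hub A}).ncard = A.ncard - 1 := Set.ncard_sdiff_singleton_of_mem hu.mem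
  have hpos : 0 < A.ncard := (Set.ncard_pos A.toFinite).2 ⟨_, hu.mem⟩
  have h2 := Set.ncard_inter_add_ncard_sdiff_eq_ncard (A \ {hub A}) (G.neighborSet (hub A))
    (Set.toFinite _)
  have h3 : (A \ {hub A}) ∩ G.neighborSet (hub A) = G.neighborSet (hub A) ∩ A := by
    ext v
    simp only [Set.mem_inter_iff, Set.mem_sdiff, Set.mem_singleton_iff, SimpleGraph.mem_neighborSet]
    constructor
    · rintro ⟨⟨h, -⟩, h'⟩; exact ⟨h', h⟩
    · rintro ⟨h', h⟩; exact ⟨⟨h, h'.ne'⟩, h'⟩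
  rw [h3] at h2
  omega

theorem edgesIn_diff : edgesIn H A \ edgesIn G A = {e | e ∈ H.edgeSet \ G.edgeSet ∧ ∀ v ∈ e, v ∈ A} := by
  ext e
  simp only [edgesIn, Set.mem_sdiff, Set.mem_ofPred_eq]
  tauto

/-- The union is disjoint: an added edge joins vertices nonadjacent in `G`, and such a pair lies in
at most one component. -/
theorem ncard_biUnion_added [Finite V] :
    (⋃ A ∈ {A | IsBig k G A}, edgesIn H A \ edgesIn G A).ncard =
      ∑ᶠ A ∈ {A | IsBig k G A}, (edgesIn H A \ edgesIn G A).ncard := by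
  refine Set.Finite.ncard_biUnion (Set.toFinite _) (fun _ _ => Set.toFinite _) ?_
  intro A hA B hB hAB
  refine Set.disjoint_left.2 fun e => ?_
  simp only [edgesIn_diff]
  refine Sym2.inductionOn e fun b c => ?_
  simp only [Set.mem_ofPred_eq, Set.mem_sdiff, SimpleGraph.mem_edgeSet, Sym2.mem_iff, forall_eq_or_imp,
    forall_eq]
  rintro ⟨⟨h1, h2⟩, hb, hc⟩ ⟨-, hb', hc'⟩
  exact hAB (IsComponent.eq_of_nonadj (IsBig.isComponent hA) (IsBig.isComponent hB) hb hb' hc hc'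
    h1.ne h2)

theorem finsum_ncard_le_addedEdges [Finite V] :
    ∑ᶠ A ∈ {A | IsBig k G A}, (edgesIn H A \ edgesIn G A).ncard ≤ addedEdges G H := by
  rw [← ncard_biUnion_added]
  refine Set.ncard_le_ncard (Set.iUnion₂_subset fun A _ => ?_) (Set.toFinite _)
  rw [edgesIn_diff]
  exact fun e he => he.1

theorem addedEdges_hubGraph [Finite V] (hk : 5 ≤ k) (hhub : IsHubChoice k G hub) :
    addedEdges G (hubGraph k G hub) =
      ∑ᶠ A ∈ {A | IsBig k G A}, (edgesIn (hubGraph k G hub) A \ edgesIn G A).ncard := by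
  refine le_antisymm ?_ finsum_ncard_le_addedEdges
  rw [← ncard_biUnion_added]
  refine Set.ncard_le_ncard (fun e => Sym2.inductionOn e fun b c => ?_) (Set.toFinite _)
  rintro ⟨h1, h2⟩
  obtain ⟨-, A, hA, hb, hc, -⟩ := hubGraph_adj_mem hk hhub h1 h2
  refine Set.mem_iUnion₂.2 ⟨A, hA, ?_⟩
  exact ⟨mem_edgesIn.2 ⟨h1, hb, hc⟩, fun h => h2 (mem_edgesIn.1 h).1⟩

theorem IsBig.two_le_ncard [Finite V] (hk : 5 ≤ k) (hA : IsBig k G A)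
    (hhub : IsHubChoice k G hub) : 2 ≤ A.ncard := by
  obtain ⟨x, hx, y, hy, hxy, -⟩ := hA.exists_nonadj hk hhub
  exact (Set.one_lt_ncard_iff A.toFinite).2 ⟨x, y, hx, hy, hxy⟩

/-- The comparison is made component by component; edges that `H` adds elsewhere only increase its
total. -/
theorem addedEdges_hubGraph_le [Finite V] (hk : 5 ≤ k) (hhub : IsHubChoice k G hub) (hGH : G ≤ H)
    (hH : IsChordal H) : addedEdges G (hubGraph k G hub) ≤ addedEdges G H := by
  rw [addedEdges_hubGraph hk hhub]
  refine le_trans ?_ (finsum_ncard_le_addedEdges (k := k))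
  rw [finsum_mem_eq_finite_toFinset_sum _ (Set.toFinite _),
    finsum_mem_eq_finite_toFinset_sum _ (Set.toFinite _)]
  refine Finset.sum_le_sum fun A hA => ?_
  have hA : IsBig k G A := by simpa using hA
  have h1 := hA.ncard_added hk hhub
  have h2 := hA.isComponent.1.le_ncard_added (hA.two_le_ncard hk hhub) (hA.isHub hk hhub) hGH hH
  omega

/-- The contribution `|A| - 1 - deg` is `k - 1 - 2` for a cycle, and `n (k/2 - 1) + 2 - 1 - n` for a
cage with `n` paths. -/
theorem addedEdges_hubGraph_eq [Finite V] (hk : 5 ≤ k) (hhub : IsHubChoice k G hub) :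
    addedEdges G (hubGraph k G hub) = fillInCount k G := by
  rw [addedEdges_hubGraph hk hhub, fillInCount]
  have hcyc : ∀ A, IsCycleComponent k G A → A.ncard = k ∧
      (edgesIn (hubGraph k G hub) A \ edgesIn G A).ncard = k - 3 := by
    intro A hA
    obtain ⟨-, h1, h2⟩ := isHub_of_cycle (by omega) hA.2.some (hhub.1 A hA)
    have := IsBig.ncard_added hk hhub (Or.inl hA)
    exact ⟨h2, by omega⟩
  have hcage : ∀ A n, IsCageComponent k G A n → 3 ≤ n ∧ Even k ∧ A.ncard = n * (k / 2 - 1) + 2 ∧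
      (edgesIn (hubGraph k G hub) A \ edgesIn G A).ncard = n * (k / 2 - 2) + 1 := by
    intro A n hA
    obtain ⟨-, h1, h2, -⟩ := isHub_of_cage hk hA.2.1 hA.2.2.1 hA.2.2.2.some (hhub.2 A n hA)
    have := IsBig.ncard_added hk hhub (Or.inr ⟨n, hA⟩)
    obtain ⟨c, hc⟩ : ∃ c, k / 2 = c + 2 := ⟨k / 2 - 2, by omega⟩
    refine ⟨hA.2.2.1, hA.2.1, h2, ?_⟩
    rw [h1, h2, hc] at this
    rw [hc, Nat.add_sub_cancel]
    rw [show c + 2 - 1 = c + 1 by omega, mul_add] at this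
    omega
  have hset : {A | IsBig k G A} = {A | IsCycleComponent k G A} ∪
      Prod.fst '' {q : Set V × ℕ | IsCageComponent k G q.1 q.2} := by
    ext A
    simp [IsBig]
  -- The number of vertices of a cage determines `n`, so the sum over pairs counts every cage once.
  have hpf : {q : Set V × ℕ | IsCageComponent k G q.1 q.2}.InjOn Prod.fst := by
    rintro ⟨A, n⟩ hA ⟨B, n'⟩ hB (rfl : A = B)
    have h1 := (hcage A n hA).2.2.1
    have h2 := (hcage A n' hB).2.2.1
    have : n * (k / 2 - 1) = n' * (k / 2 - 1) := by omega
    rw [Nat.eq_of_mul_eq_mul_right (by omega) this]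
  -- A cage has at least `3 (k/2 - 1) + 2 > k` vertices and is not a cycle of length `k`.
  have hdis : Disjoint {A | IsCycleComponent k G A}
      (Prod.fst '' {q : Set V × ℕ | IsCageComponent k G q.1 q.2}) := by
    refine Set.disjoint_left.2 ?_
    rintro A hA ⟨⟨B, n⟩, hB, rfl⟩
    have h1 := (hcyc _ hA).1
    obtain ⟨h3, ⟨c, hc⟩, h4, -⟩ := hcage _ n hB
    have : 3 * (k / 2 - 1) ≤ n * (k / 2 - 1) := Nat.mul_le_mul_right _ h3
    simp only at h1 h4
    omega
  rw [hset, finsum_mem_union hdis (Set.toFinite _) (Set.toFinite _), finsum_mem_image hpf]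
  congr 1
  · rw [finsum_mem_congr (s := {A | IsCycleComponent k G A}) rfl fun A hA => (hcyc A hA).2,
      finsum_mem_eq_finite_toFinset_sum _ (Set.toFinite _), Finset.sum_const,
      Set.ncard_eq_toFinset_card _ (Set.toFinite _), smul_eq_mul]
  · exact finsum_mem_congr rfl fun q hq => (hcage q.1 q.2 hq).2.2.2

/-- The outputs of the algorithm are minimum chordal completions. -/
theorem IsSC.fillIn_correct [Finite V] (hsc : IsSC k G) (hk : 5 ≤ k) (hH : IsFillInOutput k G H) :
    G ≤ H ∧ IsChordal H ∧ IsLeast (fillInSizes G) (addedEdges G H) ∧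
      addedEdges G H = fillInCount k G := by
  obtain ⟨hub, hhub, rfl⟩ := isFillInOutput_iff.1 hH
  have hch := hsc.isChordal_hubGraph hk hhub
  refine ⟨le_hubGraph, hch, ⟨⟨_, le_hubGraph, hch, rfl⟩, ?_⟩, addedEdges_hubGraph_eq hk hhub⟩
  rintro m ⟨H', hGH, hH', rfl⟩
  exact addedEdges_hubGraph_le hk hhub hGH hH'

end FillIn

/-! ## A structured language for random access machines -/

/-- Expressions; `row e` is the product of `reg 0` and `e`. -/
inductive Ex where
  | var (x : ℕ)
  | lit (c : ℕ)
  | add (a b : Ex)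
  | sub (a b : Ex)
  | ld (a : Ex)
  | row (a : Ex)

/-- Commands; `loop i p` runs `p` with `i = 0, …, reg 0 - 1`. -/
inductive Cmd where
  | skip
  | assign (x : ℕ) (e : Ex)
  | store (a e : Ex)
  | seq (p q : Cmd)
  | ite (e : Ex) (p q : Cmd)
  | loop (i : ℕ) (p : Cmd)

/-- `F (n - 1) (… (F 0 s))`. -/
def iter {α : Type*} (F : ℕ → α → α) : ℕ → α → α
  | 0, s => s
  | n + 1, s => F n (iter F n s)

/-- The value of an expression. -/
def Ex.val (s : RamState) : Ex → ℕ
  | .var x => s.reg x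
  | .lit c => c
  | .add a b => a.val s + b.val s
  | .sub a b => a.val s - b.val s
  | .ld a => s.mem (a.val s)
  | .row a => s.reg 0 * a.val s

/-- The effect of a command. -/
def Cmd.run : Cmd → RamState → RamState
  | .skip, s => s
  | .assign x e, s => s.setReg x (e.val s)
  | .store a e, s => s.setMem (a.val s) (e.val s)
  | .seq p q, s => q.run (p.run s)
  | .ite e p q, s => if e.val s ≠ 0 then p.run s else q.run s
  | .loop i p, s => iter (fun j a => p.run (a.setReg i j)) (s.reg 0) s

/-- All variables of the expression are smaller than `B`. -/
def Ex.wf (B : ℕ) : Ex → Bool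
  | .var x => decide (x < B)
  | .lit _ => true
  | .add a b => a.wf B && b.wf B
  | .sub a b => a.wf B && b.wf B
  | .ld a => a.wf B
  | .row a => a.wf B

/-- All variables of the command are smaller than `B`, and the variable `0` is not changed. -/
def Cmd.wf (B : ℕ) : Cmd → Bool
  | .skip => true
  | .assign x e => decide (0 < x) && decide (x < B) && e.wf B
  | .store a e => a.wf B && e.wf B
  | .seq p q => p.wf B && q.wf B
  | .ite e p q => e.wf B && p.wf B && q.wf B
  | .loop i p => decide (0 < i) && decide (i < B) && p.wf B

/-- The command may change the variable `x`. -/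
def Cmd.assigns (x : ℕ) : Cmd → Bool
  | .skip => false
  | .assign y _ => decide (x = y)
  | .store _ _ => false
  | .seq p q => p.assigns x || q.assigns x
  | .ite _ p q => p.assigns x || q.assigns x
  | .loop i p => decide (x = i) || p.assigns x

/-- Code that computes an expression in the register `r`, with the help of larger registers. -/
def Ex.compile : Ex → ℕ → RamProg
  | .var x, r => .copy r x
  | .lit c, r => .const r c
  | .add a b, r => .seq (a.compile r) (.seq (b.compile (r + 1)) (.add r r (r + 1)))
  | .sub a b, r => .seq (a.compile r) (.seq (b.compile (r + 1)) (.sub r r (r + 1)))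
  | .ld a, r => .seq (a.compile r) (.load r r)
  | .row a, r => .seq (a.compile r) (.seq (.const (r + 1) 0) (.seq (.copy (r + 2) 0)
      (.seq (.const (r + 3) 1) (.seq (.loop (r + 2) (.seq (.add (r + 1) (r + 1) r)
        (.sub (r + 2) (r + 2) (r + 3)))) (.copy r (r + 1))))))

/-- Code for a command, with the help of the registers from `R` on. -/
def Cmd.compile : Cmd → ℕ → RamProg
  | .skip, R => .const R 0
  | .assign x e, R => .seq (e.compile R) (.copy x R)
  | .store a e, R => .seq (a.compile R) (.seq (e.compile (R + 1)) (.store R (R + 1)))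
  | .seq p q, R => .seq (p.compile R) (q.compile R)
  | .ite e p q, R => .seq (e.compile R) (.ite R (p.compile R) (q.compile R))
  | .loop i p, R => .seq (.copy R 0) (.loop R (.seq (.sub i 0 R) (.seq (p.compile (R + 1))
      (.seq (.const (R + 1) 1) (.sub R R (R + 1))))))

/-- A bound for the time to compute an expression. -/
noncomputable def Ex.time : Ex → Polynomial ℕ
  | .var _ => 1
  | .lit _ => 1
  | .add a b => a.time + b.time + 1
  | .sub a b => a.time + b.time + 1
  | .ld a => a.time + 1
  | .row a => a.time + 3 * Polynomial.X + 5

/-- A bound for the running time of a command. -/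
noncomputable def Cmd.time : Cmd → Polynomial ℕ
  | .skip => 1
  | .assign _ e => e.time + 1
  | .store a e => a.time + e.time + 1
  | .seq p q => p.time + q.time
  | .ite e p q => e.time + p.time + q.time + 1
  | .loop _ p => Polynomial.X * (p.time + 4) + 2

/-! ### Correctness and running time of compiled code -/

section Simulation

variable {s s' σ : RamState} {B r R x : ℕ}

theorem RamState.reg_setReg (s : RamState) (x v y : ℕ) :
    (s.setReg x v).reg y = if y = x then v else s.reg y := by
  simp [RamState.setReg, Function.update_apply]

theorem RamState.mem_setReg (s : RamState) (x v : ℕ) : (s.setReg x v).mem = s.mem := rfl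

theorem RamState.reg_setMem (s : RamState) (x v : ℕ) : (s.setMem x v).reg = s.reg := rfl

theorem RamState.mem_setMem (s : RamState) (x v y : ℕ) :
    (s.setMem x v).mem y = if y = x then v else s.mem y := by
  simp [RamState.setMem, Function.update_apply]

theorem Ex.val_congr (hB : 0 < B) (hreg : ∀ x, x < B → s.reg x = s'.reg x) (hmem : s.mem = s'.mem)
    (e : Ex) (he : e.wf B = true) : e.val s = e.val s' := by
  induction e with
  | var x => exact hreg x (by simpa [Ex.wf] using he)
  | lit c => rfl
  | add a b iha ihb =>
    simp only [Ex.wf, Bool.and_eq_true] at he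
    simp [Ex.val, iha he.1, ihb he.2]
  | sub a b iha ihb =>
    simp only [Ex.wf, Bool.and_eq_true] at he
    simp [Ex.val, iha he.1, ihb he.2]
  | ld a iha => simp [Ex.val, iha he, hmem]
  | row a iha => simp [Ex.val, iha he, hreg 0 hB]

theorem Ex.wf_mono (h : B ≤ R) (e : Ex) (he : e.wf B = true) : e.wf R = true := by
  induction e with
  | var x => simp only [Ex.wf, decide_eq_true_eq] at he ⊢; omega
  | lit c => rfl
  | add a b iha ihb =>
    simp only [Ex.wf, Bool.and_eq_true] at he ⊢; exact ⟨iha he.1, ihb he.2⟩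
  | sub a b iha ihb =>
    simp only [Ex.wf, Bool.and_eq_true] at he ⊢; exact ⟨iha he.1, ihb he.2⟩
  | ld a iha => exact iha he
  | row a iha => exact iha he

/-- Multiplication by repeated addition. Each round takes three steps (addition, decrement, test),
and the last test takes one. -/
theorem runs_mul_loop (m : ℕ) : ∀ s : RamState, s.reg (r + 2) = m → s.reg (r + 3) = 1 →
    ∃ s', Runs (.loop (r + 2) (.seq (.add (r + 1) (r + 1) r) (.sub (r + 2) (r + 2) (r + 3)))) s s'
      (3 * m + 1) ∧ s'.reg (r + 1) = s.reg (r + 1) + m * s.reg r ∧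
      (∀ x, x ≤ r → s'.reg x = s.reg x) ∧ s'.mem = s.mem := by
  induction m with
  | zero =>
    intro s h2 h3
    exact ⟨s, Runs.loopDone h2, by simp, fun _ _ => rfl, rfl⟩
  | succ m ih =>
    intro s h2 h3
    obtain ⟨s', hrun, h1, hreg, hmem⟩ := ih
      ((s.setReg (r + 1) (s.reg (r + 1) + s.reg r)).setReg (r + 2)
        ((s.setReg (r + 1) (s.reg (r + 1) + s.reg r)).reg (r + 2) -
          (s.setReg (r + 1) (s.reg (r + 1) + s.reg r)).reg (r + 3)))
      (by simp [RamState.reg_setReg, h2, h3]) (by simp [RamState.reg_setReg, h3])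
    refine ⟨s', ?_, ?_, fun x hx => ?_, hmem⟩
    · have := Runs.loopStep (by omega) (Runs.seq (Runs.add (r + 1) (r + 1) r s) (Runs.sub _ _ _ _)) hrun
      rw [show 3 * (m + 1) + 1 = 1 + 1 + (3 * m + 1) + 1 by ring]
      exact this
    · rw [h1]
      simp [RamState.reg_setReg]
      ring
    · rw [hreg x hx]
      simp [RamState.reg_setReg, show x ≠ r + 2 by omega, show x ≠ r + 1 by omega]

theorem Ex.runs_compile (e : Ex) : ∀ (r : ℕ) (s : RamState), 0 < r → e.wf r = true →
    ∃ s' t, Runs (e.compile r) s s' t ∧ s'.reg r = e.val s ∧ (∀ x, x < r → s'.reg x = s.reg x) ∧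
      s'.mem = s.mem ∧ t ≤ e.time.eval (s.reg 0) := by
  -- Common to sums and differences: the first operand survives in register `r` because the code of
  -- the second one works from `r + 1` on.
  have hbin : ∀ (a b : Ex) (op : ℕ → ℕ → ℕ) (c : ℕ → RamProg),
      (∀ r (s : RamState), Runs (c r) s (s.setReg r (op (s.reg r) (s.reg (r + 1)))) 1) →
      (∀ (r : ℕ) (s : RamState), 0 < r → a.wf r = true →
        ∃ s' t, Runs (a.compile r) s s' t ∧ s'.reg r = a.val s ∧ (∀ x, x < r → s'.reg x = s.reg x) ∧
          s'.mem = s.mem ∧ t ≤ a.time.eval (s.reg 0)) →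
      (∀ (r : ℕ) (s : RamState), 0 < r → b.wf r = true →
        ∃ s' t, Runs (b.compile r) s s' t ∧ s'.reg r = b.val s ∧ (∀ x, x < r → s'.reg x = s.reg x) ∧
          s'.mem = s.mem ∧ t ≤ b.time.eval (s.reg 0)) →
      ∀ (r : ℕ) (s : RamState), 0 < r → a.wf r = true → b.wf r = true →
      ∃ s' t, Runs (.seq (a.compile r) (.seq (b.compile (r + 1)) (c r))) s s' t ∧
        s'.reg r = op (a.val s) (b.val s) ∧ (∀ x, x < r → s'.reg x = s.reg x) ∧
        s'.mem = s.mem ∧ t ≤ (a.time + b.time + 1).eval (s.reg 0) := by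
    intro a b op c hc iha ihb r s hr ha hb
    obtain ⟨s1, t1, h1, v1, g1, m1, l1⟩ := iha r s hr ha
    obtain ⟨s2, t2, h2, v2, g2, m2, l2⟩ := ihb (r + 1) s1 (by omega) (b.wf_mono (by omega) hb)
    refine ⟨_, _, Runs.seq h1 (Runs.seq h2 (hc r s2)), ?_, fun x hx => ?_, ?_, ?_⟩
    · rw [RamState.reg_setReg, if_pos rfl, v2, g2 r (by omega), v1,
        Ex.val_congr hr g1 m1 b hb]
    · rw [RamState.reg_setReg, if_neg (by omega), g2 x (by omega), g1 x hx]
    · rw [RamState.mem_setReg, m2, m1]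
    · rw [g1 0 hr] at l2
      simp only [Polynomial.eval_add, Polynomial.eval_one]
      omega
  induction e with
  | var y =>
    intro r s hr he
    exact ⟨_, _, Runs.copy r y s, by simp [RamState.reg_setReg, Ex.val],
      fun x hx => by simp [RamState.reg_setReg, hx.ne], rfl, by simp [Ex.time]⟩
  | lit c =>
    intro r s hr he
    exact ⟨_, _, Runs.const r c s, by simp [RamState.reg_setReg, Ex.val],
      fun x hx => by simp [RamState.reg_setReg, hx.ne], rfl, by simp [Ex.time]⟩
  | add a b iha ihb =>
    intro r s hr he
    simp only [Ex.wf, Bool.and_eq_true] at he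
    exact hbin a b (· + ·) (fun r => .add r r (r + 1)) (fun r s => Runs.add _ _ _ _) iha ihb r s hr
      he.1 he.2
  | sub a b iha ihb =>
    intro r s hr he
    simp only [Ex.wf, Bool.and_eq_true] at he
    exact hbin a b (· - ·) (fun r => .sub r r (r + 1)) (fun r s => Runs.sub _ _ _ _) iha ihb r s hr
      he.1 he.2
  | ld a iha =>
    intro r s hr he
    obtain ⟨s1, t1, h1, v1, g1, m1, l1⟩ := iha r s hr he
    refine ⟨_, _, Runs.seq h1 (Runs.load r r s1), ?_, fun x hx => ?_, m1, ?_⟩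
    · simp [RamState.reg_setReg, v1, m1, Ex.val]
    · simp [RamState.reg_setReg, hx.ne, g1 x hx]
    · simp only [Ex.time, Polynomial.eval_add, Polynomial.eval_one]; omega
  | row a iha =>
    intro r s hr he
    obtain ⟨s1, t1, h1, v1, g1, m1, l1⟩ := iha r s hr he
    set s2 := s1.setReg (r + 1) 0 with hs2
    set s3 := s2.setReg (r + 2) (s2.reg 0) with hs3
    set s4 := s3.setReg (r + 3) 1 with hs4
    have hlow : ∀ x, x ≤ r → s4.reg x = s1.reg x := by
      intro x hx
      simp [hs4, hs3, hs2, RamState.reg_setReg, show x ≠ r + 3 by omega, show x ≠ r + 2 by omega,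
        show x ≠ r + 1 by omega]
    obtain ⟨s5, h5, v5, g5, m5⟩ := runs_mul_loop (r := r) (s.reg 0) s4
      (by simp [hs4, hs3, hs2, RamState.reg_setReg, g1 0 hr])
      (by simp [hs4, RamState.reg_setReg])
    refine ⟨_, _, Runs.seq h1 (Runs.seq (Runs.const _ _ _) (Runs.seq (Runs.copy _ _ _)
      (Runs.seq (Runs.const _ _ _) (Runs.seq h5 (Runs.copy _ _ _))))), ?_, fun x hx => ?_, ?_, ?_⟩
    · rw [RamState.reg_setReg, if_pos rfl, v5, hlow r le_rfl, v1]
      simp [hs4, hs3, hs2, RamState.reg_setReg, Ex.val]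
    · rw [RamState.reg_setReg, if_neg (by omega), g5 x hx.le, hlow x hx.le, g1 x hx]
    · rw [RamState.mem_setReg, m5]; exact m1
    · simp only [Ex.time, Polynomial.eval_add, Polynomial.eval_mul, Polynomial.eval_X,
        Polynomial.eval_ofNat]
      omega

theorem iter_induction {α : Type*} {F : ℕ → α → α} {P : ℕ → α → Prop} {a : α} (n : ℕ) (h0 : P 0 a)
    (hstep : ∀ j, j < n → ∀ b, P j b → P (j + 1) (F j b)) : P n (iter F n a) := by
  induction n with
  | zero => exact h0
  | succ n ih => exact hstep n (by omega) _ (ih fun j hj => hstep j (by omega))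

theorem Cmd.run_reg (c : Cmd) (s : RamState) {x : ℕ} (hx : c.assigns x = false) :
    (c.run s).reg x = s.reg x := by
  induction c generalizing s with
  | skip => rfl
  | assign y e =>
    simp only [Cmd.assigns, decide_eq_false_iff_not] at hx
    simp [Cmd.run, RamState.reg_setReg, hx]
  | store a e => rfl
  | seq p q ihp ihq =>
    simp only [Cmd.assigns, Bool.or_eq_false_iff] at hx
    simp [Cmd.run, ihp _ hx.1, ihq _ hx.2]
  | ite e p q ihp ihq =>
    simp only [Cmd.assigns, Bool.or_eq_false_iff] at hx
    simp only [Cmd.run]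
    split_ifs
    · exact ihp _ hx.1
    · exact ihq _ hx.2
  | loop i p ih =>
    simp only [Cmd.assigns, Bool.or_eq_false_iff, decide_eq_false_iff_not] at hx
    refine iter_induction (P := fun _ (a : RamState) => a.reg x = s.reg x) _ rfl fun j _ b hb => ?_
    rw [ih _ hx.2, RamState.reg_setReg, if_neg hx.1, hb]

/-- Register 0 keeps the number `n` throughout, so all loop lengths and factors in `row` are `n`. -/
theorem Cmd.assigns_zero (c : Cmd) (hc : c.wf B = true) : c.assigns 0 = false := by
  induction c with
  | skip => rfl
  | assign y e => simp only [Cmd.wf, Bool.and_eq_true, decide_eq_true_eq] at hc; simp [Cmd.assigns]; omega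
  | store a e => rfl
  | seq p q ihp ihq => simp only [Cmd.wf, Bool.and_eq_true] at hc; simp [Cmd.assigns, ihp hc.1, ihq hc.2]
  | ite e p q ihp ihq =>
    simp only [Cmd.wf, Bool.and_eq_true] at hc; simp [Cmd.assigns, ihp hc.1.2, ihq hc.2]
  | loop i p ih =>
    simp only [Cmd.wf, Bool.and_eq_true, decide_eq_true_eq] at hc
    simp [Cmd.assigns, ih hc.2]; omega

/-- The states agree on the memory and on the registers below `B`. -/
def Agree (B : ℕ) (s σ : RamState) : Prop := (∀ x, x < B → s.reg x = σ.reg x) ∧ s.mem = σ.mem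

/-- The code of a command has the effect of the command, within the time bound. -/
theorem Cmd.runs_compile (hB : 0 < B) (c : Cmd) (hc : c.wf B = true) :
    ∀ (R : ℕ) (s σ : RamState), B ≤ R → Agree B s σ →
    ∃ s' t, Runs (c.compile R) s s' t ∧ Agree B s' (c.run σ) ∧
      (∀ x, B ≤ x → x < R → s'.reg x = s.reg x) ∧ t ≤ c.time.eval (σ.reg 0) := by
  induction c with
  | skip =>
    intro R s σ hR hs
    refine ⟨_, _, Runs.const R 0 s, ⟨fun x hx => ?_, hs.2⟩, fun x hx hxR => ?_, by simp [Cmd.time]⟩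
    · rw [RamState.reg_setReg, if_neg (by omega)]; exact hs.1 x hx
    · rw [RamState.reg_setReg, if_neg (by omega)]
  | assign y e =>
    intro R s σ hR hs
    simp only [Cmd.wf, Bool.and_eq_true, decide_eq_true_eq] at hc
    obtain ⟨s1, t1, h1, v1, g1, m1, l1⟩ := e.runs_compile R s (by omega) (e.wf_mono hR hc.2)
    refine ⟨_, _, Runs.seq h1 (Runs.copy _ _ _), ⟨fun x hx => ?_, m1.trans hs.2⟩,
      fun x hx hxR => ?_, ?_⟩
    · simp only [Cmd.run, RamState.reg_setReg]
      split_ifs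
      · rw [v1, Ex.val_congr hB hs.1 hs.2 e hc.2]
      · rw [g1 x (by omega), hs.1 x hx]
    · rw [RamState.reg_setReg, if_neg (by omega), g1 x hxR]
    · rw [hs.1 0 hB] at l1
      simp only [Cmd.time, Polynomial.eval_add, Polynomial.eval_one]; omega
  | store a e =>
    intro R s σ hR hs
    simp only [Cmd.wf, Bool.and_eq_true] at hc
    obtain ⟨s1, t1, h1, v1, g1, m1, l1⟩ := a.runs_compile R s (by omega) (a.wf_mono hR hc.1)
    obtain ⟨s2, t2, h2, v2, g2, m2, l2⟩ := e.runs_compile (R + 1) s1 (by omega)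
      (e.wf_mono (by omega) hc.2)
    have hv1 : s2.reg R = a.val σ := by
      rw [g2 R (by omega), v1, Ex.val_congr hB hs.1 hs.2 a hc.1]
    have hv2 : s2.reg (R + 1) = e.val σ := by
      rw [v2, ← Ex.val_congr hB hs.1 hs.2 e hc.2]
      exact Ex.val_congr hB (fun x hx => g1 x (by omega)) m1 e hc.2
    refine ⟨_, _, Runs.seq h1 (Runs.seq h2 (Runs.store _ _ _)), ⟨fun x hx => ?_, ?_⟩,
      fun x hx hxR => ?_, ?_⟩
    · simp only [RamState.reg_setMem, Cmd.run]
      rw [g2 x (by omega), g1 x (by omega), hs.1 x hx]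
    · funext y
      simp only [Cmd.run, RamState.mem_setMem, hv1, hv2, m2, m1, hs.2]
    · rw [RamState.reg_setMem, g2 x (by omega), g1 x hxR]
    · rw [g1 0 (by omega), hs.1 0 hB] at l2
      rw [hs.1 0 hB] at l1
      simp only [Cmd.time, Polynomial.eval_add, Polynomial.eval_one]; omega
  | seq p q ihp ihq =>
    intro R s σ hR hs
    simp only [Cmd.wf, Bool.and_eq_true] at hc
    obtain ⟨s1, t1, h1, a1, g1, l1⟩ := ihp hc.1 R s σ hR hs
    obtain ⟨s2, t2, h2, a2, g2, l2⟩ := ihq hc.2 R s1 _ hR a1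
    rw [p.run_reg _ (p.assigns_zero hc.1)] at l2
    refine ⟨_, _, Runs.seq h1 h2, a2, fun x hx hxR => by rw [g2 x hx hxR, g1 x hx hxR], ?_⟩
    simp only [Cmd.time, Polynomial.eval_add]; omega
  | ite e p q ihp ihq =>
    intro R s σ hR hs
    simp only [Cmd.wf, Bool.and_eq_true] at hc
    obtain ⟨s1, t1, h1, v1, g1, m1, l1⟩ := e.runs_compile R s (by omega) (e.wf_mono hR hc.1.1)
    have hs1 : Agree B s1 σ := ⟨fun x hx => (g1 x (by omega)).trans (hs.1 x hx), m1.trans hs.2⟩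
    rw [Ex.val_congr hB hs.1 hs.2 e hc.1.1] at v1
    rw [hs.1 0 hB] at l1
    simp only [Cmd.time, Polynomial.eval_add, Polynomial.eval_one, Cmd.run]
    split_ifs with he
    · obtain ⟨s2, t2, h2, a2, g2, l2⟩ := ihp hc.1.2 R s1 σ hR hs1
      exact ⟨_, _, Runs.seq h1 (Runs.iteTrue (by rwa [v1]) h2), a2,
        fun x hx hxR => by rw [g2 x hx hxR, g1 x hxR], by omega⟩
    · obtain ⟨s2, t2, h2, a2, g2, l2⟩ := ihq hc.2 R s1 σ hR hs1
      exact ⟨_, _, Runs.seq h1 (Runs.iteFalse (by rw [v1]; exact not_not.1 he) h2), a2,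
        fun x hx hxR => by rw [g2 x hx hxR, g1 x hxR], by omega⟩
  | loop i p ih =>
    intro R s σ hR hs
    have hc0 := hc
    simp only [Cmd.wf, Bool.and_eq_true, decide_eq_true_eq] at hc
    set F : ℕ → RamState → RamState := fun j a => p.run (a.setReg i j) with hF
    set n := σ.reg 0 with hn
    have hF0 : ∀ m, (iter F m σ).reg 0 = n := fun m =>
      iter_induction (P := fun _ (a : RamState) => a.reg 0 = n) m rfl fun j _ b hb => by
        rw [p.run_reg _ (p.assigns_zero hc.2), RamState.reg_setReg, if_neg (by omega), hb]
    -- Register `R` counts down: it holds the number `m` of rounds left, so `n - m` rounds are done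
    -- and the current index is `reg 0 - R`.
    have key : ∀ m, m ≤ n → ∀ s : RamState, s.reg R = m → Agree B s (iter F (n - m) σ) →
        ∃ s' t, Runs (.loop R (.seq (.sub i 0 R) (.seq (p.compile (R + 1))
          (.seq (.const (R + 1) 1) (.sub R R (R + 1)))))) s s' t ∧ Agree B s' (iter F n σ) ∧
          (∀ x, B ≤ x → x < R → s'.reg x = s.reg x) ∧ t ≤ m * (p.time.eval n + 4) + 1 := by
      intro m
      induction m with
      | zero =>
        intro _ s hsR hag
        exact ⟨s, _, Runs.loopDone hsR, hag, fun _ _ _ => rfl, by simp⟩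
      | succ m ihm =>
        intro hm s hsR hag
        have hag1 : Agree B (s.setReg i (s.reg 0 - s.reg R))
            ((iter F (n - (m + 1)) σ).setReg i (n - (m + 1))) := by
          refine ⟨fun x hx => ?_, hag.2⟩
          simp only [RamState.reg_setReg]
          split_ifs
          · rw [hag.1 0 hB, hF0, hsR]
          · exact hag.1 x hx
        obtain ⟨s1, t1, h1, a1, g1, l1⟩ := ih hc.2 (R + 1) _ _ (by omega) hag1
        have hs1R : s1.reg R = m + 1 := by
          rw [g1 R hR (by omega), RamState.reg_setReg, if_neg (by omega), hsR]
        set s2 := s1.setReg (R + 1) 1 with hs2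
        set s3 := s2.setReg R (s2.reg R - s2.reg (R + 1)) with hs3
        have hs3R : s3.reg R = m := by simp [hs3, hs2, RamState.reg_setReg, hs1R]
        have hit : p.run ((iter F (n - (m + 1)) σ).setReg i (n - (m + 1))) = iter F (n - m) σ := by
          rw [show n - m = n - (m + 1) + 1 by omega]; rfl
        rw [hit] at a1
        have hag3 : Agree B s3 (iter F (n - m) σ) := by
          refine ⟨fun x hx => ?_, a1.2⟩
          rw [← a1.1 x hx]
          simp [hs3, hs2, RamState.reg_setReg, show x ≠ R by omega, show x ≠ R + 1 by omega]
        obtain ⟨s4, t4, h4, a4, g4, l4⟩ := ihm (by omega) s3 hs3R hag3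
        refine ⟨s4, _, Runs.loopStep (by omega) (Runs.seq (Runs.sub _ _ _ _) (Runs.seq h1
          (Runs.seq (Runs.const _ _ _) (Runs.sub _ _ _ _)))) h4, a4, fun x hx hxR => ?_, ?_⟩
        · rw [g4 x hx hxR]
          simp only [hs3, hs2, RamState.reg_setReg, show x ≠ R by omega, show x ≠ R + 1 by omega, if_false]
          rw [g1 x hx (by omega), RamState.reg_setReg, if_neg (by omega)]
        -- Besides the body, a round costs four steps: the index, the constant one, the decrement
        -- and the test.
        · rw [RamState.reg_setReg, if_neg (by omega), hF0] at l1
          rw [add_mul]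
          omega
    have hag0 : Agree B (s.setReg R (s.reg 0)) σ := by
      refine ⟨fun x hx => ?_, hs.2⟩
      rw [RamState.reg_setReg, if_neg (by omega), hs.1 x hx]
    obtain ⟨s1, t1, h1, a1, g1, l1⟩ := key n le_rfl (s.setReg R (s.reg 0))
      (by rw [RamState.reg_setReg, if_pos rfl, hs.1 0 hB]) (by rw [Nat.sub_self]; exact hag0)
    refine ⟨s1, _, Runs.seq (Runs.copy _ _ _) h1, a1, fun x hx hxR => ?_, ?_⟩
    · rw [g1 x hx hxR, RamState.reg_setReg, if_neg (by omega)]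
    · simp only [Cmd.time, Polynomial.eval_add, Polynomial.eval_mul, Polynomial.eval_X,
        Polynomial.eval_ofNat]
      omega

/-- Invariants of loops; the variables that the loop does not change may be used freely. -/
theorem Cmd.run_loop {i : ℕ} {p : Cmd} (s : RamState) {P : ℕ → RamState → Prop} (h0 : P 0 s)
    (hstep : ∀ j, j < s.reg 0 → ∀ a, P j a →
      (∀ y, (Cmd.loop i p).assigns y = false → a.reg y = s.reg y) →
      P (j + 1) (p.run (a.setReg i j))) : P (s.reg 0) ((Cmd.loop i p).run s) := by
  refine (iter_induction (P := fun j a => P j a ∧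
    ∀ y, (Cmd.loop i p).assigns y = false → a.reg y = s.reg y) (s.reg 0)
    ⟨h0, fun _ _ => rfl⟩ fun j hj a ha => ⟨hstep j hj a ha.1 ha.2, fun y hy => ?_⟩).1
  have hy' := hy
  simp only [Cmd.assigns, Bool.or_eq_false_iff, decide_eq_false_iff_not] at hy'
  rw [p.run_reg _ hy'.2, RamState.reg_setReg, if_neg hy'.1, ha.2 y hy]

/-- Invariants of two nested loops. -/
theorem Cmd.run_loop₂ {i j n : ℕ} {p : Cmd} (s : RamState) {P : ℕ → ℕ → RamState → Prop}
    (hn : s.reg 0 = n) (h0' : (Cmd.loop i (Cmd.loop j p)).assigns 0 = false)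
    (hi : (Cmd.loop j p).assigns i = false) (h0 : P 0 0 s)
    (hset : ∀ u a, P u 0 a → P u 0 (a.setReg i u)) (hrow : ∀ u a, P u n a → P (u + 1) 0 a)
    (hstep : ∀ u, u < n → ∀ v, v < n → ∀ a, P u v a → a.reg i = u →
      (∀ y, (Cmd.loop i (Cmd.loop j p)).assigns y = false → a.reg y = s.reg y) →
      P u (v + 1) (p.run (a.setReg j v))) : P n 0 ((Cmd.loop i (Cmd.loop j p)).run s) := by
  subst hn
  refine Cmd.run_loop (P := fun u => P u 0) s h0 fun u hu a ha hreg => hrow u _ ?_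
  have hy : ∀ y, (Cmd.loop i (Cmd.loop j p)).assigns y = false →
      (a.setReg i u).reg y = s.reg y := fun y hy => by
    rw [RamState.reg_setReg, if_neg, hreg y hy]
    simp only [Cmd.assigns, Bool.or_eq_false_iff, decide_eq_false_iff_not] at hy
    exact hy.1
  have := Cmd.run_loop (i := j) (p := p) (a.setReg i u) (P := P u) (hset u a ha)
    fun v hv b hb hbreg => hstep u hu v (by rwa [hy 0 h0'] at hv) b hb
      (by rw [hbreg i hi, RamState.reg_setReg, if_pos rfl])
      fun y hy' => by
        rw [hbreg y, hy y hy']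
        rw [Cmd.assigns, Bool.or_eq_false_iff] at hy'
        exact hy'.2
  rwa [hy 0 h0'] at this

end Simulation

/-! ## The program -/

/-- The position of the pair of the variables `u`, `v` in a matrix. -/
def posEx (u v : ℕ) : Ex := .add (.row (.var u)) (.var v)

/-- The size of a matrix. -/
def sizeEx : Ex := .row (.var 0)

/-- The entry of the adjacency matrix. -/
def adjEx (u v : ℕ) : Ex := .ld (posEx u v)

/-- The address of the entry of the inseparability matrix. -/
def insepAddr (u v : ℕ) : Ex := .add sizeEx (posEx u v)

/-- The entry of the inseparability matrix. -/
def insepEx (u v : ℕ) : Ex := .ld (insepAddr u v)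

/-- The address of the entry of the matrix of added edges. -/
def addedAddr (u v : ℕ) : Ex := .add (.add sizeEx sizeEx) (posEx u v)

/-- The address of the mark of a vertex. -/
def markAddr (u : ℕ) : Ex := .add (.add sizeEx (.add sizeEx sizeEx)) (.var u)

/-- Nonzero if the variables differ. -/
def neEx (u v : ℕ) : Ex := .add (.sub (.var u) (.var v)) (.sub (.var v) (.var u))

/-- Run `p` if `e` is nonzero. -/
def Cmd.when (e : Ex) (p : Cmd) : Cmd := .ite e p .skip

/-- Mark the neighbours (except for the variables `3`, `4`) of all marked vertices. -/
def markStep : Cmd :=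
  .loop 7 (.loop 8 (.when (.ld (markAddr 7)) (.when (adjEx 7 8) (.when (neEx 8 3)
    (.when (neEx 8 4) (.store (markAddr 8) (.lit 1)))))))

/-- Mark the vertices that are linked to the variable `1` without the variables `3`, `4`. -/
def markLinked : Cmd :=
  .seq (.loop 8 (.store (markAddr 8) (.lit 0)))
    (.seq (.store (markAddr 1) (.lit 1)) (.loop 6 markStep))

/-- Clear the variable `5` if the clique `3`, `4` separates `1` and `2`. -/
def testClique : Cmd :=
  .when (.add (.sub (.lit 1) (neEx 3 4)) (adjEx 3 4)) (.when (neEx 1 3) (.when (neEx 1 4)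
    (.when (neEx 2 3) (.when (neEx 2 4)
      (.seq markLinked (.ite (.ld (markAddr 2)) .skip (.assign 5 (.lit 0))))))))

/-- Compute one entry of the inseparability matrix. -/
def insepEntry : Cmd :=
  .seq (.assign 5 (.lit 1)) (.seq (.loop 3 (.loop 4 testClique)) (.store (insepAddr 1 2) (.var 5)))

/-- Compute the inseparability matrix. -/
def insepMatrix : Cmd := .loop 1 (.loop 2 insepEntry)

/-! ### Computing the inseparability matrix -/

section Separation

variable {n : ℕ} {G : SimpleGraph (Fin n)} {s : RamState}

theorem Cmd.run_when (e : Ex) (p : Cmd) (s : RamState) :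
    (Cmd.when e p).run s = if e.val s ≠ 0 then p.run s else s := rfl

theorem neEx_val {u v : ℕ} : (neEx u v).val s ≠ 0 ↔ s.reg u ≠ s.reg v := by
  simp only [neEx, Ex.val]; omega

/-- Keeps the memory blocks apart: adjacency from `0`, inseparability from `n²`, added edges from
`2n²`, marks from `3n²`. -/
theorem pos_lt {u v : ℕ} (hu : u < n) (hv : v < n) : n * u + v < n * n := by
  calc n * u + v < n * u + n := by omega
    _ = n * (u + 1) := by ring
    _ ≤ n * n := Nat.mul_le_mul_left _ hu

theorem pos_inj {u v u' v' : ℕ} (hv : v < n) (hv' : v' < n) (h : n * u + v = n * u' + v') :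
    u = u' ∧ v = v' := by
  have h1 : (n * u + v) / n = u := by
    rw [Nat.mul_add_div (by omega), Nat.div_eq_of_lt hv, add_zero]
  have h2 : (n * u' + v') / n = u' := by
    rw [Nat.mul_add_div (by omega), Nat.div_eq_of_lt hv', add_zero]
  have : u = u' := by rw [← h1, ← h2, h]
  subst this
  exact ⟨rfl, by omega⟩

/-- The cells `0, …, n² - 1` are nonzero at the edges of `G`. -/
def StoresAdj (G : SimpleGraph (Fin n)) (s : RamState) : Prop :=
  ∀ u v : Fin n, s.mem (n * u + v) ≠ 0 ↔ G.Adj u v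

/-- The vertex is marked. -/
def Marked (n : ℕ) (s : RamState) (z : ℕ) : Prop := s.mem (n * n + (n * n + n * n) + z) ≠ 0

/-- The states have the same memory up to the marks. -/
def SameLow (n : ℕ) (s s' : RamState) : Prop :=
  ∀ c, c < n * n + (n * n + n * n) → s'.mem c = s.mem c

theorem StoresAdj.congr {s' : RamState} (h : StoresAdj G s)
    (hs : ∀ c, c < n * n → s'.mem c = s.mem c) : StoresAdj G s' :=
  fun u v => by rw [hs _ (pos_lt u.2 v.2)]; exact h u v

theorem SameLow.storesAdj {s' : RamState} (h : SameLow n s s') (hG : StoresAdj G s) :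
    StoresAdj G s' := hG.congr fun c hc => h c (by omega)

/-- A sweep may spread marks over several edges, depending on the order of the vertices. So marks
are bounded above by any property `ok` closed under admissible edges, and below by one step from the
marks at the start. -/
theorem run_markStep (hn : s.reg 0 = n) {a b : Fin n} (h3 : s.reg 3 = a) (h4 : s.reg 4 = b)
    (hG : StoresAdj G s) {ok : Fin n → Prop}
    (hok : ∀ p q, ok p → G.Adj p q → q ≠ a → q ≠ b → ok q) (hs : ∀ z : Fin n, Marked n s z → ok z) :
    SameLow n s (markStep.run s) ∧ (∀ z : Fin n, Marked n (markStep.run s) z → ok z) ∧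
    (∀ z : Fin n, Marked n s z → Marked n (markStep.run s) z) ∧
    ∀ p q : Fin n, Marked n s p → G.Adj p q → q ≠ a → q ≠ b → Marked n (markStep.run s) q := by
  have := Cmd.run_loop₂ (i := 7) (j := 8) (n := n) (P := fun u v t => SameLow n s t ∧
    (∀ z : Fin n, Marked n t z → ok z) ∧ (∀ z : Fin n, Marked n s z → Marked n t z) ∧
    ∀ p q : Fin n, (p < u ∨ ((p : ℕ) = u ∧ q < v)) → Marked n s p → G.Adj p q → q ≠ a → q ≠ b →
      Marked n t q) s hn rfl rfl ⟨fun _ _ => rfl, hs, fun _ h => h, fun p q h => by omega⟩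
    (fun _ _ h => h) (fun u t h => ⟨h.1, h.2.1, h.2.2.1, fun p q hpq => h.2.2.2 p q (by omega)⟩)
    (p := .when (.ld (markAddr 7)) (.when (adjEx 7 8) (.when (neEx 8 3)
    (.when (neEx 8 4) (.store (markAddr 8) (.lit 1)))))) ?_
  · exact ⟨this.1, this.2.1, this.2.2.1, fun p q => this.2.2.2 p q (Or.inl p.2)⟩
  · rintro u hu v hv t ⟨i1, i2, i3, i4⟩ h7 hreg
    have t0 : t.reg 0 = n := (hreg 0 rfl).trans hn
    have t3 : t.reg 3 = a := (hreg 3 rfl).trans h3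
    have t4 : t.reg 4 = b := (hreg 4 rfl).trans h4
    have hA : t.mem (n * u + v) ≠ 0 ↔ G.Adj ⟨u, hu⟩ ⟨v, hv⟩ := i1.storesAdj hG ⟨u, hu⟩ ⟨v, hv⟩
    simp only [Cmd.run_when, neEx_val, Ex.val, adjEx, posEx, markAddr, sizeEx, RamState.reg_setReg,
      RamState.mem_setReg, t0, t3, t4, h7, Cmd.run, if_true, Nat.reduceEqDiff,
      OfNat.zero_ne_ofNat, if_false]
    by_cases hc : Marked n t u ∧ G.Adj ⟨u, hu⟩ ⟨v, hv⟩ ∧ v ≠ a ∧ v ≠ b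
    · obtain ⟨c1, c2, c3, c4⟩ := hc
      have c1' : t.mem (n * n + (n * n + n * n) + u) ≠ 0 := c1
      rw [if_pos c1', if_pos (hA.2 c2), if_pos c3, if_pos c4]
      have hmark : ∀ z, Marked n ((t.setReg 8 v).setMem (n * n + (n * n + n * n) + v) 1) z ↔
          z = v ∨ Marked n t z := by
        intro z
        simp only [Marked, RamState.mem_setMem, RamState.mem_setReg]
        split_ifs with h
        · simp; left; omega
        · have : z ≠ v := fun e => h (by rw [e])
          simp [this]
      refine ⟨fun c hc => ?_, fun z hz => ?_, fun z hz => (hmark z).2 (Or.inr (i3 z hz)),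
        fun p q hpq hp hadj hqa hqb => (hmark q).2 ?_⟩
      · rw [RamState.mem_setMem, if_neg (by omega)]; exact i1 c hc
      · rcases (hmark z).1 hz with h | h
        · have : z = ⟨v, hv⟩ := Fin.ext h
          rw [this]
          exact hok _ _ (i2 ⟨u, hu⟩ c1) c2 (fun e => c3 (congrArg Fin.val e))
            (fun e => c4 (congrArg Fin.val e))
        · exact i2 z h
      · by_cases hqv : (q : ℕ) = v
        · exact Or.inl hqv
        · exact Or.inr (i4 p q (by omega) hp hadj hqa hqb)
    · have hsame : (if t.mem (n * n + (n * n + n * n) + u) ≠ 0 then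
          (if t.mem (n * u + v) ≠ 0 then (if v ≠ ↑a then (if v ≠ ↑b then
          (t.setReg 8 v).setMem (n * n + (n * n + n * n) + v) 1 else t.setReg 8 v)
          else t.setReg 8 v) else t.setReg 8 v) else t.setReg 8 v) = t.setReg 8 v := by
        split_ifs with c1 c2 c3 c4
        · exact absurd ⟨c1, hA.1 c2, c3, c4⟩ hc
        all_goals rfl
      rw [hsame]
      refine ⟨i1, i2, i3, fun p q hpq hp hadj hqa hqb => ?_⟩
      by_cases hpv : (p : ℕ) = u ∧ (q : ℕ) = v
      · exfalso
        have hp' : p = ⟨u, hu⟩ := Fin.ext hpv.1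
        have hq' : q = ⟨v, hv⟩ := Fin.ext hpv.2
        subst hp' hq'
        exact hc ⟨i3 _ hp, hadj, fun e => hqa (Fin.ext e), fun e => hqb (Fin.ext e)⟩
      · exact i4 p q (by omega) hp hadj hqa hqb

/-- After `j` sweeps every vertex reached by an admissible walk of length at most `j` is marked, and
marks never go beyond the linked vertices. -/
theorem run_markLinked (hn : s.reg 0 = n) {x a b : Fin n} (h1 : s.reg 1 = x) (h3 : s.reg 3 = a)
    (h4 : s.reg 4 = b) (hG : StoresAdj G s) (hxa : x ≠ a) (hxb : x ≠ b) :
    SameLow n s (markLinked.run s) ∧ ∀ z : Fin n, Marked n (markLinked.run s) z ↔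
      (z ≠ a ∧ z ≠ b) ∧ Linked G {a, b}ᶜ x z := by
  set s1 := (Cmd.loop 8 (.store (markAddr 8) (.lit 0))).run s with hs1
  have r1 : ∀ y, y ≠ 8 → s1.reg y = s.reg y := fun y hy => Cmd.run_reg _ _ (by simp [Cmd.assigns, hy])
  have hclear : SameLow n s s1 ∧ ∀ z, z < n → ¬ Marked n s1 z := by
    have := Cmd.run_loop (i := 8) (p := .store (markAddr 8) (.lit 0)) s
      (P := fun j t => SameLow n s t ∧ ∀ z, z < j → ¬ Marked n t z) ⟨fun _ _ => rfl, by simp⟩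
      (fun j hj t ⟨i1, i2⟩ hreg => by
        have t0 : t.reg 0 = n := (hreg 0 rfl).trans hn
        simp only [Cmd.run, Ex.val, markAddr, sizeEx, RamState.reg_setReg, t0, if_true,
          OfNat.zero_ne_ofNat, if_false]
        refine ⟨fun c hc => ?_, fun z hz => ?_⟩
        · rw [RamState.mem_setMem, if_neg (by omega)]; exact i1 c hc
        · simp only [Marked, RamState.mem_setMem, RamState.mem_setReg]
          split_ifs with h
          · simp
          · exact i2 z (by omega))
    rw [hn] at this
    exact this
  set s2 := (Cmd.store (markAddr 1) (.lit 1)).run s1 with hs2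
  have hs2' : s2 = s1.setMem (n * n + (n * n + n * n) + x) 1 := by
    simp [hs2, Cmd.run, Ex.val, markAddr, sizeEx, r1, h1, hn]
  have r2 : ∀ y, y ≠ 8 → s2.reg y = s.reg y := fun y hy => r1 y hy
  have m2 : SameLow n s s2 := fun c hc => by
    rw [hs2', RamState.mem_setMem, if_neg (by omega)]; exact hclear.1 c hc
  have k2 : ∀ z : Fin n, Marked n s2 z ↔ z = x := by
    intro z
    rw [hs2']
    simp only [Marked, RamState.mem_setMem]
    split_ifs with h
    · simp; exact Fin.ext (by omega)
    · refine ⟨fun hz => absurd hz (hclear.2 z z.2), fun e => absurd (by rw [e]) h⟩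
  set ok : Fin n → Prop := fun z => (z ≠ a ∧ z ≠ b) ∧ Linked G {a, b}ᶜ x z with hokdef
  have hmem : ∀ z, z ∈ ({a, b} : Set (Fin n))ᶜ ↔ z ≠ a ∧ z ≠ b := by simp
  have hok : ∀ p q, ok p → G.Adj p q → q ≠ a → q ≠ b → ok q := fun p q hp hadj hqa hqb =>
    ⟨⟨hqa, hqb⟩, hp.2.trans (Linked.of_adj hadj) ((hmem p).2 hp.1)⟩
  have := Cmd.run_loop (i := 6) (p := markStep) s2
    (P := fun j t => SameLow n s t ∧ (∀ z : Fin n, Marked n t z → ok z) ∧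
      ∀ z d p, d ≤ j → WalkIn G {a, b}ᶜ x z d p → z ≠ a → z ≠ b → Marked n t z)
    ⟨m2, fun z hz => by rw [(k2 z).1 hz]; exact ⟨⟨hxa, hxb⟩, Linked.refl⟩, fun z d p hd hp _ _ => by
      obtain rfl : d = 0 := by omega
      exact (k2 z).2 (hp.last.symm.trans hp.zero)⟩
    (fun j hj t ⟨i1, i2, i3⟩ hreg => by
      have tr : ∀ y, (Cmd.loop 6 markStep).assigns y = false → y ≠ 8 → y ≠ 6 →
          (t.setReg 6 j).reg y = s.reg y := fun y hy hy8 hy6 => by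
        rw [RamState.reg_setReg, if_neg hy6, hreg y hy, r2 y hy8]
      obtain ⟨o1, o2, o3, o4⟩ := run_markStep (s := t.setReg 6 j) (G := G) (a := a) (b := b)
        ((tr 0 rfl (by omega) (by omega)).trans hn) ((tr 3 rfl (by omega) (by omega)).trans h3)
        ((tr 4 rfl (by omega) (by omega)).trans h4) (SameLow.storesAdj (s := s) i1 hG) hok i2
      refine ⟨fun c hc => (o1 c hc).trans (i1 c hc), o2, fun z d p hd hp hza hzb => ?_⟩
      by_cases hdj : d ≤ j
      · exact o3 z (i3 z d p hdj hp hza hzb)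
      · obtain rfl : d = j + 1 := by omega
        have hpj : p j ≠ a ∧ p j ≠ b := by
          rcases Nat.eq_zero_or_pos j with rfl | hj0
          · rw [hp.zero]; exact ⟨hxa, hxb⟩
          · exact (hmem _).1 (hp.mem j hj0 (by omega))
        have := hp.adj j (by omega)
        rw [hp.last] at this
        exact o4 _ z (i3 _ j p le_rfl (hp.take (by omega)) hpj.1 hpj.2) this hza hzb)
  rw [r2 0 (by omega), hn] at this
  refine ⟨this.1, fun z => ⟨this.2.1 z, fun hz => ?_⟩⟩
  obtain ⟨d, p, hp, hip, -⟩ := hz.2.exists_shortest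
  -- The vertices of a shortest walk are distinct, so its length is less than `n` and `n` sweeps
  -- suffice.
  have hd : d + 1 ≤ n := by
    have hinj : Function.Injective fun i : Fin (d + 1) => p i := fun i j e =>
      Fin.ext (hip.inj' (by omega) (by omega) e)
    simpa using Fintype.card_le_of_injective _ hinj
  exact this.2.2 z d p (by omega) hp hz.1.1 hz.1.2

/-- The clique `a`, `b` does not separate `x` and `y`. -/
def PassesTest (G : SimpleGraph (Fin n)) (x y a b : Fin n) : Prop :=
  (a = b ∨ G.Adj a b) → x ≠ a → x ≠ b → y ≠ a → y ≠ b → Linked G {a, b}ᶜ x y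

/-- A nonempty clique with at most two vertices is `{a, b}` with `a = b` or `a` adjacent to `b`; the
empty one separates nothing as `G` is connected. -/
theorem insep_iff_passesTest (hG : G.Preconnected) {x y : Fin n} :
    Insep G x y ↔ ∀ a b, PassesTest G x y a b := by
  constructor
  · intro h a b hab hxa hxb hya hyb
    refine h {a, b} ?_ ?_ (by simp [hxa, hxb]) (by simp [hya, hyb])
    · rcases hab with rfl | hab
      · simp
      · simp [hab]
    · exact (Set.ncard_insert_le _ _).trans (by simp)
  · intro h S hS h2 hx hy
    have hcases : S = ∅ ∨ ∃ a b, S = {a, b} ∧ (a = b ∨ G.Adj a b) := by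
      have : S.ncard = 0 ∨ S.ncard = 1 ∨ S.ncard = 2 := by omega
      rcases this with h | h | h
      · exact Or.inl ((Set.ncard_eq_zero S.toFinite).1 h)
      · obtain ⟨a, rfl⟩ := Set.ncard_eq_one.1 h
        exact Or.inr ⟨a, a, by simp, Or.inl rfl⟩
      · obtain ⟨a, b, hab, rfl⟩ := Set.ncard_eq_two.1 h
        exact Or.inr ⟨a, b, rfl, Or.inr (hS (by simp) (by simp) hab)⟩
    rcases hcases with rfl | ⟨a, b, rfl, hab⟩
    · have hc : (G.induce (Set.univ : Set (Fin n))).Preconnected :=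
        hG.map (f := (SimpleGraph.induceUnivIso G).symm.toHom)
          (SimpleGraph.induceUnivIso G).symm.surjective
      simpa using preconnected_induce_iff.1 hc x trivial y trivial
    · simp only [Set.mem_insert_iff, Set.mem_singleton_iff, not_or] at hx hy
      exact h a b hab hx.1 hx.2 hy.1 hy.2

theorem run_testClique (hn : s.reg 0 = n) {x y a b : Fin n} (h1 : s.reg 1 = x) (h2 : s.reg 2 = y)
    (h3 : s.reg 3 = a) (h4 : s.reg 4 = b) (hG : StoresAdj G s) :
    SameLow n s (testClique.run s) ∧
      ((testClique.run s).reg 5 ≠ 0 ↔ s.reg 5 ≠ 0 ∧ PassesTest G x y a b) := by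
  have hA := hG a b
  have hc : (Ex.add (.sub (.lit 1) (neEx 3 4)) (adjEx 3 4)).val s ≠ 0 ↔ a = b ∨ G.Adj a b := by
    rw [← hA, Fin.ext_iff, ← h3, ← h4]
    have : (neEx 3 4).val s = 0 ↔ s.reg 3 = s.reg 4 := by
      have := neEx_val (s := s) (u := 3) (v := 4); omega
    simp only [adjEx, posEx, Ex.val] at this ⊢
    rw [hn, h3, h4] at *
    omega
  have hne : ∀ u v : Fin n, ((u : ℕ) ≠ v ↔ u ≠ v) := fun u v => by rw [Ne, Ne, Fin.ext_iff]
  by_cases hall : (a = b ∨ G.Adj a b) ∧ x ≠ a ∧ x ≠ b ∧ y ≠ a ∧ y ≠ b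
  · obtain ⟨c1, c2, c3, c4, c5⟩ := hall
    obtain ⟨o1, o2⟩ := run_markLinked hn h1 h3 h4 hG c2 c3
    have hrun : testClique.run s =
        if (markLinked.run s).mem (n * n + (n * n + n * n) + y) ≠ 0 then markLinked.run s else
        (markLinked.run s).setReg 5 0 := by
      have e0 : (markLinked.run s).reg 0 = n := (Cmd.run_reg _ _ rfl).trans hn
      have e2 : (markLinked.run s).reg 2 = y := (Cmd.run_reg _ _ rfl).trans h2
      simp only [testClique, Cmd.run_when, neEx_val, h1, h2, h3, h4]
      rw [if_pos (hc.2 c1), if_pos ((hne _ _).2 c2), if_pos ((hne _ _).2 c3), if_pos ((hne _ _).2 c4),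
        if_pos ((hne _ _).2 c5)]
      simp only [Cmd.run, Ex.val, markAddr, sizeEx, e0, e2]
    have e5 : (markLinked.run s).reg 5 = s.reg 5 := Cmd.run_reg _ _ rfl
    have hP : PassesTest G x y a b ↔ Marked n (markLinked.run s) y := by
      rw [o2 y]
      exact ⟨fun h => ⟨⟨c4, c5⟩, h c1 c2 c3 c4 c5⟩, fun h _ _ _ _ _ => h.2⟩
    rw [hrun, hP]
    split_ifs with hm
    · exact ⟨o1, by rw [e5, Marked]; simp [hm]⟩
    · exact ⟨o1, by simp [Marked, RamState.reg_setReg, hm]⟩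
  · have hrun : testClique.run s = s := by
      simp only [testClique, Cmd.run_when, neEx_val, h1, h2, h3, h4]
      split_ifs with c1 c2 c3 c4 c5
      · exact absurd ⟨hc.1 c1, (hne _ _).1 c2, (hne _ _).1 c3, (hne _ _).1 c4, (hne _ _).1 c5⟩ hall
      all_goals rfl
    rw [hrun]
    refine ⟨fun _ _ => rfl, ?_⟩
    have : PassesTest G x y a b := fun c1 c2 c3 c4 c5 => absurd ⟨c1, c2, c3, c4, c5⟩ hall
    simp [this]

theorem run_insepEntry (hn : s.reg 0 = n) (hGc : G.Preconnected) {x y : Fin n} (h1 : s.reg 1 = x)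
    (h2 : s.reg 2 = y) (hG : StoresAdj G s) :
    (∀ c, c < n * n + (n * n + n * n) → c ≠ n * n + (n * x + y) →
      (insepEntry.run s).mem c = s.mem c) ∧
    ((insepEntry.run s).mem (n * n + (n * x + y)) ≠ 0 ↔ Insep G x y) := by
  set s1 := s.setReg 5 1 with hs1
  have r1 : ∀ z, z ≠ 5 → s1.reg z = s.reg z := fun z hz => by rw [hs1, RamState.reg_setReg, if_neg hz]
  have := Cmd.run_loop₂ (i := 3) (j := 4) (n := n) (P := fun u v t => SameLow n s t ∧
    (t.reg 5 ≠ 0 ↔ ∀ a b : Fin n, (a < u ∨ ((a : ℕ) = u ∧ b < v)) → PassesTest G x y a b))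
    (p := testClique) s1 ((r1 0 (by omega)).trans hn) rfl rfl
    ⟨fun _ _ => rfl, by simp [hs1, RamState.reg_setReg]⟩
    (fun u t h => by simpa [SameLow, RamState.mem_setReg, RamState.reg_setReg] using h)
    (fun u t h => ⟨h.1, h.2.trans ⟨fun h a b hab => h a b (by omega), fun h a b hab => h a b (by omega)⟩⟩)
    (fun u hu v hv t ⟨i1, i2⟩ h3 hreg => by
      have tr : ∀ y, (Cmd.loop 3 (.loop 4 testClique)).assigns y = false → y ≠ 5 → y ≠ 4 →
          (t.setReg 4 v).reg y = s.reg y := fun y hy hy5 hy4 => by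
        rw [RamState.reg_setReg, if_neg hy4, hreg y hy, r1 y hy5]
      obtain ⟨o1, o2⟩ := run_testClique (s := t.setReg 4 v) (G := G) (a := ⟨u, hu⟩) (b := ⟨v, hv⟩)
        ((tr 0 rfl (by omega) (by omega)).trans hn) ((tr 1 rfl (by omega) (by omega)).trans h1)
        ((tr 2 rfl (by omega) (by omega)).trans h2)
        (by rw [RamState.reg_setReg, if_neg (by omega), h3])
        (by rw [RamState.reg_setReg, if_pos rfl]) (SameLow.storesAdj (s := s) i1 hG)
      refine ⟨fun c hc => (o1 c hc).trans (i1 c hc), ?_⟩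
      rw [o2, RamState.reg_setReg, if_neg (by omega), i2]
      constructor
      · rintro ⟨h, h'⟩ a b hab
        by_cases hc : (a : ℕ) = u ∧ (b : ℕ) = v
        · have ha : a = ⟨u, hu⟩ := Fin.ext hc.1
          have hb : b = ⟨v, hv⟩ := Fin.ext hc.2
          rw [ha, hb]; exact h'
        · exact h a b (by omega)
      · exact fun h => ⟨fun a b hab => h a b (by omega), h _ _ (Or.inr ⟨rfl, by simp⟩)⟩)
  set s2 := (Cmd.loop 3 (.loop 4 testClique)).run s1 with hs2
  have r2 : ∀ z, (Cmd.loop 3 (.loop 4 testClique)).assigns z = false → z ≠ 5 → s2.reg z = s.reg z :=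
    fun z hz hz5 => by rw [hs2, Cmd.run_reg _ _ hz, r1 z hz5]
  have hrun : insepEntry.run s = s2.setMem (n * n + (n * x + y)) (s2.reg 5) := by
    change s2.setMem ((insepAddr 1 2).val s2) (s2.reg 5) = _
    simp only [insepAddr, sizeEx, posEx, Ex.val, r2 0 rfl (by omega), r2 1 rfl (by omega),
      r2 2 rfl (by omega), hn, h1, h2]
  rw [hrun]
  refine ⟨fun c hc hne => ?_, ?_⟩
  · rw [RamState.mem_setMem, if_neg hne]; exact this.1 c hc
  · rw [RamState.mem_setMem, if_pos rfl, this.2, insep_iff_passesTest hGc]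
    exact ⟨fun h a b => h a b (Or.inl a.2), fun h a b _ => h a b⟩

/-- The cells `n², …, 2 n² - 1` are nonzero at the inseparable pairs. -/
def StoresInsep (G : SimpleGraph (Fin n)) (s : RamState) : Prop :=
  ∀ u v : Fin n, s.mem (n * n + (n * u + v)) ≠ 0 ↔ Insep G u v

theorem run_insepMatrix (hn : s.reg 0 = n) (hGc : G.Preconnected) (hG : StoresAdj G s) :
    (∀ c, c < n * n → (insepMatrix.run s).mem c = s.mem c) ∧
    (∀ c, n * n + n * n ≤ c → c < n * n + (n * n + n * n) → (insepMatrix.run s).mem c = s.mem c) ∧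
    StoresInsep G (insepMatrix.run s) := by
  have := Cmd.run_loop₂ (i := 1) (j := 2) (n := n) (P := fun u v t =>
    (∀ c, c < n * n → t.mem c = s.mem c) ∧
    (∀ c, n * n + n * n ≤ c → c < n * n + (n * n + n * n) → t.mem c = s.mem c) ∧
    ∀ a b : Fin n, (a < u ∨ ((a : ℕ) = u ∧ b < v)) →
      (t.mem (n * n + (n * a + b)) ≠ 0 ↔ Insep G a b)) (p := insepEntry) s hn rfl rfl
    ⟨fun _ _ => rfl, fun _ _ _ => rfl, fun a b h => by omega⟩ (fun _ _ h => h)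
    (fun u t h => ⟨h.1, h.2.1, fun a b hab => h.2.2 a b (by omega)⟩)
    (fun u hu v hv t ⟨i1, i2, i3⟩ h1 hreg => by
      have hpos := pos_lt hu hv
      obtain ⟨o1, o2⟩ := run_insepEntry (s := t.setReg 2 v) (G := G) (x := ⟨u, hu⟩) (y := ⟨v, hv⟩)
        (by rw [RamState.reg_setReg, if_neg (by omega), hreg 0 rfl, hn]) hGc
        (by rw [RamState.reg_setReg, if_neg (by omega), h1])
        (by rw [RamState.reg_setReg, if_pos rfl]) (StoresAdj.congr (s := s) hG i1)
      refine ⟨fun c hc => ?_, fun c hc hc' => ?_, fun a b hab => ?_⟩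
      · rw [o1 c (by omega) (by simp only; omega)]; exact i1 c hc
      · rw [o1 c (by omega) (by simp only; omega)]; exact i2 c hc hc'
      · by_cases hc : (a : ℕ) = u ∧ (b : ℕ) = v
        · have ha : a = ⟨u, hu⟩ := Fin.ext hc.1
          have hb : b = ⟨v, hv⟩ := Fin.ext hc.2
          rw [ha, hb]; exact o2
        · have hpab := pos_lt a.2 b.2
          rw [o1 _ (by omega) (fun e => hc (pos_inj b.2 hv (by simpa using e)))]
          exact i3 a b (by omega))
  exact ⟨this.1, this.2.1, fun a b => this.2.2 a b (Or.inl a.2)⟩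

end Separation

/-! ### Choosing the hubs and joining them to their components -/

/-- One more than the degree of the variable `12` within the vertices inseparable from the
variables `1`, `2`. -/
def degCount : Cmd :=
  .seq (.assign 11 (.lit 1)) (.loop 13 (.when (insepEx 13 1) (.when (insepEx 13 2)
    (.when (adjEx 12 13) (.assign 11 (.add (.var 11) (.lit 1)))))))

/-- Find the first vertex of maximum degree. -/
def hubSearch : Cmd :=
  .seq (.assign 9 (.lit 0)) (.seq (.assign 10 (.lit 0)) (.loop 12 (.when (insepEx 12 1)
    (.when (insepEx 12 2) (.seq degCount (.when (.sub (.var 11) (.var 10))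
      (.seq (.assign 10 (.var 11)) (.assign 9 (.var 12)))))))))

/-- Join the hub to its component. -/
def hubJoin : Cmd :=
  .loop 12 (.when (insepEx 12 1) (.when (insepEx 12 2) (.store (addedAddr 9 12) (.lit 1))))

/-- Treat all components. -/
def hubPhase : Cmd :=
  .loop 1 (.loop 2 (.when (neEx 1 2) (.ite (adjEx 1 2) .skip
    (.when (insepEx 1 2) (.seq hubSearch hubJoin)))))

/-- The first vertex of maximum degree of the subgraph induced on `A`. -/
def IsFirstMax {n : ℕ} (G : SimpleGraph (Fin n)) (A : Set (Fin n)) (u : Fin n) : Prop :=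
  IsMaxDegreeIn G A u ∧ ∀ v ∈ A, v < u → (G.neighborSet v ∩ A).ncard < (G.neighborSet u ∩ A).ncard

section Hubs

variable {n : ℕ} {G : SimpleGraph (Fin n)} {A : Set (Fin n)} {s : RamState}

/-- A component is met once for each ordered nonadjacent pair in it. Breaking ties by the order of
the vertices makes all these searches find the same hub. -/
theorem IsFirstMax.unique {u v : Fin n} (hu : IsFirstMax G A u) (hv : IsFirstMax G A v) : u = v := by
  rcases lt_trichotomy u v with h | h | h
  · exact absurd (hv.2 u hu.1.1 h) (not_lt.2 (hu.1.2 v hv.1.1))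
  · exact h
  · exact absurd (hu.2 v hv.1.1 h) (not_lt.2 (hv.1.2 u hu.1.1))

theorem exists_isFirstMax (hA : A.Nonempty) : ∃ u, IsFirstMax G A u := by
  obtain ⟨m, hm, hmax⟩ := A.toFinite.exists_maximalFor (fun z => (G.neighborSet z ∩ A).ncard) A hA
  have hmax' : ∀ z ∈ A, (G.neighborSet z ∩ A).ncard ≤ (G.neighborSet m ∩ A).ncard := fun z hz =>
    (le_total _ _).elim id fun h => hmax hz h
  obtain ⟨u, hu, hmin⟩ := ({z ∈ A | (G.neighborSet m ∩ A).ncard ≤ (G.neighborSet z ∩ A).ncard}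
    ).toFinite.exists_minimalFor id _ ⟨m, hm, le_rfl⟩
  refine ⟨u, ⟨hu.1, fun v hv => (hmax' v hv).trans hu.2⟩, fun v hv hvu => ?_⟩
  by_contra! h
  exact absurd (hmin ⟨hv, hu.2.trans h⟩ hvu.le) (not_le.2 hvu)

/-- The hub that the program chooses. -/
noncomputable def firstMax [Nonempty (Fin n)] (G : SimpleGraph (Fin n)) (A : Set (Fin n)) : Fin n :=
  Classical.epsilon (IsFirstMax G A)

theorem firstMax_spec [Nonempty (Fin n)] (hA : A.Nonempty) : IsFirstMax G A (firstMax G A) :=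
  Classical.epsilon_spec (exists_isFirstMax hA)

/-- The state holds the size, the adjacency matrix and the inseparability matrix of `G`. -/
structure Holds (G : SimpleGraph (Fin n)) (s : RamState) : Prop where
  size : s.reg 0 = n
  adj : StoresAdj G s
  insep : StoresInsep G s

theorem Holds.congr {s' : RamState} (h : Holds G s) (h0 : s'.reg 0 = s.reg 0)
    (hm : ∀ c, c < n * n + n * n → s'.mem c = s.mem c) : Holds G s' where
  size := h0.trans h.size
  adj := h.adj.congr fun c hc => hm c (by omega)
  insep := fun u v => by
    rw [hm _ (by have := pos_lt u.2 v.2; omega)]; exact h.insep u v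

theorem Holds.adjEx_val (h : Holds G s) {i j : ℕ} {u v : Fin n} (hi : s.reg i = u)
    (hj : s.reg j = v) : (adjEx i j).val s ≠ 0 ↔ G.Adj u v := by
  simpa [adjEx, posEx, Ex.val, h.size, hi, hj] using h.adj u v

theorem Holds.insepEx_val (h : Holds G s) {i j : ℕ} {u v : Fin n} (hi : s.reg i = u)
    (hj : s.reg j = v) : (insepEx i j).val s ≠ 0 ↔ Insep G u v := by
  simpa [insepEx, insepAddr, sizeEx, posEx, Ex.val, h.size, hi, hj] using h.insep u v

theorem Cmd.run_when_pos {e : Ex} {p : Cmd} (h : e.val s ≠ 0) : (Cmd.when e p).run s = p.run s :=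
  if_pos h

theorem Cmd.run_when_neg {e : Ex} {p : Cmd} (h : ¬ e.val s ≠ 0) : (Cmd.when e p).run s = s :=
  if_neg h

theorem ncard_lt_succ_of_pos {Q : Fin n → Prop} {j : ℕ} (hj : j < n) (h : Q ⟨j, hj⟩) :
    {w : Fin n | w < j + 1 ∧ Q w}.ncard = {w : Fin n | w < j ∧ Q w}.ncard + 1 := by
  rw [← Set.ncard_insert_of_notMem (a := ⟨j, hj⟩) (by simp)]
  congr 1
  ext w
  simp only [Set.mem_ofPred_eq, Set.mem_insert_iff, Fin.ext_iff]
  constructor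
  · rintro ⟨h1, h2⟩
    by_cases hw : (w : ℕ) = j
    · exact Or.inl hw
    · exact Or.inr ⟨by omega, h2⟩
  · rintro (hw | ⟨h1, h2⟩)
    · have : w = ⟨j, hj⟩ := Fin.ext hw
      exact ⟨by omega, this ▸ h⟩
    · exact ⟨by omega, h2⟩

theorem ncard_lt_succ_of_neg {Q : Fin n → Prop} {j : ℕ} (hj : j < n) (h : ¬ Q ⟨j, hj⟩) :
    {w : Fin n | w < j + 1 ∧ Q w}.ncard = {w : Fin n | w < j ∧ Q w}.ncard := by
  congr 1
  ext w
  refine ⟨fun ⟨h1, h2⟩ => ⟨?_, h2⟩, fun ⟨h1, h2⟩ => ⟨by omega, h2⟩⟩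
  have : (w : ℕ) ≠ j := fun e => h (by rwa [show (⟨j, hj⟩ : Fin n) = w from Fin.ext e.symm])
  omega

theorem run_degCount (hs : Holds G s) {x y z : Fin n} (h1 : s.reg 1 = x) (h2 : s.reg 2 = y)
    (h12 : s.reg 12 = z) :
    (degCount.run s).mem = s.mem ∧ (degCount.run s).reg 11 =
      (G.neighborSet z ∩ {w | Insep G w x ∧ Insep G w y}).ncard + 1 := by
  set s1 := s.setReg 11 1 with hs1
  have r1 : ∀ v, v ≠ 11 → s1.reg v = s.reg v := fun v hv => by rw [hs1, RamState.reg_setReg, if_neg hv]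
  have := Cmd.run_loop (i := 13) (p := .when (insepEx 13 1) (.when (insepEx 13 2)
    (.when (adjEx 12 13) (.assign 11 (.add (.var 11) (.lit 1)))))) s1
    (P := fun j t => t.mem = s.mem ∧ t.reg 11 =
      {w : Fin n | w < j ∧ w ∈ G.neighborSet z ∩ {w | Insep G w x ∧ Insep G w y}}.ncard + 1)
    ⟨rfl, by simp [hs1, RamState.reg_setReg]⟩ (by
      rintro j hj t ⟨i1, i2⟩ hreg
      rw [r1 0 (by omega), hs.size] at hj
      set t' := t.setReg 13 j with ht'
      have tr : ∀ v, v ≠ 13 → v ≠ 11 → t'.reg v = s.reg v := fun v h13 h11 => by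
        rw [ht', RamState.reg_setReg, if_neg h13, hreg v, r1 v h11]
        simp [Cmd.assigns, Cmd.when, h13, h11]
      have t13 : t'.reg 13 = (⟨j, hj⟩ : Fin n) := by simp [ht', RamState.reg_setReg]
      have ht : Holds G t' := hs.congr (tr 0 (by omega) (by omega)) fun c _ => by
        rw [ht', RamState.mem_setReg, i1]
      have e1 := ht.insepEx_val t13 ((tr 1 (by omega) (by omega)).trans h1)
      have e2 := ht.insepEx_val t13 ((tr 2 (by omega) (by omega)).trans h2)
      have e3 := ht.adjEx_val ((tr 12 (by omega) (by omega)).trans h12) t13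
      have t11 : t'.reg 11 = t.reg 11 := by simp [ht', RamState.reg_setReg]
      by_cases hc : (⟨j, hj⟩ : Fin n) ∈ G.neighborSet z ∩ {w | Insep G w x ∧ Insep G w y}
      · rw [Cmd.run_when_pos (e1.2 hc.2.1), Cmd.run_when_pos (e2.2 hc.2.2),
          Cmd.run_when_pos (e3.2 hc.1), ncard_lt_succ_of_pos hj hc, ← i2, ← t11]
        exact ⟨i1, by simp [Cmd.run, Ex.val, RamState.reg_setReg]⟩
      · rw [ncard_lt_succ_of_neg hj hc, ← i2, ← t11]
        have : Cmd.run (.when (insepEx 13 1) (.when (insepEx 13 2)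
            (.when (adjEx 12 13) (.assign 11 (.add (.var 11) (.lit 1)))))) t' = t' := by
          simp only [Cmd.run_when]
          split_ifs with c1 c2 c3
          · exact absurd ⟨e3.1 c3, e1.1 c1, e2.1 c2⟩ hc
          all_goals rfl
        rw [this]
        exact ⟨i1, rfl⟩)
  rw [r1 0 (by omega), hs.size] at this
  refine ⟨this.1, this.2.trans ?_⟩
  congr 2
  ext w
  simp

theorem run_hubSearch (hs : Holds G s) {x y : Fin n} (h1 : s.reg 1 = x) (h2 : s.reg 2 = y)
    (hA : A = {z | Insep G z x ∧ Insep G z y}) (hne : A.Nonempty) :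
    (hubSearch.run s).mem = s.mem ∧ ∃ h : Fin n, IsFirstMax G A h ∧ (hubSearch.run s).reg 9 = h := by
  set s1 := (s.setReg 9 0).setReg 10 0 with hs1
  have r1 : ∀ v, v ≠ 9 → v ≠ 10 → s1.reg v = s.reg v := fun v h9 h10 => by
    simp [hs1, RamState.reg_setReg, h9, h10]
  set dg : Fin n → ℕ := fun z => (G.neighborSet z ∩ A).ncard with hdg
  have := Cmd.run_loop (i := 12) (p := .when (insepEx 12 1)
    (.when (insepEx 12 2) (.seq degCount (.when (.sub (.var 11) (.var 10))
      (.seq (.assign 10 (.var 11)) (.assign 9 (.var 12))))))) s1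
    -- Register 10 holds one more than the best degree so far, so zero means that no vertex of `A`
    -- has been met. Replacement only by strictly larger degrees keeps the first maximum.
    (P := fun j t => t.mem = s.mem ∧ (∀ z ∈ A, (z : ℕ) < j → dg z < t.reg 10) ∧
      (t.reg 10 ≠ 0 → ∃ h ∈ A, t.reg 9 = h ∧ t.reg 10 = dg h + 1 ∧ ∀ z ∈ A, z < h → dg z < dg h))
    ⟨rfl, fun z _ hz => by omega, fun h => by simp [hs1, RamState.reg_setReg] at h⟩ (by
      rintro j hj t ⟨i1, i2, i3⟩ hreg
      rw [r1 0 (by omega) (by omega), hs.size] at hj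
      set t' := t.setReg 12 j with ht'
      have tr : ∀ v, v < 9 → t'.reg v = s.reg v := fun v hv => by
        rw [ht', RamState.reg_setReg, if_neg (by omega), hreg v, r1 v (by omega) (by omega)]
        simp [Cmd.assigns, Cmd.when, degCount]
        omega
      have t12 : t'.reg 12 = (⟨j, hj⟩ : Fin n) := by simp [ht', RamState.reg_setReg]
      have ht : Holds G t' := hs.congr (tr 0 (by omega)) fun c _ => by
        rw [ht', RamState.mem_setReg, i1]
      have e1 := ht.insepEx_val t12 ((tr 1 (by omega)).trans h1)
      have e2 := ht.insepEx_val t12 ((tr 2 (by omega)).trans h2)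
      obtain ⟨d1, d2⟩ := run_degCount ht ((tr 1 (by omega)).trans h1) ((tr 2 (by omega)).trans h2) t12
      rw [← hA] at d2
      replace d2 : (degCount.run t').reg 11 = dg ⟨j, hj⟩ + 1 := d2
      have d9 : (degCount.run t').reg 9 = t.reg 9 := Cmd.run_reg _ _ rfl
      have d10 : (degCount.run t').reg 10 = t.reg 10 := Cmd.run_reg _ _ rfl
      have d12 : (degCount.run t').reg 12 = j := (Cmd.run_reg _ _ rfl).trans t12
      have hlt : ∀ z : Fin n, (z : ℕ) < j + 1 → (z : ℕ) < j ∨ z = ⟨j, hj⟩ := fun z hz => by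
        rw [Fin.ext_iff]; simp only; omega
      by_cases hc : (⟨j, hj⟩ : Fin n) ∈ A
      · have hc' := hc
        rw [hA] at hc'
        rw [Cmd.run_when_pos (e1.2 hc'.1), Cmd.run_when_pos (e2.2 hc'.2)]
        change _ ∧ _ ∧ _
        by_cases hb : t.reg 10 < dg ⟨j, hj⟩ + 1
        · have hrun : Cmd.run (.seq degCount (.when (.sub (.var 11) (.var 10))
              (.seq (.assign 10 (.var 11)) (.assign 9 (.var 12))))) t' =
              ((degCount.run t').setReg 10 (dg ⟨j, hj⟩ + 1)).setReg 9 j := by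
            change (Cmd.when _ _).run (degCount.run t') = _
            rw [Cmd.run_when_pos (by simp only [Ex.val, d2, d10]; omega)]
            simp [Cmd.run, Ex.val, RamState.reg_setReg, d2, d12]
          rw [hrun]
          simp only [RamState.reg_setReg, RamState.mem_setReg, if_true, Nat.reduceEqDiff, if_false]
          refine ⟨d1.trans i1, fun z hz hzj => ?_, fun _ => ⟨⟨j, hj⟩, hc, rfl, rfl, fun z hz hzj => ?_⟩⟩
          · rcases hlt z hzj with h | h
            · have := i2 z hz h; omega
            · rw [h]; omega
          · have : dg z < t.reg 10 := i2 z hz hzj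
            change dg z < dg ⟨j, hj⟩
            omega
        · have hrun : Cmd.run (.seq degCount (.when (.sub (.var 11) (.var 10))
              (.seq (.assign 10 (.var 11)) (.assign 9 (.var 12))))) t' = degCount.run t' := by
            change (Cmd.when _ _).run (degCount.run t') = _
            rw [Cmd.run_when_neg (by simp only [Ex.val, d2, d10]; omega)]
          rw [hrun, d9, d10]
          refine ⟨d1.trans i1, fun z hz hzj => ?_, i3⟩
          rcases hlt z hzj with h | h
          · exact i2 z hz h
          · rw [h]; omega
      · have : Cmd.run (.when (insepEx 12 1) (.when (insepEx 12 2) (.seq degCount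
            (.when (.sub (.var 11) (.var 10)) (.seq (.assign 10 (.var 11))
            (.assign 9 (.var 12))))))) t' = t' := by
          rw [Cmd.run_when]
          split_ifs with c1
          · rw [Cmd.run_when_neg fun c2 => hc (by rw [hA]; exact ⟨e1.1 c1, e2.1 c2⟩)]
          · rfl
        rw [this]
        have t9 : t'.reg 9 = t.reg 9 := by simp [ht', RamState.reg_setReg]
        have t10 : t'.reg 10 = t.reg 10 := by simp [ht', RamState.reg_setReg]
        rw [t9, t10]
        refine ⟨i1, fun z hz hzj => ?_, i3⟩
        rcases hlt z hzj with h | h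
        · exact i2 z hz h
        · exact absurd (h ▸ hz) hc)
  rw [r1 0 (by omega) (by omega), hs.size] at this
  obtain ⟨o1, o2, o3⟩ := this
  obtain ⟨z, hz⟩ := hne
  obtain ⟨h, hA', h9, h10, hmin⟩ := o3 (by have := o2 z hz z.2; omega)
  refine ⟨o1, h, ⟨⟨hA', fun v hv => ?_⟩, hmin⟩, h9⟩
  have := o2 v hv v.2
  simp only [hdg] at this h10
  omega

/-- The cell of the pair `p`, `q` in the matrix of added edges. -/
def addedCell (n p q : ℕ) : ℕ := n * n + n * n + (n * p + q)

theorem run_hubJoin (hs : Holds G s) {x y h : Fin n} (h1 : s.reg 1 = x) (h2 : s.reg 2 = y)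
    (h9 : s.reg 9 = h) :
    (∀ c, c < n * n + n * n → (hubJoin.run s).mem c = s.mem c) ∧
    ∀ p q : Fin n, (hubJoin.run s).mem (addedCell n p q) ≠ 0 ↔
      s.mem (addedCell n p q) ≠ 0 ∨ (p = h ∧ Insep G q x ∧ Insep G q y) := by
  have := Cmd.run_loop (i := 12) (p := .when (insepEx 12 1) (.when (insepEx 12 2)
    (.store (addedAddr 9 12) (.lit 1)))) s
    (P := fun j t => (∀ c, c < n * n + n * n → t.mem c = s.mem c) ∧
      ∀ p q : Fin n, t.mem (addedCell n p q) ≠ 0 ↔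
        s.mem (addedCell n p q) ≠ 0 ∨ ((q : ℕ) < j ∧ p = h ∧ Insep G q x ∧ Insep G q y))
    ⟨fun _ _ => rfl, by simp⟩ (by
      rintro j hj t ⟨i1, i2⟩ hreg
      rw [hs.size] at hj
      set t' := t.setReg 12 j with ht'
      have tr : ∀ v, v ≠ 12 → t'.reg v = s.reg v := fun v hv => by
        rw [ht', RamState.reg_setReg, if_neg hv, hreg v]
        simp [Cmd.assigns, Cmd.when, hv]
      have t12 : t'.reg 12 = (⟨j, hj⟩ : Fin n) := by simp [ht', RamState.reg_setReg]
      have ht : Holds G t' := hs.congr (tr 0 (by omega)) fun c hc => by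
        rw [ht', RamState.mem_setReg, i1 c hc]
      have e1 := ht.insepEx_val t12 ((tr 1 (by omega)).trans h1)
      have e2 := ht.insepEx_val t12 ((tr 2 (by omega)).trans h2)
      by_cases hc : Insep G ⟨j, hj⟩ x ∧ Insep G ⟨j, hj⟩ y
      · rw [Cmd.run_when_pos (e1.2 hc.1), Cmd.run_when_pos (e2.2 hc.2)]
        have hrun : Cmd.run (.store (addedAddr 9 12) (.lit 1)) t' = t'.setMem (addedCell n h j) 1 := by
          simp [Cmd.run, addedAddr, posEx, sizeEx, Ex.val, addedCell, ht.size, t12, tr 9, h9]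
        rw [hrun]
        refine ⟨fun c hc => ?_, fun p q => ?_⟩
        · rw [RamState.mem_setMem, if_neg (by simp only [addedCell]; omega)]; exact i1 c hc
        · rw [RamState.mem_setMem]
          split_ifs with hpq
          · obtain ⟨h3, h4⟩ := pos_inj q.2 hj (by simpa [addedCell] using hpq)
            have hp : p = h := Fin.ext h3
            have hq : q = ⟨j, hj⟩ := Fin.ext h4
            simp [hp, hq, hc.1, hc.2]
          · refine (i2 p q).trans (or_congr Iff.rfl (and_congr_left fun ⟨hp, _⟩ => ?_))
            have : (q : ℕ) ≠ j := fun e => hpq (by rw [hp, e])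
            omega
      · have hrun : Cmd.run (.when (insepEx 12 1) (.when (insepEx 12 2)
            (.store (addedAddr 9 12) (.lit 1)))) t' = t' := by
          rw [Cmd.run_when]
          split_ifs with c1
          · rw [Cmd.run_when_neg fun c2 => hc ⟨e1.1 c1, e2.1 c2⟩]
          · rfl
        rw [hrun]
        refine ⟨i1, fun p q => (i2 p q).trans (or_congr Iff.rfl (and_congr_left fun ⟨_, hq⟩ => ?_))⟩
        have : (q : ℕ) ≠ j := fun e => hc (by rwa [show (⟨j, hj⟩ : Fin n) = q from Fin.ext e.symm])
        omega)
  rw [hs.size] at this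
  refine ⟨this.1, fun p q => (this.2 p q).trans ?_⟩
  simp

/-- The pair `x`, `y` leads the algorithm to join `p` and `q`. -/
def Joins [Nonempty (Fin n)] (G : SimpleGraph (Fin n)) (x y p q : Fin n) : Prop :=
  x ≠ y ∧ ¬ G.Adj x y ∧ Insep G x y ∧ p = firstMax G {z | Insep G z x ∧ Insep G z y} ∧
    Insep G q x ∧ Insep G q y

/-- The hub depends only on the set of vertices inseparable from `x` and `y`. Repeated treatment of
a component therefore writes the same cells again. -/
theorem run_hubPhase [Nonempty (Fin n)] (hs : Holds G s)
    (h0 : ∀ p q : Fin n, s.mem (addedCell n p q) = 0) :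
    (∀ c, c < n * n + n * n → (hubPhase.run s).mem c = s.mem c) ∧
    ∀ p q : Fin n, (hubPhase.run s).mem (addedCell n p q) ≠ 0 ↔ ∃ x y, Joins G x y p q := by
  have := Cmd.run_loop₂ (i := 1) (j := 2) (n := n) (P := fun u v t =>
    (∀ c, c < n * n + n * n → t.mem c = s.mem c) ∧
    ∀ p q : Fin n, t.mem (addedCell n p q) ≠ 0 ↔
      ∃ x y : Fin n, (x < u ∨ ((x : ℕ) = u ∧ y < v)) ∧ Joins G x y p q)
    (p := .when (neEx 1 2) (.ite (adjEx 1 2) .skip (.when (insepEx 1 2) (.seq hubSearch hubJoin))))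
    s hs.size rfl rfl ⟨fun _ _ => rfl, fun p q => by simp [h0]⟩ (fun _ _ h => h)
    (fun u t h => ⟨h.1, fun p q => (h.2 p q).trans <| exists_congr fun x => exists_congr fun y =>
      and_congr_left fun _ => by omega⟩)
    (by
      rintro u hu v hv t ⟨i1, i2⟩ h1 hreg
      set t' := t.setReg 2 v with ht'
      have t0 : t'.reg 0 = s.reg 0 := by
        rw [ht', RamState.reg_setReg, if_neg (by omega), hreg 0 rfl]
      have t1 : t'.reg 1 = (⟨u, hu⟩ : Fin n) := by
        rw [ht', RamState.reg_setReg, if_neg (by omega), h1]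
      have t2 : t'.reg 2 = (⟨v, hv⟩ : Fin n) := by simp [ht', RamState.reg_setReg]
      have ht : Holds G t' := hs.congr t0 fun c hc => by rw [ht', RamState.mem_setReg, i1 c hc]
      have hext : ∀ x y : Fin n, (x : ℕ) = u ∧ (y : ℕ) = v → x = ⟨u, hu⟩ ∧ y = ⟨v, hv⟩ :=
        fun x y h => ⟨Fin.ext h.1, Fin.ext h.2⟩
      have e1 : (neEx 1 2).val t' ≠ 0 ↔ (⟨u, hu⟩ : Fin n) ≠ ⟨v, hv⟩ := by
        rw [neEx_val, t1, t2, Ne, Ne, Fin.ext_iff]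
      have e2 := ht.adjEx_val t1 t2
      have e3 := ht.insepEx_val t1 t2
      by_cases hc : (⟨u, hu⟩ : Fin n) ≠ ⟨v, hv⟩ ∧ ¬ G.Adj ⟨u, hu⟩ ⟨v, hv⟩ ∧ Insep G ⟨u, hu⟩ ⟨v, hv⟩
      · have hrun : Cmd.run (.when (neEx 1 2) (.ite (adjEx 1 2) .skip
            (.when (insepEx 1 2) (.seq hubSearch hubJoin)))) t' = hubJoin.run (hubSearch.run t') := by
          rw [Cmd.run_when_pos (e1.2 hc.1)]
          change (if _ then _ else _) = _
          rw [if_neg fun h => hc.2.1 (e2.1 h), Cmd.run_when_pos (e3.2 hc.2.2)]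
          rfl
        rw [hrun]
        obtain ⟨m1, h, hh, h9⟩ := run_hubSearch ht t1 t2 rfl ⟨⟨u, hu⟩, Insep.refl _, hc.2.2⟩
        have hh' := hh.unique (firstMax_spec ⟨_, hh.1.1⟩)
        obtain ⟨j1, j2⟩ := run_hubJoin (s := hubSearch.run t') (G := G) (h := h)
          (ht.congr (Cmd.run_reg _ _ rfl) fun c _ => by rw [m1])
          ((Cmd.run_reg _ _ rfl).trans t1) ((Cmd.run_reg _ _ rfl).trans t2) h9
        refine ⟨fun c hc => by rw [j1 c hc, m1]; exact i1 c hc, fun p q => ?_⟩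
        rw [j2, m1, ht', RamState.mem_setReg, i2]
        constructor
        · rintro (⟨x, y, hxy, hj⟩ | ⟨h3, h4⟩)
          · exact ⟨x, y, by omega, hj⟩
          · exact ⟨_, _, Or.inr ⟨rfl, by simp⟩, hc.1, hc.2.1, hc.2.2, h3.trans hh', h4⟩
        · rintro ⟨x, y, hxy, hj⟩
          by_cases hxy' : (x : ℕ) = u ∧ (y : ℕ) = v
          · obtain ⟨rfl, rfl⟩ := hext x y hxy'
            exact Or.inr ⟨hj.2.2.2.1.trans hh'.symm, hj.2.2.2.2⟩
          · exact Or.inl ⟨x, y, by omega, hj⟩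
      · have hrun : Cmd.run (.when (neEx 1 2) (.ite (adjEx 1 2) .skip
            (.when (insepEx 1 2) (.seq hubSearch hubJoin)))) t' = t' := by
          rw [Cmd.run_when]
          split_ifs with c1
          · change (if _ then _ else _) = _
            split_ifs with c2
            · rfl
            · rw [Cmd.run_when_neg fun c3 => hc ⟨e1.1 c1, fun h => c2 (e2.2 h), e3.1 c3⟩]
          · rfl
        rw [hrun]
        refine ⟨i1, fun p q => (i2 p q).trans <| exists_congr fun x => exists_congr fun y =>
          and_congr_left fun hj => ?_⟩
        have : ¬ ((x : ℕ) = u ∧ (y : ℕ) = v) := fun hxy => by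
          obtain ⟨rfl, rfl⟩ := hext x y hxy
          exact hc ⟨hj.1, hj.2.1, hj.2.2.1⟩
        omega)
  refine ⟨this.1, fun p q => (this.2 p q).trans <| exists_congr fun x => exists_congr fun y => ?_⟩
  simp

end Hubs

/-! ### Writing the output and counting the added edges -/

/-- Add the computed edges to the matrix, and count them in the variable `14`. -/
def outputPhase : Cmd :=
  .seq (.assign 14 (.lit 0)) (.loop 12 (.loop 13 (.ite (adjEx 12 13) .skip (.when (neEx 12 13)
    (.when (.add (.ld (addedAddr 12 13)) (.ld (addedAddr 13 12)))
      (.seq (.store (posEx 12 13) (.lit 1)) (.when (.sub (.var 13) (.var 12))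
        (.assign 14 (.add (.var 14) (.lit 1))))))))))

/-- The algorithm Fill-in. -/
def fillInCmd : Cmd := .seq insepMatrix (.seq hubPhase outputPhase)

/-- The algorithm Fill-in as a random access machine program. -/
def fillInProg : RamProg := .seq (fillInCmd.compile 16) (.copy 0 14)

section Output

variable {n : ℕ} {G H : SimpleGraph (Fin n)} {s : RamState}

theorem adjEntry_pos (u v : Fin n) (h : G.Adj u v) : adjEntry G (n * u + v) = 1 :=
  if_pos ⟨u, v, h, rfl⟩

theorem adjEntry_neg (u v : Fin n) (h : ¬ G.Adj u v) : adjEntry G (n * u + v) = 0 := by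
  refine if_neg ?_
  rintro ⟨u', v', h', e⟩
  obtain ⟨h1, h2⟩ := pos_inj v.2 v'.2 e
  obtain rfl := Fin.ext h1
  obtain rfl := Fin.ext h2
  exact h h'

theorem adjEntry_of_le {i : ℕ} (hi : n * n ≤ i) : adjEntry G i = 0 := by
  refine if_neg ?_
  rintro ⟨u, v, -, rfl⟩
  exact absurd (pos_lt u.2 v.2) (not_lt.2 hi)

theorem storesAdj_of_mem (h : ∀ u v : Fin n, s.mem (n * u + v) = adjEntry G (n * u + v)) :
    StoresAdj G s := by
  intro u v
  rw [h u v]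
  by_cases huv : G.Adj u v
  · simp [adjEntry_pos u v huv, huv]
  · simp [adjEntry_neg u v huv, huv]

theorem holdsGraph_of_mem (h : ∀ u v : Fin n, s.mem (n * u + v) = adjEntry G (n * u + v)) :
    HoldsGraph s G := by
  intro i hi
  have hn : 0 < n := Nat.pos_of_ne_zero fun e => by subst e; omega
  have := h ⟨i / n, Nat.div_lt_of_lt_mul hi⟩ ⟨i % n, Nat.mod_lt _ hn⟩
  simpa only [Nat.div_add_mod] using this

/-- Counts each edge at its ordered pair, as the program does. -/
theorem addedEdges_eq_ncard :
    addedEdges G H = {e : Fin n × Fin n | e.1 < e.2 ∧ H.Adj e.1 e.2 ∧ ¬ G.Adj e.1 e.2}.ncard := by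
  rw [addedEdges, ← Set.InjOn.ncard_image (f := fun e : Fin n × Fin n => s(e.1, e.2))]
  · congr 1
    ext e
    induction e with | _ a b
    simp only [Set.mem_sdiff, SimpleGraph.mem_edgeSet, Set.mem_image, Set.mem_ofPred_eq, Prod.exists,
      Sym2.eq_iff]
    constructor
    · rintro ⟨h1, h2⟩
      rcases lt_or_gt_of_ne h1.ne with h | h
      · exact ⟨a, b, ⟨h, h1, h2⟩, Or.inl ⟨rfl, rfl⟩⟩
      · exact ⟨b, a, ⟨h, h1.symm, fun h => h2 h.symm⟩, Or.inr ⟨rfl, rfl⟩⟩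
    · rintro ⟨c, d, ⟨-, h1, h2⟩, ⟨rfl, rfl⟩ | ⟨rfl, rfl⟩⟩
      · exact ⟨h1, h2⟩
      · exact ⟨h1.symm, fun h => h2 h.symm⟩
  · rintro ⟨a, b⟩ ⟨h1, -⟩ ⟨c, d⟩ ⟨h2, -⟩ he
    simp only [Sym2.eq_iff] at he
    simp only at h1 h2
    rcases he with ⟨rfl, rfl⟩ | ⟨rfl, rfl⟩
    · rfl
    · exact absurd h1 (not_lt.2 h2.le)

/-- The row-by-row predecessors of a position. -/
def Before (u v : ℕ) (p q : Fin n) : Prop := p < u ∨ ((p : ℕ) = u ∧ q < v)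

theorem before_succ {u v : ℕ} (hu : u < n) (hv : v < n) (p q : Fin n) :
    Before u (v + 1) p q ↔ Before u v p q ∨ (p = ⟨u, hu⟩ ∧ q = ⟨v, hv⟩) := by
  simp only [Before, Fin.ext_iff]; omega

theorem ncard_before_succ_of_pos {Q : Fin n → Fin n → Prop} {u v : ℕ} (hu : u < n) (hv : v < n)
    (h : Q ⟨u, hu⟩ ⟨v, hv⟩) :
    {e : Fin n × Fin n | Before u (v + 1) e.1 e.2 ∧ Q e.1 e.2}.ncard =
      {e : Fin n × Fin n | Before u v e.1 e.2 ∧ Q e.1 e.2}.ncard + 1 := by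
  rw [← Set.ncard_insert_of_notMem (a := (⟨u, hu⟩, ⟨v, hv⟩)) (by simp [Before])]
  congr 1
  ext ⟨p, q⟩
  simp only [Set.mem_ofPred_eq, Set.mem_insert_iff, before_succ hu hv, Prod.mk.injEq]
  constructor
  · rintro ⟨h1 | h1, h2⟩
    · exact Or.inr ⟨h1, h2⟩
    · exact Or.inl h1
  · rintro (⟨rfl, rfl⟩ | ⟨h1, h2⟩)
    · exact ⟨Or.inr ⟨rfl, rfl⟩, h⟩
    · exact ⟨Or.inl h1, h2⟩

theorem ncard_before_succ_of_neg {Q : Fin n → Fin n → Prop} {u v : ℕ} (hu : u < n) (hv : v < n)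
    (h : ¬ Q ⟨u, hu⟩ ⟨v, hv⟩) :
    {e : Fin n × Fin n | Before u (v + 1) e.1 e.2 ∧ Q e.1 e.2}.ncard =
      {e : Fin n × Fin n | Before u v e.1 e.2 ∧ Q e.1 e.2}.ncard := by
  congr 1
  ext ⟨p, q⟩
  simp only [Set.mem_ofPred_eq, before_succ hu hv]
  refine and_congr_left fun hQ => or_iff_left ?_
  rintro ⟨rfl, rfl⟩
  exact h hQ

/-- The matrix is overwritten in place. This is safe because the test at a position reads only its
own cell, which still holds the entry of `G`. The matrix of added edges is not symmetric, hence the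
test of both orders. -/
theorem run_outputPhase (hn : s.reg 0 = n)
    (hG : ∀ u v : Fin n, s.mem (n * u + v) = adjEntry G (n * u + v))
    (hH : ∀ u v : Fin n, H.Adj u v ↔ G.Adj u v ∨ (u ≠ v ∧
      (s.mem (addedCell n u v) ≠ 0 ∨ s.mem (addedCell n v u) ≠ 0))) :
    HoldsGraph (outputPhase.run s) H ∧ (outputPhase.run s).reg 14 = addedEdges G H := by
  set s1 := s.setReg 14 0 with hs1
  have hGH : G ≤ H := fun u v h => (hH u v).2 (Or.inl h)
  set Q : Fin n → Fin n → Prop := fun p q => p < q ∧ H.Adj p q ∧ ¬ G.Adj p q with hQ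
  have := Cmd.run_loop₂ (i := 12) (j := 13) (n := n) (P := fun u v t =>
    (∀ p q : Fin n, t.mem (addedCell n p q) = s.mem (addedCell n p q)) ∧
    (∀ p q : Fin n, Before u v p q → t.mem (n * p + q) = adjEntry H (n * p + q)) ∧
    (∀ p q : Fin n, ¬ Before u v p q → t.mem (n * p + q) = adjEntry G (n * p + q)) ∧
    t.reg 14 = {e : Fin n × Fin n | Before u v e.1 e.2 ∧ Q e.1 e.2}.ncard)
    (p := .ite (adjEx 12 13) .skip (.when (neEx 12 13)
    (.when (.add (.ld (addedAddr 12 13)) (.ld (addedAddr 13 12)))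
      (.seq (.store (posEx 12 13) (.lit 1)) (.when (.sub (.var 13) (.var 12))
        (.assign 14 (.add (.var 14) (.lit 1)))))))) s1
    (by simp [hs1, RamState.reg_setReg, hn]) rfl rfl
    ⟨fun _ _ => rfl, fun p q h => by simp [Before] at h, fun p q _ => hG p q, by
      simp [hs1, RamState.reg_setReg, Before]⟩
    (fun u t h => by simpa [RamState.mem_setReg, RamState.reg_setReg] using h)
    (fun u t h => by
      have : ∀ p q : Fin n, Before u n p q ↔ Before (u + 1) 0 p q := fun p q => by
        simp only [Before]; omega
      simpa only [this] using h)
    (by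
      rintro u hu v hv t ⟨i1, i2, i3, i4⟩ h12 hreg
      set t' := t.setReg 13 v with ht'
      have t0 : t'.reg 0 = n := by
        rw [ht', RamState.reg_setReg, if_neg (by omega), hreg 0 rfl, hs1, RamState.reg_setReg,
          if_neg (by omega), hn]
      have t12 : t'.reg 12 = u := by rw [ht', RamState.reg_setReg, if_neg (by omega), h12]
      have t13 : t'.reg 13 = v := by simp [ht', RamState.reg_setReg]
      have t14 : t'.reg 14 = t.reg 14 := by simp [ht', RamState.reg_setReg]
      have tm : t'.mem = t.mem := rfl
      have hcur : t.mem (n * u + v) = adjEntry G (n * u + v) :=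
        i3 ⟨u, hu⟩ ⟨v, hv⟩ (by simp [Before])
      have e1 : (adjEx 12 13).val t' ≠ 0 ↔ G.Adj ⟨u, hu⟩ ⟨v, hv⟩ := by
        simp only [adjEx, posEx, Ex.val, t0, t12, t13, tm, hcur]
        by_cases h : G.Adj ⟨u, hu⟩ ⟨v, hv⟩
        · simp [h, adjEntry_pos ⟨u, hu⟩ ⟨v, hv⟩ h]
        · simp [h, adjEntry_neg ⟨u, hu⟩ ⟨v, hv⟩ h]
      have e2 : (neEx 12 13).val t' ≠ 0 ↔ (⟨u, hu⟩ : Fin n) ≠ ⟨v, hv⟩ := by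
        rw [neEx_val, t12, t13, Ne, Ne, Fin.ext_iff]
      have e3 : (Ex.add (.ld (addedAddr 12 13)) (.ld (addedAddr 13 12))).val t' ≠ 0 ↔
          s.mem (addedCell n u v) ≠ 0 ∨ s.mem (addedCell n v u) ≠ 0 := by
        rw [← i1 ⟨u, hu⟩ ⟨v, hv⟩, ← i1 ⟨v, hv⟩ ⟨u, hu⟩]
        simp only [addedAddr, sizeEx, posEx, Ex.val, t0, t12, t13, tm, addedCell]
        omega
      by_cases hadd : H.Adj ⟨u, hu⟩ ⟨v, hv⟩ ∧ ¬ G.Adj ⟨u, hu⟩ ⟨v, hv⟩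
      · obtain ⟨hc1, hc2⟩ := hadd
        obtain ⟨hc3, hc4⟩ := ((hH _ _).1 hc1).resolve_left hc2
        have hrun : ∃ m, Cmd.run (.ite (adjEx 12 13) .skip (.when (neEx 12 13)
            (.when (.add (.ld (addedAddr 12 13)) (.ld (addedAddr 13 12)))
            (.seq (.store (posEx 12 13) (.lit 1)) (.when (.sub (.var 13) (.var 12))
            (.assign 14 (.add (.var 14) (.lit 1)))))))) t' = m ∧ m.mem =
            (t.setMem (n * u + v) 1).mem ∧
            m.reg 14 = if u < v then t.reg 14 + 1 else t.reg 14 := by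
          refine ⟨_, rfl, ?_⟩
          change (RamState.mem (if _ then _ else _)) = _ ∧ RamState.reg (if _ then _ else _) 14 = _
          rw [if_neg fun h => hc2 (e1.1 h), Cmd.run_when_pos (e2.2 hc3), Cmd.run_when_pos (e3.2 hc4)]
          have hst : Cmd.run (.store (posEx 12 13) (.lit 1)) t' = t'.setMem (n * u + v) 1 := by
            simp [Cmd.run, posEx, Ex.val, t0, t12, t13]
          change (RamState.mem (Cmd.run _ (Cmd.run _ _))) = _ ∧
            RamState.reg (Cmd.run _ (Cmd.run _ _)) 14 = _
          rw [hst, Cmd.run_when]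
          simp only [Ex.val, RamState.reg_setMem, t12, t13, Cmd.run, t14]
          split_ifs with c1 c2 c2
          · exact ⟨rfl, by simp [RamState.reg_setReg]⟩
          · omega
          · omega
          · exact ⟨rfl, t14⟩
        obtain ⟨m, hm, m1, m2⟩ := hrun
        have hpos := pos_lt hu hv
        rw [hm, m1, m2, i4]
        refine ⟨fun p q => ?_, fun p q hpq => ?_, fun p q hpq => ?_, ?_⟩
        · rw [RamState.mem_setMem, if_neg (by simp only [addedCell]; omega), i1]
        · rw [RamState.mem_setMem]
          split_ifs with he
          · obtain ⟨h1, h2⟩ := pos_inj q.2 hv he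
            obtain rfl : p = ⟨u, hu⟩ := Fin.ext h1
            obtain rfl : q = ⟨v, hv⟩ := Fin.ext h2
            exact (adjEntry_pos _ _ hc1).symm
          · refine i2 p q (((before_succ hu hv p q).1 hpq).resolve_right ?_)
            rintro ⟨rfl, rfl⟩
            exact he rfl
        · rw [before_succ hu hv, not_or] at hpq
          rw [RamState.mem_setMem, if_neg, i3 p q hpq.1]
          intro he
          obtain ⟨h1, h2⟩ := pos_inj q.2 hv he
          exact hpq.2 ⟨Fin.ext h1, Fin.ext h2⟩
        · split_ifs with huv
          · rw [ncard_before_succ_of_pos (Q := Q) hu hv ⟨huv, hc1, hc2⟩]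
          · rw [ncard_before_succ_of_neg (Q := Q) hu hv fun h => huv h.1]
      · have hrun : Cmd.run (.ite (adjEx 12 13) .skip (.when (neEx 12 13)
            (.when (.add (.ld (addedAddr 12 13)) (.ld (addedAddr 13 12)))
            (.seq (.store (posEx 12 13) (.lit 1)) (.when (.sub (.var 13) (.var 12))
            (.assign 14 (.add (.var 14) (.lit 1)))))))) t' = t' := by
          change (if _ then _ else _) = _
          split_ifs with c1
          · rfl
          · rw [Cmd.run_when]
            split_ifs with c2
            · rw [Cmd.run_when_neg fun c3 => hadd ⟨(hH _ _).2 (Or.inr ⟨e2.1 c2, e3.1 c3⟩),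
                fun h => c1 (e1.2 h)⟩]
            · rfl
        rw [hrun, t14, i4, ncard_before_succ_of_neg (Q := Q) hu hv fun h => hadd h.2]
        have hcur' : adjEntry G (n * u + v) = adjEntry H (n * u + v) := by
          by_cases h : G.Adj ⟨u, hu⟩ ⟨v, hv⟩
          · exact (adjEntry_pos ⟨u, hu⟩ ⟨v, hv⟩ h).trans
              (adjEntry_pos ⟨u, hu⟩ ⟨v, hv⟩ (hGH h)).symm
          · exact (adjEntry_neg ⟨u, hu⟩ ⟨v, hv⟩ h).trans
              (adjEntry_neg ⟨u, hu⟩ ⟨v, hv⟩ fun h' => hadd ⟨h', h⟩).symm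
        refine ⟨i1, fun p q hpq => ?_, fun p q hpq => ?_, rfl⟩
        · rcases (before_succ hu hv p q).1 hpq with h | ⟨rfl, rfl⟩
          · exact i2 p q h
          · exact hcur.trans hcur'
        · rw [before_succ hu hv, not_or] at hpq
          exact i3 p q hpq.1)
  refine ⟨holdsGraph_of_mem fun p q => this.2.1 p q (Or.inl p.2), this.2.2.2.trans ?_⟩
  rw [addedEdges_eq_ncard]
  congr 1
  ext e
  exact and_iff_right (Or.inl e.1.2)

/-- Any vertex is allowed in a cycle, so the maximum-degree rule is admissible everywhere and shapes
need not be recognised. -/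
theorem isHubChoice_firstMax [Nonempty (Fin n)] (k : ℕ) :
    IsHubChoice k G (firstMax G) := by
  have h : ∀ A, IsComponent G A → IsMaxDegreeIn G A (firstMax G A) := fun A hA =>
    (firstMax_spec (Set.nonempty_coe_sort.1 hA.1.1.nonempty)).1
  exact ⟨fun A hA => (h A hA.1).1, fun A _ hA => h A hA.1⟩

/-- A nonadjacent inseparable pair lies in a component, which is then a cycle or a cage and equals
the set that the program searches. Conversely, every cycle or cage contains such a pair. -/
theorem IsSC.joins_iff {k : ℕ} (hsc : IsSC k G) (hk : 5 ≤ k) [Nonempty (Fin n)] {p q : Fin n} :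
    (∃ x y, Joins G x y p q) ↔ ∃ A, IsBig k G A ∧ p = firstMax G A ∧ q ∈ A := by
  constructor
  · rintro ⟨x, y, hxy, hadj, hins, hp, hq⟩
    obtain ⟨A, hA, hQ⟩ := exists_isComponent_of_insep hsc.1.preconnected (Q := {x, y}) ⟨x, by simp⟩
      (by rintro a (rfl | rfl) b (rfl | rfl)
          exacts [Insep.refl _, hins, hins.symm, Insep.refl _])
    have hx : x ∈ A := hQ (by simp)
    have hy : y ∈ A := hQ (by simp)
    have hAe := hA.eq_setOf_insep hsc.1.preconnected hx hy hxy hadj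
    exact ⟨A, hsc.isBig hk hA hx hy hxy hadj, by rw [hAe]; exact hp, by rw [hAe]; exact hq⟩
  · rintro ⟨A, hA, hp, hq⟩
    obtain ⟨x, hx, y, hy, hxy, hadj⟩ := hA.exists_nonadj hk (isHubChoice_firstMax k)
    have hAe := hA.isComponent.eq_setOf_insep hsc.1.preconnected hx hy hxy hadj
    refine ⟨x, y, hxy, hadj, hA.isComponent.1.insep hx hy, by rw [hp, ← hAe], ?_⟩
    rw [hAe] at hq
    exact hq

theorem run_fillInCmd {k : ℕ} (hsc : IsSC k G) (hk : 5 ≤ k) : ∃ H, IsFillInOutput k G H ∧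
    HoldsGraph (fillInCmd.run (inputState G)) H ∧
    (fillInCmd.run (inputState G)).reg 14 = addedEdges G H := by
  have := hsc.1.nonempty
  set s0 := inputState G with hs0
  have h00 : s0.reg 0 = n := rfl
  obtain ⟨a1, a2, a3⟩ := run_insepMatrix h00 hsc.1.preconnected (storesAdj_of_mem fun _ _ => rfl)
  set s1 := insepMatrix.run s0 with hs1
  have h10 : s1.reg 0 = n := (Cmd.run_reg _ _ rfl).trans h00
  have hmem1 : ∀ u v : Fin n, s1.mem (n * u + v) = adjEntry G (n * u + v) := fun u v =>
    a1 _ (pos_lt u.2 v.2)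
  -- The block of added edges needs no initialisation: the input is zero from `n²` on, and
  -- `insepMatrix` leaves this block alone.
  obtain ⟨b1, b2⟩ := run_hubPhase ⟨h10, storesAdj_of_mem hmem1, a3⟩ fun p q => by
    have := pos_lt p.2 q.2
    rw [addedCell, a2 _ (by omega) (by omega)]
    exact adjEntry_of_le (by omega)
  set s2 := hubPhase.run s1 with hs2
  refine ⟨hubGraph k G (firstMax G), isFillInOutput_iff.2 ⟨_, isHubChoice_firstMax k, rfl⟩,
    run_outputPhase (s := s2) ((Cmd.run_reg _ _ rfl).trans h10) (fun u v => ?_) fun u v => ?_⟩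
  · rw [b1 _ (by have := pos_lt u.2 v.2; omega), hmem1]
  · rw [b2, b2, hsc.joins_iff hk, hsc.joins_iff hk, hubGraph_adj]
    refine or_congr Iff.rfl (and_congr Iff.rfl ?_)
    simp only [← exists_or, ← and_or_left]

theorem runs_fillInProg {k : ℕ} (hsc : IsSC k G) (hk : 5 ≤ k) : ∃ (H : SimpleGraph (Fin n))
    (s : RamState) (t : ℕ), Runs fillInProg (inputState G) s t ∧ t ≤ (fillInCmd.time + 1).eval n ∧
      IsFillInOutput k G H ∧ HoldsGraph s H ∧ s.reg 0 = addedEdges G H := by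
  obtain ⟨H, hH, h1, h2⟩ := run_fillInCmd hsc hk
  -- All variables of the command are below 16, so the auxiliary registers start there.
  obtain ⟨s, t, hrun, hag, -, ht⟩ := fillInCmd.runs_compile (B := 16) (by omega) rfl 16 (inputState G)
    (inputState G) le_rfl ⟨fun _ _ => rfl, rfl⟩
  refine ⟨H, _, _, Runs.seq hrun (Runs.copy 0 14 s), ?_, hH, fun i hi => ?_, ?_⟩
  · rw [Polynomial.eval_add, Polynomial.eval_one]
    exact Nat.add_le_add_right ht 1
  · rw [RamState.mem_setReg, hag.2]
    exact h1 i hi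
  · rw [RamState.reg_setReg, if_pos rfl, hag.1 14 (by omega), h2]

end Output
end SCGraph

theorem mainTheorem11 :
    -- Fill-in makes the graph chordal with the minimum number of additional edges
    (∀ (V : Type*) [Finite V] (k : ℕ) (G H : SimpleGraph V), 5 ≤ k → SCGraph.IsSC k G →
      SCGraph.IsFillInOutput k G H →
        G ≤ H ∧ SCGraph.IsChordal H ∧
        IsLeast (SCGraph.fillInSizes G) (SCGraph.addedEdges G H) ∧
        SCGraph.addedEdges G H = SCGraph.fillInCount k G) ∧
    -- one program runs Fill-in and computes the minimum fill-in, in polynomial time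
    (∃ (P : SCGraph.RamProg) (p : Polynomial ℕ),
      ∀ (n k : ℕ) (G : SimpleGraph (Fin n)), 5 ≤ k → SCGraph.IsSC k G →
        ∃ (H : SimpleGraph (Fin n)) (s : SCGraph.RamState) (t : ℕ),
          SCGraph.Runs P (SCGraph.inputState G) s t ∧ t ≤ p.eval n ∧
          SCGraph.IsFillInOutput k G H ∧ SCGraph.HoldsGraph s H ∧
          IsLeast (SCGraph.fillInSizes G) (s.reg 0)) := by
  refine ⟨fun V _ k G H hk hsc hH => hsc.fillIn_correct hk hH, SCGraph.fillInProg,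
    SCGraph.fillInCmd.time + 1, fun n k G hk hsc => ?_⟩
  obtain ⟨H, s, t, h1, h2, h3, h4, h5⟩ := SCGraph.runs_fillInProg hsc hk
  exact ⟨H, s, t, h1, h2, h3, h4, h5 ▸ (hsc.fillIn_correct hk h3).2.2.1⟩
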